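/- Let $n\geqslant 1$ and let $q$ be a nonzero complex number which is not a root of unity. Let $e_{ij}\in\mathrm{End}\,\mathbb C^n$ be the matrix units and put $$R(x)=\frac{f(x)}{q-q^{-1}x}\,(R-x\widetilde R),$$ $$R=q\sum_i e_{ii}\otimes e_{ii}+\sum_{i\ne j}e_{ii}\otimes e_{jj}+(q-q^{-1})\sum_{i<j}e_{ij}\otimes e_{ji},\qquad \widetilde R=q^{-1}\sum_i e_{ii}\otimes e_{ii}+\sum_{i\ne j}e_{ii}\otimes e_{jj}-(q-q^{-1})\sum_{i>j}e_{ij}\otimes e_{ji},$$ where $f(x)\in 1+x\,\mathbb C[[x]]$ is the unique series with $f(xq^{2n})=f(x)\dfrac{(1-xq^2)(1-xq^{2n-2})}{(1-x)(1-xq^{2n})}$. The quantum affine algebra $\mathrm U_q(\widehat{\mathfrak{gl}}_n)$ is the unital associative $\mathbb C$-algebra generated by $l^+_{ij}[-r]$, $l^-_{ij}[r]$ ($1\leqslant i,j\leqslant n$, $r=0,1,\dots$) and an invertible central element $q^c$, subject to the relations $l^+_{ji}[0]=l^-_{ij}[0]=0$ for $i<j$, $\;l^+_{ii}[0]\,l^-_{ii}[0]=l^-_{ii}[0]\,l^+_{ii}[0]=1$,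 and $$R(u/v)L_1^{\pm}(u)L_2^{\pm}(v)=L_2^{\pm}(v)L_1^{\pm}(u)R(u/v),\qquad R(uq^{-c}/v)L_1^{+}(u)L_2^{-}(v)=L_2^{-}(v)L_1^{+}(u)R(uq^{c}/v),$$ where $L^\pm(u)=[l^\pm_{ij}(u)]$ with $l^+_{ij}(u)=\sum_{r\geqslant0}l^+_{ij}[-r]u^r$ and $l^-_{ij}(u)=\sum_{r\geqslant0}l^-_{ij}[r]u^{-r}$, and where the subscript $1$ or $2$ indicates the copy of $\mathrm{End}\,\mathbb C^n$ in $\mathrm{End}\,\mathbb C^n\otimes\mathrm{End}\,\mathbb C^n$ to which the matrix belongs. Let $D=\mathrm{diag}\,[q^{n-1},q^{n-3},\dots,q^{-n+1}]$, let $t$ denote the matrix transposition $e_{ij}\mapsto e_{ji}$ (applied without changing the entries), and let $$\mathrm{qdet}\,L^{\pm}(u)=\sum_{\sigma\in\mathfrak S_n}(-q)^{-l(\sigma)}\,l^{\pm}_{\sigma(1)1}(uq^{2n-2})\,l^{\pm}_{\sigma(2)2}(uq^{2n-4})\cdots l^{\pm}_{\sigma(n)n}(u),$$ where $l(\sigma)$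 is the length of the permutation $\sigma$. Then, for each choice of the sign, the matrix $L^\pm(u)$ and the series $\mathrm{qdet}\,L^\pm(u)$ are invertible; there is a unique series $z^\pm(u)$ in $u^{\pm1}$ with coefficients in $\mathrm U_q(\widehat{\mathfrak{gl}}_n)$ such that $$L^{\pm}(uq^{2n})^t\,D\,(L^{\pm}(u)^{-1})^t=z^{\pm}(u)\,D;$$ the coefficients of $z^\pm(u)$ belong to the center of $\mathrm U_q(\widehat{\mathfrak{gl}}_n)$; and $$z^{\pm}(u)=\frac{\mathrm{qdet}\,L^{\pm}(uq^{2})}{\mathrm{qdet}\,L^{\pm}(u)},\qquad\text{that is,}\qquad z^\pm(u)=\mathrm{qdet}\,L^{\pm}(uq^{2})\,\bigl(\mathrm{qdet}\,L^{\pm}(u)\bigr)^{-1}.$$ -/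

import Mathlib

open scoped PowerSeries Kronecker

namespace QuantumAffine

/-- The two possible signs of the generator series `L⁺(u)` and `L⁻(u)`. -/
inductive PM
  | plus
  | minus

/-! ### The `R`-matrix -/

/-- The power series `(1 - x q²)(1 - x q²ⁿ⁻²) / ((1 - x)(1 - x q²ⁿ))`. -/
noncomputable def ratioSeries (q : ℂ) (n : ℕ) : ℂ⟦X⟧ :=
  (1 - PowerSeries.C (q ^ 2) * PowerSeries.X)
    * (1 - PowerSeries.C (q ^ (2 * (n : ℤ) - 2)) * PowerSeries.X)
    * ((1 - PowerSeries.X) * (1 - PowerSeries.C (q ^ (2 * n)) * PowerSeries.X))⁻¹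

/-- The coefficients `f_k`, computed recursively from
`f(x q²ⁿ) = f(x) (1 - x q²)(1 - x q²ⁿ⁻²) / ((1 - x)(1 - x q²ⁿ))` and `f_0 = 1`. -/
noncomputable def fCoeff (q : ℂ) (n : ℕ) : ℕ → ℂ
  | 0 => 1
  | k + 1 => ((q ^ (2 * n)) ^ (k + 1) - 1)⁻¹ *
      ∑ j : Fin (k + 1), fCoeff q n j * PowerSeries.coeff (k + 1 - j) (ratioSeries q n)

/-- The normalizing series `f(x) = 1 + f_1 x + f_2 x² + ⋯`. -/
noncomputable def fSeries (q : ℂ) (n : ℕ) : ℂ⟦X⟧ := PowerSeries.mk (fCoeff q n)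

/-- `R = q ∑ e_ii ⊗ e_ii + ∑_{i ≠ j} e_ii ⊗ e_jj + (q - q⁻¹) ∑_{i < j} e_ij ⊗ e_ji`;
`End ℂⁿ ⊗ End ℂⁿ` is identified with the matrices indexed by pairs through the
Kronecker product. -/
noncomputable def R0 (q : ℂ) (n : ℕ) : Matrix (Fin n × Fin n) (Fin n × Fin n) ℂ :=
  q • (∑ i : Fin n, Matrix.single i i (1 : ℂ) ⊗ₖ Matrix.single i i (1 : ℂ))
    + (∑ i : Fin n, ∑ j : Fin n,
        if i ≠ j then Matrix.single i i (1 : ℂ) ⊗ₖ Matrix.single j j (1 : ℂ) else 0)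
    + (q - q⁻¹) • (∑ i : Fin n, ∑ j : Fin n,
        if i < j then Matrix.single i j (1 : ℂ) ⊗ₖ Matrix.single j i (1 : ℂ) else 0)

/-- `R̃ = q⁻¹ ∑ e_ii ⊗ e_ii + ∑_{i ≠ j} e_ii ⊗ e_jj - (q - q⁻¹) ∑_{i > j} e_ij ⊗ e_ji`. -/
noncomputable def R1 (q : ℂ) (n : ℕ) : Matrix (Fin n × Fin n) (Fin n × Fin n) ℂ :=
  q⁻¹ • (∑ i : Fin n, Matrix.single i i (1 : ℂ) ⊗ₖ Matrix.single i i (1 : ℂ))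
    + (∑ i : Fin n, ∑ j : Fin n,
        if i ≠ j then Matrix.single i i (1 : ℂ) ⊗ₖ Matrix.single j j (1 : ℂ) else 0)
    - (q - q⁻¹) • (∑ i : Fin n, ∑ j : Fin n,
        if j < i then Matrix.single i j (1 : ℂ) ⊗ₖ Matrix.single j i (1 : ℂ) else 0)

/-- `R(x) = f(x) / (q - q⁻¹ x) · (R - x R̃)`, with entries in `ℂ[[x]]`. -/
noncomputable def RMatrix (q : ℂ) (n : ℕ) : Matrix (Fin n × Fin n) (Fin n × Fin n) ℂ⟦X⟧ :=
  (fSeries q n * (PowerSeries.C q - PowerSeries.C q⁻¹ * PowerSeries.X)⁻¹) •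
    ((R0 q n).map PowerSeries.C - (PowerSeries.X : ℂ⟦X⟧) • (R1 q n).map PowerSeries.C)

/-! ### The quantum affine algebra -/

/-- The generators `l⁺_ij[-r]`, `l⁻_ij[r]`, `q^c` and `q^{-c}`. -/
inductive Gen (n : ℕ)
  | lp (i j : Fin n) (r : ℕ)
  | lm (i j : Fin n) (r : ℕ)
  | qc
  | qcInv

/-- The free algebra on the generators. -/
abbrev Free (n : ℕ) : Type := FreeAlgebra ℂ (Gen n)

/-- The generator `g` in the free algebra. -/
def gen {n : ℕ} (g : Gen n) : Free n := FreeAlgebra.ι ℂ g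

/-- The coefficient of `u ^ r` (`r ∈ ℤ`) in the matrix `L^±(u)` of free generators:
`L⁺(u)` contains only nonnegative powers of `u` and `L⁻(u)` only nonpositive ones. -/
def freeMode {n : ℕ} : PM → ℤ → Matrix (Fin n) (Fin n) (Free n)
  | .plus, r => if 0 ≤ r then Matrix.of fun i j => gen (.lp i j r.toNat) else 0
  | .minus, r => if r ≤ 0 then Matrix.of fun i j => gen (.lm i j (-r).toNat) else 0

/-- The coefficient of `x ^ m` in `R(x)`. -/
noncomputable def RCoeff (q : ℂ) (n m : ℕ) :
    Matrix (Fin n × Fin n) (Fin n × Fin n) (Free n) :=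
  (RMatrix q n).map fun p => algebraMap ℂ (Free n) (PowerSeries.coeff m p)

/-- The coefficient of `u ^ a v ^ b` in `R(y u / v) L₁^s(u) L₂^t(v)`. For the sign pairs
`(+,+)`, `(-,-)`, `(+,-)` only finitely many terms of the sum are nonzero. -/
noncomputable def rllLeft (q : ℂ) (n : ℕ) (y : Free n) (s t : PM) (a b : ℤ) :
    Matrix (Fin n × Fin n) (Fin n × Fin n) (Free n) :=
  ∑ᶠ m : ℕ, y ^ m • (RCoeff q n m
    * (freeMode s (a - m) ⊗ₖ (1 : Matrix (Fin n) (Fin n) (Free n)))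
    * ((1 : Matrix (Fin n) (Fin n) (Free n)) ⊗ₖ freeMode t (b + m)))

/-- The coefficient of `u ^ a v ^ b` in `L₂^t(v) L₁^s(u) R(y u / v)`. -/
noncomputable def rllRight (q : ℂ) (n : ℕ) (y : Free n) (s t : PM) (a b : ℤ) :
    Matrix (Fin n × Fin n) (Fin n × Fin n) (Free n) :=
  ∑ᶠ m : ℕ, y ^ m • (((1 : Matrix (Fin n) (Fin n) (Free n)) ⊗ₖ freeMode t (b + m))
    * (freeMode s (a - m) ⊗ₖ (1 : Matrix (Fin n) (Fin n) (Free n)))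
    * RCoeff q n m)

/-- The defining relations; the relations between generator series are imposed on each
coefficient and each matrix entry. -/
inductive Rel (q : ℂ) (n : ℕ) : Free n → Free n → Prop
  | lp_zero (i j : Fin n) (h : i < j) : Rel q n (gen (.lp j i 0)) 0
  | lm_zero (i j : Fin n) (h : i < j) : Rel q n (gen (.lm i j 0)) 0
  | lp_lm (i : Fin n) : Rel q n (gen (.lp i i 0) * gen (.lm i i 0)) 1
  | lm_lp (i : Fin n) : Rel q n (gen (.lm i i 0) * gen (.lp i i 0)) 1
  | qc_qcInv : Rel q n (gen .qc * gen .qcInv) 1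
  | qcInv_qc : Rel q n (gen .qcInv * gen .qc) 1
  | qc_comm (g : Gen n) : Rel q n (gen .qc * gen g) (gen g * gen .qc)
  | rll (s : PM) (a b : ℤ) (i j : Fin n × Fin n) :
      Rel q n (rllLeft q n 1 s s a b i j) (rllRight q n 1 s s a b i j)
  | rllMixed (a b : ℤ) (i j : Fin n × Fin n) :
      Rel q n (rllLeft q n (gen .qcInv) .plus .minus a b i j)
        (rllRight q n (gen .qc) .plus .minus a b i j)

/-- The quantum affine algebra `U_q(ĝl_n)`. -/
abbrev Uq (q : ℂ) (n : ℕ) : Type := RingQuot (Rel q n)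

/-- The generators `l⁺_ij[-r]` (sign `plus`) and `l⁻_ij[r]` (sign `minus`) of `U_q(ĝl_n)`. -/
noncomputable def l (q : ℂ) (n : ℕ) : PM → Fin n → Fin n → ℕ → Uq q n
  | .plus, i, j, r => RingQuot.mkAlgHom ℂ (Rel q n) (gen (.lp i j r))
  | .minus, i, j, r => RingQuot.mkAlgHom ℂ (Rel q n) (gen (.lm i j r))

/-! ### Generating series

A series `∑_r a_r u^r` (sign `plus`) or `∑_r a_r u^{-r}` (sign `minus`) is the formal power
series with coefficients `a_r`; the variable is `u` for the sign `plus` and `u⁻¹` for the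
sign `minus`. -/

/-- The substitution `u ↦ u c` in a series in `u` (sign `plus`) or in `u⁻¹` (sign `minus`). -/
noncomputable def dilate {A : Type*} [Ring A] [Algebra ℂ A] (s : PM) (c : ℂ) (g : A⟦X⟧) :
    A⟦X⟧ :=
  match s with
  | .plus => PowerSeries.mk fun r => c ^ r • PowerSeries.coeff r g
  | .minus => PowerSeries.mk fun r => (c⁻¹) ^ r • PowerSeries.coeff r g

/-- The matrix `L^±(u)`. -/
noncomputable def LMat (q : ℂ) (n : ℕ) (s : PM) : Matrix (Fin n) (Fin n) (Uq q n)⟦X⟧ :=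
  Matrix.of fun i j => PowerSeries.mk (l q n s i j)

/-- `D = diag [q^{n-1}, q^{n-3}, …, q^{-n+1}]`. -/
noncomputable def DMat (q : ℂ) (n : ℕ) : Matrix (Fin n) (Fin n) (Uq q n)⟦X⟧ :=
  Matrix.diagonal fun i =>
    algebraMap ℂ (Uq q n)⟦X⟧ (q ^ ((n : ℤ) - 1 - 2 * ((i : ℕ) : ℤ)))

/-- The length of a permutation: its number of inversions. -/
def permLength {n : ℕ} (σ : Equiv.Perm (Fin n)) : ℕ :=
  (Finset.univ.filter fun p : Fin n × Fin n => p.1 < p.2 ∧ σ p.2 < σ p.1).card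

/-- The quantum determinant
`qdet L^±(u) = ∑_σ (-q)^{-l(σ)} l^±_{σ(1)1}(u q^{2n-2}) ⋯ l^±_{σ(n)n}(u)`. -/
noncomputable def qdet (q : ℂ) (n : ℕ) (s : PM) : (Uq q n)⟦X⟧ :=
  ∑ σ : Equiv.Perm (Fin n), (-q) ^ (-(permLength σ : ℤ)) •
    (List.ofFn fun k : Fin n =>
      dilate s (q ^ (2 * (n : ℤ) - 2 - 2 * ((k : ℕ) : ℤ))) (LMat q n s (σ k) k)).prod

/-- The defining relation `L^±(u q^{2n})^t D (L^±(u)^{-1})^t = z D` of the series `z`. -/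
def IsZSeries (q : ℂ) (n : ℕ) (s : PM) (z : (Uq q n)⟦X⟧) : Prop :=
  ((LMat q n s).map (dilate s (q ^ (2 * n)))).transpose * DMat q n
    * (Ring.inverse (LMat q n s)).transpose = z • DMat q n

/-! ### Characterization of the normalizing series -/

theorem ratioSeries_coeff_zero (q : ℂ) (n : ℕ) :
    PowerSeries.coeff 0 (ratioSeries q n) = 1 := by
  simp [ratioSeries]

theorem fSeries_coeff_zero (q : ℂ) (n : ℕ) : PowerSeries.coeff 0 (fSeries q n) = 1 := by
  simp [fSeries, fCoeff]

theorem fSeries_spec (q : ℂ) (n : ℕ) (hq : ∀ m : ℕ, 0 < m → q ^ m ≠ 1)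
    (hn : 0 < n) (g : ℂ⟦X⟧) :
    (PowerSeries.coeff 0 g = 1 ∧ PowerSeries.rescale (q ^ (2 * n)) g = g * ratioSeries q n)
      ↔ g = fSeries q n := by
  have hne : ∀ k : ℕ, (q ^ (2 * n)) ^ (k + 1) - 1 ≠ 0 := by
    intro k
    rw [← pow_mul]
    exact sub_ne_zero.2 (hq _ (by positivity))
  have key : ∀ (h : ℂ⟦X⟧) (k : ℕ), PowerSeries.coeff (k + 1) (h * ratioSeries q n)
      = (∑ j : Fin (k + 1), PowerSeries.coeff (j : ℕ) h
          * PowerSeries.coeff (k + 1 - j) (ratioSeries q n)) + PowerSeries.coeff (k + 1) h := by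
    intro h k
    rw [PowerSeries.coeff_mul, Finset.Nat.sum_antidiagonal_eq_sum_range_succ_mk,
      Finset.sum_range_succ, Finset.sum_range]
    simp [ratioSeries_coeff_zero, -PowerSeries.coeff_zero_eq_constantCoeff]
  constructor
  · rintro ⟨h0, h1⟩
    ext k
    induction k using Nat.strong_induction_on with
    | _ k ih =>
      cases k with
      | zero => rw [h0, fSeries_coeff_zero]
      | succ k =>
        have h2 := congrArg (PowerSeries.coeff (k + 1)) h1
        rw [key, PowerSeries.coeff_rescale] at h2
        have h3 : PowerSeries.coeff (k + 1) (fSeries q n)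
            = ((q ^ (2 * n)) ^ (k + 1) - 1)⁻¹ * ∑ j : Fin (k + 1),
              PowerSeries.coeff (j : ℕ) g * PowerSeries.coeff (k + 1 - j) (ratioSeries q n) := by
          rw [fSeries, PowerSeries.coeff_mk, fCoeff]
          congr 1
          refine Finset.sum_congr rfl fun j _ => ?_
          rw [ih j j.2, fSeries, PowerSeries.coeff_mk]
        rw [h3, eq_inv_mul_iff_mul_eq₀ (hne k)]
        linear_combination h2
  · rintro rfl
    refine ⟨fSeries_coeff_zero q n, ?_⟩
    ext k
    cases k with
    | zero =>
      rw [PowerSeries.coeff_rescale]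
      simp [fSeries_coeff_zero, ratioSeries_coeff_zero, PowerSeries.coeff_mul,
        -PowerSeries.coeff_zero_eq_constantCoeff]
    | succ k =>
      rw [key, PowerSeries.coeff_rescale]
      have h3 : PowerSeries.coeff (k + 1) (fSeries q n)
          = ((q ^ (2 * n)) ^ (k + 1) - 1)⁻¹ * ∑ j : Fin (k + 1),
            PowerSeries.coeff (j : ℕ) (fSeries q n)
              * PowerSeries.coeff (k + 1 - j) (ratioSeries q n) := by
        simp only [fSeries, PowerSeries.coeff_mk]
        rw [fCoeff]
      rw [eq_inv_mul_iff_mul_eq₀ (hne k)] at h3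
      linear_combination h3

end QuantumAffine

/-! Put p = (-q)⁻¹. Quantum determinants and fused R-matrices are both treated as determinants of a
chain of n matrices, obtained by contracting the chain against the q-sign of the row word. If
consecutive matrices satisfy `IsQPair`, the contraction is again q-alternating in the column word
(`IsQAlternating.contract`). A q-alternating function on words of length n is determined by its
value on 1 2 … n (`IsQAlternating.eq_qSign_smul`), so the contraction is the sign times a single
element, `chainDet`.

At u = q²v the matrix R - (u/v)R̃ degenerates to a q-antisymmetrizer, and the RLL relation says that
L(q²u), L(u) is such a pair (`LMat_isQPair`). Hence qdet L(u) is the determinant of the chain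
L(uq^{2n-2}), …, L(u). The minors of L(uq^{2n-2}), …, L(uq²) then occur in two Laplace expansions:
with L(uq^{2n}) in front they give qdet L(uq²), with L(u) at the end they give qdet L(u). The second
expansion expresses L(u)⁻¹ through these minors, with weights coming from moving a letter across a
word; up to sign the weights are the inverse of D. Substituting into the first expansion gives z
(`exists_inverse_LMat`).

Centrality of qdet uses the same mechanism for R itself: R-matrices at q²-spaced parameters form a
chain whose determinant is scalar (`chainDet_rFst`, `chainDet_rSnd`), and the RLL relation moves an
entry of L through det(R) · qdet L (`chainDet_exchange`). For equal signs det(R) is a product of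
linear forms, which are not zero divisors, and it cancels. For opposite signs the two sides carry
q^{-c} and q^c, so det(R) has to be independent of its argument. This is the role of f: its
functional equation makes det(R) invariant under x ↦ q²x, hence constant because q is not a root of
unity (`normSeries_eq`). -/

namespace QuantumAffine

/-! ### Alternating functions of words -/

/-- A function of words which vanishes on words with a repeated adjacent letter and is
multiplied by `p` when two adjacent letters are put in decreasing order. -/
structure IsQAlternating {n : ℕ} {A : Type*} [AddCommGroup A] [Module ℂ A] (p : ℂ)
    (g : List (Fin n) → A) : Prop where
  repeated : ∀ (w : List (Fin n)) (i : Fin n) (w' : List (Fin n)), g (w ++ i :: i :: w') = 0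
  swap : ∀ (w : List (Fin n)) (i j : Fin n) (w' : List (Fin n)), i < j →
    g (w ++ j :: i :: w') = p • g (w ++ i :: j :: w')

section Alternating

variable {n : ℕ} {A : Type*} [AddCommGroup A] [Module ℂ A] {p : ℂ}

theorem IsQAlternating.cons {g : List (Fin n) → A} (hg : IsQAlternating p g) (i : Fin n) :
    IsQAlternating p fun w => g (i :: w) where
  repeated w := hg.repeated (i :: w)
  swap w := hg.swap (i :: w)

/-- A swap of adjacent letters changes the value by an invertible factor, and common first letters
are absorbed by `IsQAlternating.cons`. Tracking only the vanishing avoids computing the power of p.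
-/
theorem IsQAlternating.eq_zero_iff_of_perm (hp : p ≠ 0) {w w' : List (Fin n)}
    (h : w.Perm w') {g : List (Fin n) → A} (hg : IsQAlternating p g) : g w = 0 ↔ g w' = 0 := by
  induction h generalizing g with
  | nil => rfl
  | cons i _ ih => exact ih (hg.cons i)
  | swap i j w =>
    rcases lt_trichotomy i j with h | rfl | h
    · have := hg.swap [] i j w h
      simp only [List.nil_append] at this
      rw [this, smul_eq_zero_iff_right hp]
    · rfl
    · have := hg.swap [] j i w h
      simp only [List.nil_append] at this
      rw [this, smul_eq_zero_iff_right hp]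
  | trans _ _ ih₁ ih₂ => exact (ih₁ hg).trans (ih₂ hg)

theorem IsQAlternating.eq_zero_of_not_nodup (hp : p ≠ 0) {g : List (Fin n) → A}
    (hg : IsQAlternating p g) {w : List (Fin n)} (hw : ¬ w.Nodup) : g w = 0 := by
  obtain ⟨a, ha⟩ := List.exists_duplicate_iff_not_nodup.2 hw
  -- A permutation brings the two equal letters next to each other at the front.
  obtain ⟨v, hv⟩ := (List.duplicate_iff_sublist.1 ha).exists_perm_append
  exact (hg.eq_zero_iff_of_perm hp hv).2 (hg.repeated [] a v)

theorem perm_finRange_of_nodup {w : List (Fin n)} (hw : w.Nodup) (hl : w.length = n) :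
    w.Perm (List.finRange n) := by
  refine (List.perm_ext_iff_of_nodup hw (List.nodup_finRange n)).2 fun a => ?_
  simp only [List.mem_finRange, iff_true]
  have h : w.toFinset = Finset.univ := by
    apply Finset.eq_univ_of_card
    rw [List.toFinset_card_of_nodup hw, hl, Fintype.card_fin]
  exact List.mem_toFinset.1 (h ▸ Finset.mem_univ a)

/-- The sign `p ^ inv w` of a word without repetitions, extended by zero. -/
noncomputable def qSign (p : ℂ) : List (Fin n) → ℂ
  | [] => 1
  | a :: w => (if a ∈ w then 0 else p ^ (w.countP (· < a))) * qSign p w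

theorem qSign_isQAlternating (p : ℂ) : IsQAlternating p (qSign p (n := n)) := by
  constructor
  · intro w i w'
    induction w with
    | nil => simp [qSign]
    | cons a w ih => simp [qSign, ih]
  · intro w i j w' hij
    induction w with
    | nil =>
      have h1 : ¬ j < i := hij.asymm
      simp only [List.nil_append, qSign, List.mem_cons, List.countP_cons, hij, h1, hij.ne,
        hij.ne', false_or, decide_true, decide_false, if_true, smul_eq_mul]
      split_ifs <;> first | contradiction | ring
    | cons a w ih =>
      have hperm : (w ++ j :: i :: w').Perm (w ++ i :: j :: w') :=
        (List.Perm.swap i j w').append_left w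
      simp only [List.cons_append, qSign, ih, hperm.mem_iff, hperm.countP_eq, smul_eq_mul]
      ring

theorem qSign_of_pairwise {p : ℂ} {w : List (Fin n)} (h : w.Pairwise (· < ·)) :
    qSign p w = 1 := by
  induction h with
  | nil => rfl
  | @cons a w ha _ ih =>
    have h1 : a ∉ w := fun hm => (ha a hm).false
    have h2 : w.countP (· < a) = 0 := by
      rw [List.countP_eq_zero]
      intro b hb
      simpa using (ha b hb).le
    simp [qSign, h1, h2, ih]

theorem qSign_finRange (p : ℂ) : qSign p (List.finRange n) = 1 :=
  qSign_of_pairwise (List.pairwise_lt_finRange n)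

theorem qSign_ne_zero {p : ℂ} (hp : p ≠ 0) {w : List (Fin n)} (hw : w.Nodup) :
    qSign p w ≠ 0 := by
  induction hw with
  | nil => simp [qSign]
  | @cons a w ha _ ih =>
    have h1 : a ∉ w := fun hm => ha a hm rfl
    simp [qSign, h1, ih, hp]

theorem qSign_of_not_nodup {p : ℂ} {w : List (Fin n)} (hw : ¬ w.Nodup) :
    qSign p w = 0 := by
  induction w with
  | nil => simp at hw
  | cons a w ih =>
    by_cases h : a ∈ w
    · simp [qSign, h]
    · rw [List.nodup_cons, not_and] at hw
      simp [qSign, ih (hw h)]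

/-- The difference of the two sides is q-alternating and vanishes on the increasing word, hence on
all its permutations; words with a repetition give zero on both sides. -/
theorem IsQAlternating.eq_qSign_smul (hp : p ≠ 0) {g : List (Fin n) → A}
    (hg : IsQAlternating p g) {w : List (Fin n)} (hw : w.length = n) :
    g w = qSign p w • g (List.finRange n) := by
  by_cases hnd : w.Nodup
  · have hd : IsQAlternating p fun v => g v - qSign p v • g (List.finRange n) := by
      constructor
      · intro v i v'
        simp [hg.repeated, (qSign_isQAlternating p).repeated]
      · intro v i j v' hij
        simp [hg.swap _ _ _ _ hij, (qSign_isQAlternating p).swap _ _ _ _ hij, smul_sub, mul_smul]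
    exact sub_eq_zero.1 ((hd.eq_zero_iff_of_perm hp (perm_finRange_of_nodup hnd hw)).2
      (by simp [qSign_finRange]))
  · rw [hg.eq_zero_of_not_nodup hp hnd, qSign_of_not_nodup hnd, zero_smul]

theorem qSign_append_singleton (p : ℂ) (r : List (Fin n)) (i : Fin n) :
    qSign p (r ++ [i]) = (if i ∈ r then 0 else p ^ (r.countP (i < ·))) * qSign p r := by
  induction r with
  | nil => simp [qSign]
  | cons a r ih =>
    by_cases h2 : i ∈ r
    · simp [qSign, ih, h2]
    by_cases h1 : a ∈ r
    · simp [qSign, h1]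
    by_cases h3 : i = a
    · simp [qSign, h3]
    simp only [List.cons_append, qSign, ih, List.mem_append, List.mem_cons, h1, h2, h3,
      Ne.symm h3, List.countP_append, List.countP_cons, List.countP_nil, List.not_mem_nil,
      or_self, if_false, decide_eq_true_eq, zero_add, pow_add]
    ring

/-- Moving the first letter of a word of length `n` to the end. -/
theorem qSign_rotate (p : ℂ) (r : List (Fin n)) (i : Fin n) (hr : r.length + 1 = n) :
    p ^ (i : ℕ) * qSign p (r ++ [i]) = p ^ (n - 1 - (i : ℕ)) * qSign p (i :: r) := by
  rw [qSign_append_singleton, qSign]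
  by_cases h : i ∈ r
  · simp [h]
  by_cases hnd : r.Nodup
  · have hperm := perm_finRange_of_nodup (List.nodup_cons.2 ⟨h, hnd⟩) (by simpa using hr)
    -- Since i :: r is a permutation of all letters, r contains exactly i letters below i, and the
    -- remaining n - 1 - i lie above.
    have h1 : r.countP (· < i) = i := by
      have h2 := hperm.countP_eq (· < i)
      simp only [List.countP_cons, lt_irrefl, decide_false, Bool.false_eq_true, if_false,
        add_zero] at h2
      rw [h2, ← Multiset.coe_countP, Multiset.countP_eq_card_filter]
      exact (congrArg Finset.card (by ext; simp : Finset.univ.filter (· < i) = Finset.Iio i)).trans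
        (Fin.card_Iio i)
    have h5 : r.countP (· < i) + r.countP (i < ·) = r.length := by
      clear hr hnd hperm h1
      induction r with
      | nil => simp
      | cons a r ih =>
        rw [List.mem_cons, not_or] at h
        have := ih h.2
        simp only [List.countP_cons, List.length_cons, decide_eq_true_eq]
        rcases lt_or_gt_of_ne h.1 with h' | h'
        · simp [h', h'.not_gt]; omega
        · simp [h', h'.not_gt]; omega
    have h6 : r.countP (i < ·) = n - 1 - i := by omega
    rw [h1, h6]
    simp only [h, if_false]
    ring
  · simp [qSign_of_not_nodup hnd]

end Alternating

/-! ### Contractions of chains of matrices -/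

section Contraction

variable {n : ℕ} {A : Type*} [Ring A]

/-- The sum `∑ X⁽¹⁾_{i₁ c₁} ⋯ X⁽ᵐ⁾_{i_m c_m} g(i₁, …, i_m)`. -/
def contract : List (Matrix (Fin n) (Fin n) A) → (List (Fin n) → A) → List (Fin n) → A
  | [], g, [] => g []
  | [], _, _ :: _ => 0
  | _ :: _, _, [] => 0
  | X :: Xs, g, c :: cs => ∑ i, X i c * contract Xs (fun w => g (i :: w)) cs

theorem contract_zero (Xs : List (Matrix (Fin n) (Fin n) A)) (cs : List (Fin n)) :
    contract Xs (fun _ => 0) cs = 0 := by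
  induction Xs generalizing cs with
  | nil => cases cs <;> rfl
  | cons X Xs ih => cases cs <;> simp [contract, ih]

theorem contract_add (Xs : List (Matrix (Fin n) (Fin n) A)) (g h : List (Fin n) → A)
    (cs : List (Fin n)) :
    contract Xs (fun w => g w + h w) cs = contract Xs g cs + contract Xs h cs := by
  induction Xs generalizing cs g h with
  | nil => cases cs <;> simp [contract]
  | cons X Xs ih =>
    cases cs
    · simp [contract]
    · simp [contract, ih, mul_add, Finset.sum_add_distrib]

theorem contract_sum {κ : Type*} (s : Finset κ) (Xs : List (Matrix (Fin n) (Fin n) A))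
    (g : κ → List (Fin n) → A) (cs : List (Fin n)) :
    contract Xs (fun w => ∑ k ∈ s, g k w) cs = ∑ k ∈ s, contract Xs (g k) cs := by
  classical
  induction s using Finset.induction_on with
  | empty => simp [contract_zero]
  | insert a s ha ih => simp [Finset.sum_insert ha, contract_add, ih]

theorem contract_mul_left (Xs : List (Matrix (Fin n) (Fin n) A)) (g : List (Fin n) → A)
    (cs : List (Fin n)) (a : A) (ha : ∀ X ∈ Xs, ∀ i j, Commute a (X i j)) :
    contract Xs (fun w => a * g w) cs = a * contract Xs g cs := by
  induction Xs generalizing cs g with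
  | nil => cases cs <;> simp [contract]
  | cons X Xs ih =>
    cases cs with
    | nil => simp [contract]
    | cons c cs =>
      simp only [contract, Finset.mul_sum]
      refine Finset.sum_congr rfl fun i _ => ?_
      rw [ih _ _ fun Y hY => ha Y (List.mem_cons_of_mem _ hY), ← mul_assoc, ← mul_assoc,
        (ha X List.mem_cons_self i c).eq]

theorem contract_mul_right (Xs : List (Matrix (Fin n) (Fin n) A)) (g : List (Fin n) → A)
    (cs : List (Fin n)) (a : A) :
    contract Xs (fun w => g w * a) cs = contract Xs g cs * a := by
  induction Xs generalizing cs g with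
  | nil => cases cs <;> simp [contract]
  | cons X Xs ih => cases cs <;> simp [contract, ih, Finset.sum_mul, mul_assoc]

theorem contract_congr (Xs : List (Matrix (Fin n) (Fin n) A)) (g h : List (Fin n) → A)
    (cs : List (Fin n)) (hgh : ∀ w : List (Fin n), w.length = Xs.length → g w = h w) :
    contract Xs g cs = contract Xs h cs := by
  induction Xs generalizing cs g h with
  | nil => cases cs <;> simp [contract, hgh]
  | cons X Xs ih =>
    cases cs with
    | nil => rfl
    | cons c cs =>
      simp only [contract]
      refine Finset.sum_congr rfl fun i _ => ?_
      rw [ih _ _ _ fun w hw => hgh (i :: w) (by simpa using hw)]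

theorem commute_contract (Xs : List (Matrix (Fin n) (Fin n) A)) (g : List (Fin n) → A)
    (cs : List (Fin n)) (a : A) (ha : ∀ X ∈ Xs, ∀ i j, Commute a (X i j))
    (hg : ∀ w, Commute a (g w)) : Commute a (contract Xs g cs) := by
  induction Xs generalizing cs g with
  | nil => cases cs <;> simp [contract, hg]
  | cons X Xs ih =>
    cases cs with
    | nil => simp [contract]
    | cons c cs =>
      exact Commute.sum_right _ _ _ fun i _ => (ha X List.mem_cons_self i c).mul_right
        (ih _ _ (fun Y hY => ha Y (List.mem_cons_of_mem _ hY)) fun w => hg _)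

theorem map_contract {A' : Type*} [Ring A'] (φ : A →+* A')
    (Xs : List (Matrix (Fin n) (Fin n) A)) (g : List (Fin n) → A) (cs : List (Fin n)) :
    φ (contract Xs g cs) = contract (Xs.map fun X => X.map φ) (fun w => φ (g w)) cs := by
  induction Xs generalizing cs g with
  | nil => cases cs <;> simp [contract]
  | cons X Xs ih => cases cs <;> simp [contract, ih]

theorem contract_append_singleton (Xs : List (Matrix (Fin n) (Fin n) A))
    (X : Matrix (Fin n) (Fin n) A) (g : List (Fin n) → A) (cs : List (Fin n)) (c : Fin n)
    (hl : Xs.length = cs.length) :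
    contract (Xs ++ [X]) g (cs ++ [c])
      = contract Xs (fun w => ∑ i, X i c * g (w ++ [i])) cs := by
  induction Xs generalizing cs g with
  | nil =>
    obtain rfl : cs = [] := by simpa using hl.symm
    simp [contract]
  | cons Y Xs ih =>
    cases cs with
    | nil => simp at hl
    | cons d cs =>
      simp only [List.cons_append, contract]
      refine Finset.sum_congr rfl fun i _ => ?_
      rw [ih _ _ (by simpa using hl)]

/-- Every entry of a Q moves to the left of the P entries preceding it, which separates the two
chains. This is the source of multiplicativity of the determinant. -/
theorem contract_mul {κ : Type*} (ks : List κ) (P Q : κ → Matrix (Fin n) (Fin n) A)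
    (hPQ : ∀ k l i j i' j', Commute (P k i j) (Q l i' j')) (g : List (Fin n) → A)
    (cs : List (Fin n)) :
    contract (ks.map fun k => P k * Q k) g cs
      = contract (ks.map Q) (fun w => contract (ks.map P) g w) cs := by
  induction ks generalizing cs g with
  | nil => cases cs <;> rfl
  | cons k ks ih =>
    cases cs with
    | nil => rfl
    | cons c cs =>
      simp only [List.map_cons, contract, contract_sum, Matrix.mul_apply, Finset.sum_mul, ih,
        Finset.mul_sum]
      rw [Finset.sum_comm]
      refine Finset.sum_congr rfl fun j _ => Finset.sum_congr rfl fun i _ => ?_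
      rw [contract_mul_left, ← mul_assoc, (hPQ k k i j j c).eq]
      intro X hX i' j'
      obtain ⟨l, -, rfl⟩ := List.mem_map.1 hX
      exact hPQ _ _ _ _ _ _

/-- T passes through the factors one at a time, starting with the rightmost. -/
theorem contract_mul_eq_mul_contract {κ : Type*} (ks : List κ)
    (Y Y' : κ → Matrix (Fin n) (Fin n) A) (T : A)
    (hT : ∀ k i j, Y k i j * T = T * Y' k i j) (g : List (Fin n) → A)
    (hg : ∀ w, Commute (g w) T) (cs : List (Fin n)) :
    contract (ks.map Y) g cs * T = T * contract (ks.map Y') g cs := by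
  induction ks generalizing cs g with
  | nil =>
    cases cs
    · exact hg []
    · simp [contract]
  | cons k ks ih =>
    cases cs with
    | nil => simp [contract]
    | cons c cs =>
      simp only [List.map_cons, contract, Finset.sum_mul, Finset.mul_sum]
      refine Finset.sum_congr rfl fun i _ => ?_
      rw [mul_assoc, ih _ fun w => hg _, ← mul_assoc, hT, mul_assoc]

theorem contract_ofFn {m : ℕ} (X : Fin m → Matrix (Fin n) (Fin n) A) (g : List (Fin n) → A)
    (c : Fin m → Fin n) :
    contract (List.ofFn X) g (List.ofFn c)
      = ∑ i : Fin m → Fin n, (List.ofFn fun k => X k (i k) (c k)).prod * g (List.ofFn i) := by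
  induction m generalizing g with
  | zero => simp [contract]
  | succ m ih =>
    rw [← (Fin.consEquiv fun _ => Fin n).sum_comp, Fintype.sum_prod_type]
    simp only [List.ofFn_succ, contract, ih, Finset.mul_sum, List.prod_cons, Fin.consEquiv_apply,
      Fin.cons_zero, Fin.cons_succ, mul_assoc]

end Contraction

/-! ### Chains of `q`-commuting matrices and their determinants -/

section QuantumDeterminant

variable {n : ℕ} {A : Type*} [Ring A] [Algebra ℂ A] {p : ℂ}

/-- The relations between the entries of two matrices which make the products of columns
in the quantum exterior algebra skew-commute. -/
structure IsQPair (p : ℂ) (X Y : Matrix (Fin n) (Fin n) A) : Prop where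
  same : ∀ i j k, i < j → X i k * Y j k + p • (X j k * Y i k) = 0
  diff : ∀ i j k l, i < j → k < l →
    X i l * Y j k + p • (X j l * Y i k) = p • (X i k * Y j l + p • (X j k * Y i l))

theorem contract_smul (Xs : List (Matrix (Fin n) (Fin n) A)) (g : List (Fin n) → A)
    (cs : List (Fin n)) (a : ℂ) :
    contract Xs (fun w => a • g w) cs = a • contract Xs g cs := by
  simp only [Algebra.smul_def]
  exact contract_mul_left _ _ _ _ fun X _ i j => Algebra.commutes _ _

theorem sum_sum_eq_sum_lt {M : Type*} [AddCommMonoid M] (f : Fin n → Fin n → M)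
    (hf : ∀ i, f i i = 0) :
    ∑ i, ∑ j, f i j = ∑ i, ∑ j, if i < j then f i j + f j i else 0 := by
  have h : ∀ i j, f i j = (if i < j then f i j else 0) + if j < i then f i j else 0 := by
    intro i j
    rcases lt_trichotomy i j with h | rfl | h
    · simp [h, h.not_gt]
    · simp [hf]
    · simp [h, h.not_gt]
  have h2 : ∀ i j, (if i < j then f i j + f j i else 0)
      = (if i < j then f i j else 0) + if i < j then f j i else 0 := by
    intro i j; split_ifs <;> simp
  simp_rw [h2, Finset.sum_add_distrib]
  rw [Finset.sum_comm (f := fun i j => if i < j then f j i else 0), ← Finset.sum_add_distrib]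
  refine Finset.sum_congr rfl fun i _ => ?_
  rw [← Finset.sum_add_distrib]
  exact Finset.sum_congr rfl fun j _ => h i j

/-- Folding the double sum onto pairs i < j produces exactly the combinations of entries that occur
in `IsQPair`. -/
theorem IsQPair.sum_eq {X Y : Matrix (Fin n) (Fin n) A} {G : Fin n → Fin n → A}
    (h0 : ∀ i, G i i = 0) (h1 : ∀ i j, i < j → G j i = p • G i j) (c d : Fin n) :
    ∑ i, X i c * ∑ j, Y j d * G i j
      = ∑ i, ∑ j, if i < j then (X i c * Y j d + p • (X j c * Y i d)) * G i j else 0 := by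
  simp only [Finset.mul_sum]
  rw [sum_sum_eq_sum_lt _ fun i => by simp [h0]]
  refine Finset.sum_congr rfl fun i _ => Finset.sum_congr rfl fun j _ => ?_
  split_ifs with hij
  · rw [h1 i j hij, add_mul, smul_mul_assoc, mul_assoc, mul_assoc, mul_smul_comm, mul_smul_comm]
  · rfl

/-- Induction on the chain. Away from the first two columns the claim is inherited from the tail. At
the first two columns, folding the sum over rows leaves the quantities of `IsQPair`: `same` kills a
repeated column and `diff` gives the factor p for a transposed pair. -/
theorem IsQAlternating.contract {Xs : List (Matrix (Fin n) (Fin n) A)}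
    (hX : Xs.IsChain (IsQPair p)) {g : List (Fin n) → A} (hg : IsQAlternating p g) :
    IsQAlternating p (contract Xs g) := by
  induction Xs generalizing g with
  | nil =>
    -- The word is longer than the chain, so every contraction is zero by default.
    have h : ∀ (w : List (Fin n)) (i j : Fin n) (w' : List (Fin n)),
        QuantumAffine.contract ([] : List (Matrix (Fin n) (Fin n) A)) g (w ++ i :: j :: w') = 0 :=
      fun w _ _ _ => by cases w <;> rfl
    exact ⟨fun w i w' => h _ _ _ _, fun w i j w' _ => by rw [h, h, smul_zero]⟩
  | cons X Xs ih =>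
    have hXs : Xs.IsChain (IsQPair p) := hX.of_cons
    cases Xs with
    | nil =>
      have h : ∀ (w : List (Fin n)) (i j : Fin n) (w' : List (Fin n)),
          QuantumAffine.contract [X] g (w ++ i :: j :: w') = 0 := by
        rintro (_ | ⟨a, _ | ⟨b, w⟩⟩) _ _ _ <;> simp [QuantumAffine.contract]
      exact ⟨fun w i w' => h _ _ _ _, fun w i j w' _ => by rw [h, h, smul_zero]⟩
    | cons Y Xs =>
      have hXY : IsQPair p X Y := (List.isChain_cons_cons.1 hX).1
      have h0 : ∀ (cs : List (Fin n)) (i : Fin n),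
          QuantumAffine.contract Xs (fun w => g (i :: i :: w)) cs = 0 := fun cs i => by
        rw [← contract_zero Xs cs]
        exact contract_congr _ _ _ _ fun w _ => hg.repeated [] i w
      have h1 : ∀ (cs : List (Fin n)) (i j : Fin n), i < j →
          QuantumAffine.contract Xs (fun w => g (j :: i :: w)) cs
            = p • QuantumAffine.contract Xs (fun w => g (i :: j :: w)) cs := fun cs i j hij => by
        rw [← contract_smul]
        exact contract_congr _ _ _ _ fun w _ => hg.swap [] i j w hij
      constructor
      · rintro (_ | ⟨a, w⟩) k w'
        · simp only [List.nil_append, QuantumAffine.contract]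
          rw [IsQPair.sum_eq (h0 w') (h1 w')]
          refine Finset.sum_eq_zero fun i _ => Finset.sum_eq_zero fun j _ => ?_
          split_ifs with hij
          · rw [hXY.same i j k hij, zero_mul]
          · rfl
        · rw [List.cons_append, QuantumAffine.contract]
          exact Finset.sum_eq_zero fun i _ => by rw [(ih hXs (hg.cons i)).repeated, mul_zero]
      · rintro (_ | ⟨a, w⟩) k l w' hkl
        · simp only [List.nil_append, QuantumAffine.contract]
          rw [IsQPair.sum_eq (h0 w') (h1 w'), IsQPair.sum_eq (h0 w') (h1 w')]
          simp only [Finset.smul_sum]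
          refine Finset.sum_congr rfl fun i _ => Finset.sum_congr rfl fun j _ => ?_
          split_ifs with hij
          · rw [hXY.diff i j k l hij hkl, smul_mul_assoc]
          · rw [smul_zero]
        · rw [List.cons_append, List.cons_append, QuantumAffine.contract,
            QuantumAffine.contract, Finset.smul_sum]
          exact Finset.sum_congr rfl fun i _ => by
            rw [(ih hXs (hg.cons i)).swap _ _ _ _ hkl, mul_smul_comm]

/-- The sign of a word as an element of an algebra. -/
noncomputable def algSign (A : Type*) [Ring A] [Algebra ℂ A] (p : ℂ) (w : List (Fin n)) : A :=
  algebraMap ℂ A (qSign p w)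

theorem algSign_isQAlternating : IsQAlternating p (algSign (n := n) A p) where
  repeated w i w' := by rw [algSign, (qSign_isQAlternating p).repeated, map_zero]
  swap w i j w' h := by
    rw [algSign, algSign, (qSign_isQAlternating p).swap w i j w' h, smul_eq_mul, map_mul,
      Algebra.smul_def]

/-- The quantum determinant of a chain of matrices. -/
noncomputable def chainDet (p : ℂ) (Xs : List (Matrix (Fin n) (Fin n) A)) : A :=
  contract Xs (algSign A p) (List.finRange n)

/-- Exchanging columns changes the determinant by the q-sign; this is the form in which
q-alternation is used later. -/
theorem contract_algSign (hp : p ≠ 0) {Xs : List (Matrix (Fin n) (Fin n) A)}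
    (hX : Xs.IsChain (IsQPair p)) {cs : List (Fin n)} (hcs : cs.length = n) :
    contract Xs (algSign A p) cs = algSign A p cs * chainDet p Xs := by
  rw [(algSign_isQAlternating.contract hX).eq_qSign_smul hp hcs, Algebra.smul_def]
  rfl

theorem commute_algSign (w : List (Fin n)) (a : A) : Commute (algSign A p w) a :=
  Algebra.commutes _ _

theorem map_chainDet {A' : Type*} [Ring A'] [Algebra ℂ A'] (φ : A →ₐ[ℂ] A')
    (Xs : List (Matrix (Fin n) (Fin n) A)) :
    φ (chainDet p Xs) = chainDet p (Xs.map fun X => X.map φ) := by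
  have h := map_contract φ.toRingHom Xs (algSign A p) (List.finRange n)
  rw [chainDet, chainDet]
  refine h.trans ?_
  congr 1
  funext w
  exact φ.commutes _

theorem commute_chainDet {Xs : List (Matrix (Fin n) (Fin n) A)} {a : A}
    (ha : ∀ X ∈ Xs, ∀ i j, Commute a (X i j)) : Commute a (chainDet p Xs) :=
  commute_contract _ _ _ _ ha fun w => (commute_algSign w a).symm

/-- The complementary minors of a chain of `n - 1` matrices. -/
noncomputable def chainMinor (p : ℂ) (Xs : List (Matrix (Fin n) (Fin n) A)) (i : Fin n)
    (cs : List (Fin n)) : A :=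
  contract Xs (fun w => algSign A p (i :: w)) cs

/-- Laplace expansion along the first matrix of the chain. -/
theorem sum_mul_chainMinor (hp : p ≠ 0) {X : Matrix (Fin n) (Fin n) A}
    {Xs : List (Matrix (Fin n) (Fin n) A)} (hX : (X :: Xs).IsChain (IsQPair p))
    {cs : List (Fin n)} (hcs : cs.length + 1 = n) (c : Fin n) :
    ∑ i, X i c * chainMinor p Xs i cs = algSign A p (c :: cs) * chainDet p (X :: Xs) := by
  rw [← contract_algSign hp hX (by simpa using hcs)]
  rfl

/-- Laplace expansion along the last matrix. `qSign_rotate` moves the last letter to the front, so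
the minors are those of `sum_mul_chainMinor`, at the price of the weights p^{n-1-i} / p^i. -/
theorem sum_chainMinor_mul (hp : p ≠ 0) {X : Matrix (Fin n) (Fin n) A}
    {Xs : List (Matrix (Fin n) (Fin n) A)} (hX : (Xs ++ [X]).IsChain (IsQPair p))
    (hXs : Xs.length + 1 = n) {cs : List (Fin n)} (hcs : cs.length + 1 = n) (c : Fin n) :
    ∑ i : Fin n, (p ^ (n - 1 - (i : ℕ)) / p ^ (i : ℕ)) • (chainMinor p Xs i cs * X i c)
      = (p ^ (n - 1 - (c : ℕ)) / p ^ (c : ℕ)) •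
        (algSign A p (c :: cs) * chainDet p (Xs ++ [X])) := by
  have key : ∀ (r : List (Fin n)) (i : Fin n), r.length + 1 = n →
      algSign A p (r ++ [i]) = (p ^ (n - 1 - (i : ℕ)) / p ^ (i : ℕ)) • algSign A p (i :: r) := by
    intro r i hr
    rw [algSign, algSign, Algebra.smul_def, ← map_mul]
    congr 1
    have := qSign_rotate p r i hr
    have h0 : p ^ (i : ℕ) ≠ 0 := pow_ne_zero _ hp
    field_simp
    linear_combination this
  have h := contract_algSign (A := A) hp hX (cs := cs ++ [c]) (by simpa using hcs)
  rw [key cs c hcs, contract_append_singleton _ _ _ _ _ (by omega), contract_sum,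
    smul_mul_assoc] at h
  rw [← h]
  refine Finset.sum_congr rfl fun i _ => ?_
  rw [chainMinor, ← contract_mul_right, ← contract_smul]
  refine contract_congr _ _ _ _ fun w hw => ?_
  rw [key w i (by omega), mul_smul_comm, (commute_algSign (i :: w) (X i c)).eq]

/-- After the chains are separated, the inner contraction is det P times the sign, and det P
commutes with every Q entry. Only the P chain has to consist of q-pairs. -/
theorem contract_algSign_mul {κ : Type*} (hp : p ≠ 0) (ks : List κ)
    (P Q : κ → Matrix (Fin n) (Fin n) A)
    (hPQ : ∀ k l i j i' j', Commute (P k i j) (Q l i' j'))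
    (hP : (ks.map P).IsChain (IsQPair p)) (hk : ks.length = n) :
    chainDet p (ks.map fun k => P k * Q k) = chainDet p (ks.map P) * chainDet p (ks.map Q) := by
  rw [chainDet, contract_mul _ _ _ hPQ]
  have hc : ∀ X ∈ ks.map Q, ∀ i j, Commute (chainDet p (ks.map P)) (X i j) := by
    intro X hX i j
    obtain ⟨l, -, rfl⟩ := List.mem_map.1 hX
    refine (commute_chainDet fun Y hY i' j' => ?_).symm
    obtain ⟨k, -, rfl⟩ := List.mem_map.1 hY
    exact (hPQ _ _ _ _ _ _).symm
  rw [contract_congr _ _ (fun w => chainDet p (ks.map P) * algSign A p w), contract_mul_left _ _ _ _ hc]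
  · rfl
  · intro w hw
    rw [contract_algSign hp hP (by simpa [hk] using hw), (commute_algSign _ _).eq]

/-- Row words with a repetition have sign zero, so only permutations remain. -/
theorem chainDet_ofFn (Xs : Fin n → Matrix (Fin n) (Fin n) A) :
    chainDet p (List.ofFn Xs) = ∑ σ : Equiv.Perm (Fin n), qSign p (List.ofFn σ) •
      (List.ofFn fun k => Xs k (σ k) k).prod := by
  classical
  rw [chainDet, ← List.ofFn_id, contract_ofFn]
  symm
  refine Finset.sum_of_injOn (fun σ : Equiv.Perm (Fin n) => (σ : Fin n → Fin n))
    (fun σ _ τ _ h => Equiv.coe_fn_injective h) (fun _ _ => Finset.mem_coe.2 (Finset.mem_univ _))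
    ?_ ?_
  · intro i _ hi
    have h : ¬ (List.ofFn i).Nodup := by
      rw [List.nodup_ofFn]
      intro hinj
      exact hi ⟨Equiv.ofBijective i (Finite.injective_iff_bijective.1 hinj), by simp, rfl⟩
    rw [algSign, qSign_of_not_nodup h, map_zero, mul_zero]
  · intro σ _
    rw [Algebra.smul_def, Algebra.commutes]
    rfl

theorem qSign_ofFn {m : ℕ} (f : Fin m → Fin n) (hf : Function.Injective f) :
    qSign p (List.ofFn f)
      = p ^ (Finset.univ.filter fun x : Fin m × Fin m => x.1 < x.2 ∧ f x.2 < f x.1).card := by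
  induction m with
  | zero => simp [qSign]
  | succ m ih =>
    rw [List.ofFn_succ, qSign, ih (fun i => f i.succ) (hf.comp (Fin.succ_injective m))]
    have h1 : f 0 ∉ List.ofFn fun i : Fin m => f i.succ := by
      rw [List.mem_ofFn]
      rintro ⟨i, hi⟩
      exact Fin.succ_ne_zero i (hf hi)
    rw [if_neg h1, ← pow_add]
    congr 1
    have h2 : (List.ofFn fun i : Fin m => f i.succ).countP (· < f 0)
        = (Finset.univ.filter fun i : Fin m => f i.succ < f 0).card := by
      rw [List.ofFn_eq_map, List.countP_map, List.countP_eq_length_filter]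
      rfl
    rw [h2]
    simp only [Finset.card_filter, Fintype.sum_prod_type, Fin.sum_univ_succ, Fin.succ_lt_succ_iff,
      false_and, if_false, Fin.succ_pos, true_and, Fin.not_lt_zero, zero_add]

/-- The exchange of a chain determinant with an element intertwining the chain with another
chain. -/
theorem chainDet_exchange {κ : Type*} (hp : p ≠ 0) {ks : List κ} (hk : ks.length = n)
    {r r' X : κ → Matrix (Fin n) (Fin n) A} {T : A}
    (hr : (ks.map r).IsChain (IsQPair p)) (hX : (ks.map X).IsChain (IsQPair p))
    (hrX : ∀ k l i j i' j', Commute (r k i j) (X l i' j'))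
    (hXr : ∀ k l i j i' j', Commute (X k i j) (r' l i' j')) :
    ((∀ k i j, (r k * X k) i j * T = T * (X k * r' k) i j) →
      chainDet p (ks.map r) * chainDet p (ks.map X) * T
        = T * (chainDet p (ks.map X) * chainDet p (ks.map r')))
    ∧ ((∀ k i j, T * (r k * X k) i j = (X k * r' k) i j * T) →
      T * (chainDet p (ks.map r) * chainDet p (ks.map X))
        = chainDet p (ks.map X) * chainDet p (ks.map r') * T) := by
  -- Both products are determinants of the fused chains r_k X_k and X_k r'_k, which T intertwines
  -- factor by factor.
  rw [← contract_algSign_mul hp ks r X hrX hr hk, ← contract_algSign_mul hp ks X r' hXr hX hk]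
  exact ⟨fun h => contract_mul_eq_mul_contract ks _ _ T h _ (fun w => commute_algSign w T) _,
    fun h => (contract_mul_eq_mul_contract ks _ _ T (fun k i j => (h k i j).symm) _
      (fun w => commute_algSign w T) _).symm⟩

end QuantumDeterminant

/-! ### The `R`-matrix as a chain of matrices with matrix entries -/

section RMatrixEntries

variable {n : ℕ} {K : Type*} [CommRing K] [Algebra ℂ K] {q : ℂ}

theorem sum_single_diag_apply (i a j b : Fin n) :
    ∑ x : Fin n, ((if x = i ∧ x = j then (1 : ℂ) else 0) * if x = a ∧ x = b then (1 : ℂ) else 0)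
      = if i = j ∧ a = b ∧ i = a then 1 else 0 := by
  rw [Finset.sum_eq_single i (fun x _ hx => by simp [hx]) (by simp)]
  grind

theorem sum_single_single_apply (P : Fin n → Fin n → Prop) [∀ x y, Decidable (P x y)]
    (i a j b : Fin n) :
    (∑ x : Fin n, ∑ y : Fin n, if P x y then (if x = i ∧ x = j then (1 : ℂ) else 0) *
      (if y = a ∧ y = b then (1 : ℂ) else 0) else 0)
      = if P i a ∧ i = j ∧ a = b then 1 else 0 := by
  rw [Finset.sum_eq_single i (fun x _ hx => by simp [hx]) (by simp),
    Finset.sum_eq_single a (fun x _ hx => by simp [hx]) (by simp)]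
  grind

theorem sum_single_swap_apply (P : Fin n → Fin n → Prop) [∀ x y, Decidable (P x y)]
    (i a j b : Fin n) :
    (∑ x : Fin n, ∑ y : Fin n, if P x y then (if x = i ∧ y = j then (1 : ℂ) else 0) *
      (if y = a ∧ x = b then (1 : ℂ) else 0) else 0)
      = if P i a ∧ i = b ∧ a = j then 1 else 0 := by
  rw [Finset.sum_eq_single i (fun x _ hx => by simp [hx]) (by simp),
    Finset.sum_eq_single a (fun x _ hx => by simp [hx]) (by simp)]
  grind

theorem R0_apply (q : ℂ) (i a j b : Fin n) : R0 q n (i, a) (j, b)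
    = if i = j ∧ a = b then (if i = a then q else 1)
      else if i = b ∧ a = j ∧ i < j then q - q⁻¹ else 0 := by
  simp only [R0, Matrix.add_apply, Matrix.smul_apply, Matrix.sum_apply,
    Matrix.kroneckerMap_apply, Matrix.single_apply, smul_eq_mul, apply_ite (fun M :
      Matrix (Fin n × Fin n) (Fin n × Fin n) ℂ => M (i, a) (j, b)), Matrix.zero_apply]
  rw [sum_single_diag_apply, sum_single_single_apply, sum_single_swap_apply]
  grind

theorem R1_apply (q : ℂ) (i a j b : Fin n) : R1 q n (i, a) (j, b)
    = if i = j ∧ a = b then (if i = a then q⁻¹ else 1)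
      else if i = b ∧ a = j ∧ j < i then -(q - q⁻¹) else 0 := by
  simp only [R1, Matrix.add_apply, Matrix.sub_apply, Matrix.smul_apply, Matrix.sum_apply,
    Matrix.kroneckerMap_apply, Matrix.single_apply, smul_eq_mul, apply_ite (fun M :
      Matrix (Fin n × Fin n) (Fin n × Fin n) ℂ => M (i, a) (j, b)), Matrix.zero_apply]
  rw [sum_single_diag_apply, sum_single_single_apply, sum_single_swap_apply]
  grind

/-- The entries of `α R - β R̃`. -/
noncomputable def rEntry (q : ℂ) (α β : K) (I J : Fin n × Fin n) : K :=
  R0 q n I J • α - R1 q n I J • β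

theorem rEntry_apply (q : ℂ) (α β : K) (i a j b : Fin n) : rEntry q α β (i, a) (j, b)
    = if i = j ∧ a = b then (if i = a then q • α - q⁻¹ • β else α - β)
      else if i = b ∧ a = j then (q - q⁻¹) • (if i < j then α else β) else 0 := by
  rw [rEntry, R0_apply, R1_apply]
  split_ifs
  all_goals first | (exfalso; grind) | (simp; done) | (simp only [neg_smul, zero_smul]; module)

/-- The matrix `α R - β R̃`, with entries in the endomorphisms of the second factor. -/
noncomputable def rFst (q : ℂ) (α β : K) : Matrix (Fin n) (Fin n) (Matrix (Fin n) (Fin n) K) :=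
  Matrix.of fun i j => Matrix.of fun a b => rEntry q α β (i, a) (j, b)

/-- The matrix `α R - β R̃`, with entries in the endomorphisms of the first factor, which are
transposed. -/
noncomputable def rSnd (q : ℂ) (α β : K) : Matrix (Fin n) (Fin n) (Matrix (Fin n) (Fin n) K) :=
  Matrix.of fun i j => Matrix.of fun a b => rEntry q α β (b, i) (a, j)

theorem rFst_self (α β : K) (i : Fin n) : rFst q α β i i
    = Matrix.diagonal fun a => if a = i then q • α - q⁻¹ • β else α - β := by
  ext a b
  simp only [rFst, Matrix.of_apply, rEntry_apply, Matrix.diagonal_apply]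
  grind

theorem rFst_of_ne (α β : K) {i j : Fin n} (h : i ≠ j) : rFst q α β i j
    = Matrix.single j i ((q - q⁻¹) • (if i < j then α else β)) := by
  ext a b
  simp only [rFst, Matrix.of_apply, rEntry_apply, Matrix.single_apply]
  grind

theorem rSnd_self (α β : K) (i : Fin n) : rSnd q α β i i
    = Matrix.diagonal fun a => if a = i then q • α - q⁻¹ • β else α - β := by
  ext a b
  simp only [rSnd, Matrix.of_apply, rEntry_apply, Matrix.diagonal_apply]
  grind

theorem rSnd_of_ne (α β : K) {i j : Fin n} (h : i ≠ j) : rSnd q α β i j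
    = Matrix.single i j ((q - q⁻¹) • (if j < i then α else β)) := by
  ext a b
  simp only [rSnd, Matrix.of_apply, rEntry_apply, Matrix.single_apply]
  grind

theorem single_mul_apply_ite (i j a b : Fin n) (c : K) (M : Matrix (Fin n) (Fin n) K) :
    (Matrix.single i j c * M) a b = if a = i then c * M j b else 0 := by
  split_ifs with h
  · subst h; simp
  · simp [h]

-- With x = β/α the hypothesis reads x = q²x', so this is fusion for R itself. It is checked
-- directly: a block of R is either diagonal or a multiple of one matrix unit, and each pattern of
-- coincidences among i, j, k, l leaves a polynomial identity.
set_option maxHeartbeats 1000000 in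
theorem rFst_isQPair (hq : q ≠ 0) {α β α' β' : K} (h : β * α' = q ^ 2 • (α * β')) :
    IsQPair (-q)⁻¹ (rFst (n := n) q α β) (rFst q α' β') := by
  have hq1 : algebraMap ℂ K q * algebraMap ℂ K q⁻¹ = 1 := by
    rw [← map_mul, mul_inv_cancel₀ hq, map_one]
  rw [Algebra.smul_def, map_pow] at h
  constructor
  · intro i j k hij
    have e1 := hij.ne
    have e2 := hij.ne'
    have e3 := hij.not_gt
    ext a b
    rcases eq_or_ne i k with rfl | e4
    · simp only [rFst_self, rFst_of_ne _ _ e2]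
      simp only [Matrix.add_apply, Matrix.smul_apply, Matrix.diagonal_mul, single_mul_apply_ite,
        Matrix.single_apply, Matrix.diagonal_apply, Matrix.zero_apply]
      simp only [Algebra.smul_def, map_sub, inv_neg, map_neg]
      -- The only remaining facts about q are QQ' = 1 and the relation `h`.
      generalize algebraMap ℂ K q = Q, algebraMap ℂ K q⁻¹ = Q' at h hq1 ⊢
      grind
    rcases eq_or_ne j k with rfl | e5
    · simp only [rFst_self, rFst_of_ne _ _ e4]
      simp only [Matrix.add_apply, Matrix.smul_apply, Matrix.diagonal_mul, single_mul_apply_ite,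
        Matrix.single_apply, Matrix.diagonal_apply, Matrix.zero_apply]
      simp only [Algebra.smul_def, map_sub, inv_neg, map_neg]
      generalize algebraMap ℂ K q = Q, algebraMap ℂ K q⁻¹ = Q' at h hq1 ⊢
      grind
    · simp only [rFst_of_ne _ _ e4, rFst_of_ne _ _ e5]
      simp only [Matrix.add_apply, Matrix.smul_apply, single_mul_apply_ite,
        Matrix.single_apply, Matrix.zero_apply]
      simp only [Algebra.smul_def, map_sub, inv_neg, map_neg]
      generalize algebraMap ℂ K q = Q, algebraMap ℂ K q⁻¹ = Q' at h hq1 ⊢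
      grind
  · intro i j k l hij hkl
    ext a b
    have d1 := hij.ne'
    have d2 := hkl.ne'
    have d3 := hij.not_gt
    have d4 := hkl.not_gt
    rcases eq_or_ne i k with rfl | e1
    · rcases eq_or_ne j l with rfl | e4
      · have e2 := hij.ne
        simp only [rFst_self, rFst_of_ne _ _ e2, rFst_of_ne _ _ d1]
        simp only [Matrix.add_apply, Matrix.smul_apply, Matrix.diagonal_mul, single_mul_apply_ite,
          Matrix.single_apply, Matrix.diagonal_apply]
        simp only [Algebra.smul_def, map_sub, inv_neg, map_neg]
        generalize algebraMap ℂ K q = Q, algebraMap ℂ K q⁻¹ = Q' at h hq1 ⊢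
        simp only [hij, d1, d3, d1.symm, if_true, if_false, true_and, and_true]
        split_ifs <;> grind
      · have e2 := hkl.ne
        simp only [rFst_self, rFst_of_ne _ _ e2, rFst_of_ne _ _ d1, rFst_of_ne _ _ e4]
        simp only [Matrix.add_apply, Matrix.smul_apply, Matrix.diagonal_mul, single_mul_apply_ite,
          Matrix.single_apply, Matrix.diagonal_apply]
        simp only [Algebra.smul_def, map_sub, inv_neg, map_neg]
        generalize algebraMap ℂ K q = Q, algebraMap ℂ K q⁻¹ = Q' at h hq1 ⊢
        rcases lt_or_gt_of_ne e4 with o | o <;>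
          simp only [hij, hkl, d1, d3, d4, o, o.not_gt, if_true, if_false, true_and, and_true] <;> grind
    rcases eq_or_ne i l with rfl | e2
    · have e3 := (hkl.trans hij).ne'
      simp only [rFst_self, rFst_of_ne _ _ e1, rFst_of_ne _ _ e3, rFst_of_ne _ _ d1]
      simp only [Matrix.add_apply, Matrix.smul_apply, Matrix.diagonal_mul, single_mul_apply_ite,
        Matrix.single_apply, Matrix.diagonal_apply]
      simp only [Algebra.smul_def, map_sub, inv_neg, map_neg]
      generalize algebraMap ℂ K q = Q, algebraMap ℂ K q⁻¹ = Q' at h hq1 ⊢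
      grind
    rcases eq_or_ne j k with rfl | e3
    · have e4 := hkl.ne
      simp only [rFst_self, rFst_of_ne _ _ e1, rFst_of_ne _ _ e2, rFst_of_ne _ _ e4]
      simp only [Matrix.add_apply, Matrix.smul_apply, Matrix.diagonal_mul, single_mul_apply_ite,
        Matrix.single_apply, Matrix.diagonal_apply]
      simp only [Algebra.smul_def, map_sub, inv_neg, map_neg]
      generalize algebraMap ℂ K q = Q, algebraMap ℂ K q⁻¹ = Q' at h hq1 ⊢
      grind
    rcases eq_or_ne j l with rfl | e4
    · simp only [rFst_self, rFst_of_ne _ _ e1, rFst_of_ne _ _ e2, rFst_of_ne _ _ e3]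
      simp only [Matrix.add_apply, Matrix.smul_apply, Matrix.diagonal_mul, single_mul_apply_ite,
        Matrix.single_apply, Matrix.diagonal_apply]
      simp only [Algebra.smul_def, map_sub, inv_neg, map_neg]
      generalize algebraMap ℂ K q = Q, algebraMap ℂ K q⁻¹ = Q' at h hq1 ⊢
      rcases lt_or_gt_of_ne e1 with o | o <;>
        simp only [hij, hkl, d1, d3, d4, o, o.not_gt, o.ne, o.ne', if_true, if_false, true_and, false_and,
          and_true] <;> grind
    · simp only [rFst_of_ne _ _ e1, rFst_of_ne _ _ e2, rFst_of_ne _ _ e3, rFst_of_ne _ _ e4]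
      simp only [Matrix.add_apply, Matrix.smul_apply, Matrix.diagonal_mul, single_mul_apply_ite,
        Matrix.single_apply, Matrix.diagonal_apply]
      simp only [Algebra.smul_def, map_sub, inv_neg, map_neg]
      generalize algebraMap ℂ K q = Q, algebraMap ℂ K q⁻¹ = Q' at h hq1 ⊢
      grind

-- Here x' = q²x, opposite to `rFst_isQPair`: the spectral variable of the second tensor factor
-- stands in the denominator of u/v.
set_option maxHeartbeats 1000000 in
theorem rSnd_isQPair (hq : q ≠ 0) {α β α' β' : K} (h : α * β' = q ^ 2 • (β * α')) :
    IsQPair (-q)⁻¹ (rSnd (n := n) q α β) (rSnd q α' β') := by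
  have hq1 : algebraMap ℂ K q * algebraMap ℂ K q⁻¹ = 1 := by
    rw [← map_mul, mul_inv_cancel₀ hq, map_one]
  rw [Algebra.smul_def, map_pow] at h
  constructor
  · intro i j k hij
    have e1 := hij.ne
    have e2 := hij.ne'
    have e3 := hij.not_gt
    ext a b
    rcases eq_or_ne i k with rfl | e4
    · simp only [rSnd_self, rSnd_of_ne _ _ e2]
      simp only [Matrix.add_apply, Matrix.smul_apply, Matrix.diagonal_mul, single_mul_apply_ite,
        Matrix.single_apply, Matrix.diagonal_apply, Matrix.zero_apply]
      simp only [Algebra.smul_def, map_sub, inv_neg, map_neg]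
      generalize algebraMap ℂ K q = Q, algebraMap ℂ K q⁻¹ = Q' at h hq1 ⊢
      grind
    rcases eq_or_ne j k with rfl | e5
    · simp only [rSnd_self, rSnd_of_ne _ _ e4]
      simp only [Matrix.add_apply, Matrix.smul_apply, Matrix.diagonal_mul, single_mul_apply_ite,
        Matrix.single_apply, Matrix.diagonal_apply, Matrix.zero_apply]
      simp only [Algebra.smul_def, map_sub, inv_neg, map_neg]
      generalize algebraMap ℂ K q = Q, algebraMap ℂ K q⁻¹ = Q' at h hq1 ⊢
      grind
    · simp only [rSnd_of_ne _ _ e4, rSnd_of_ne _ _ e5]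
      simp only [Matrix.add_apply, Matrix.smul_apply, single_mul_apply_ite,
        Matrix.single_apply, Matrix.zero_apply]
      simp only [Algebra.smul_def, map_sub, inv_neg, map_neg]
      generalize algebraMap ℂ K q = Q, algebraMap ℂ K q⁻¹ = Q' at h hq1 ⊢
      grind
  · intro i j k l hij hkl
    ext a b
    have d1 := hij.ne'
    have d2 := hkl.ne'
    have d3 := hij.not_gt
    have d4 := hkl.not_gt
    rcases eq_or_ne i k with rfl | e1
    · rcases eq_or_ne j l with rfl | e4
      · have e2 := hij.ne
        simp only [rSnd_self, rSnd_of_ne _ _ e2, rSnd_of_ne _ _ d1]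
        simp only [Matrix.add_apply, Matrix.smul_apply, Matrix.diagonal_mul, single_mul_apply_ite,
          Matrix.single_apply, Matrix.diagonal_apply]
        simp only [Algebra.smul_def, map_sub, inv_neg, map_neg]
        generalize algebraMap ℂ K q = Q, algebraMap ℂ K q⁻¹ = Q' at h hq1 ⊢
        simp only [hij, d1, d3, d1.symm, if_true, if_false, true_and, and_true]
        split_ifs <;> grind
      · have e2 := hkl.ne
        simp only [rSnd_self, rSnd_of_ne _ _ e2, rSnd_of_ne _ _ d1, rSnd_of_ne _ _ e4]
        simp only [Matrix.add_apply, Matrix.smul_apply, Matrix.diagonal_mul, single_mul_apply_ite,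
          Matrix.single_apply, Matrix.diagonal_apply]
        simp only [Algebra.smul_def, map_sub, inv_neg, map_neg]
        generalize algebraMap ℂ K q = Q, algebraMap ℂ K q⁻¹ = Q' at h hq1 ⊢
        rcases lt_or_gt_of_ne e4 with o | o <;>
          simp only [hij, hkl, d1, d3, d4, o, o.not_gt, if_true, if_false, true_and, and_true] <;> (split_ifs <;> grind)
    rcases eq_or_ne i l with rfl | e2
    · have e3 := (hkl.trans hij).ne'
      simp only [rSnd_self, rSnd_of_ne _ _ e1, rSnd_of_ne _ _ e3, rSnd_of_ne _ _ d1]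
      simp only [Matrix.add_apply, Matrix.smul_apply, Matrix.diagonal_mul, single_mul_apply_ite,
        Matrix.single_apply, Matrix.diagonal_apply]
      simp only [Algebra.smul_def, map_sub, inv_neg, map_neg]
      generalize algebraMap ℂ K q = Q, algebraMap ℂ K q⁻¹ = Q' at h hq1 ⊢
      grind
    rcases eq_or_ne j k with rfl | e3
    · have e4 := hkl.ne
      simp only [rSnd_self, rSnd_of_ne _ _ e1, rSnd_of_ne _ _ e2, rSnd_of_ne _ _ e4]
      simp only [Matrix.add_apply, Matrix.smul_apply, Matrix.diagonal_mul, single_mul_apply_ite,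
        Matrix.single_apply, Matrix.diagonal_apply]
      simp only [Algebra.smul_def, map_sub, inv_neg, map_neg]
      generalize algebraMap ℂ K q = Q, algebraMap ℂ K q⁻¹ = Q' at h hq1 ⊢
      grind
    rcases eq_or_ne j l with rfl | e4
    · simp only [rSnd_self, rSnd_of_ne _ _ e1, rSnd_of_ne _ _ e2, rSnd_of_ne _ _ e3]
      simp only [Matrix.add_apply, Matrix.smul_apply, Matrix.diagonal_mul, single_mul_apply_ite,
        Matrix.single_apply, Matrix.diagonal_apply]
      simp only [Algebra.smul_def, map_sub, inv_neg, map_neg]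
      generalize algebraMap ℂ K q = Q, algebraMap ℂ K q⁻¹ = Q' at h hq1 ⊢
      rcases lt_or_gt_of_ne e1 with o | o <;>
        simp only [hij, hkl, d1, d3, d4, o, o.not_gt, o.ne, o.ne', if_true, if_false, true_and, false_and,
          and_true] <;> grind
    · simp only [rSnd_of_ne _ _ e1, rSnd_of_ne _ _ e2, rSnd_of_ne _ _ e3, rSnd_of_ne _ _ e4]
      simp only [Matrix.add_apply, Matrix.smul_apply, Matrix.diagonal_mul, single_mul_apply_ite,
        Matrix.single_apply, Matrix.diagonal_apply]
      simp only [Algebra.smul_def, map_sub, inv_neg, map_neg]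
      generalize algebraMap ℂ K q = Q, algebraMap ℂ K q⁻¹ = Q' at h hq1 ⊢
      grind

end RMatrixEntries
end QuantumAffine

namespace QuantumAffine

/-! ### Chain determinants of the `R`-matrix -/

section RMatrixDeterminant

variable {n : ℕ} {K : Type*} [CommRing K] [Algebra ℂ K] {q : ℂ} {κ : Type*} (α β : κ → K)

/-- For i ≠ c the block (i, c) is a matrix unit supported in row c, so it contributes nothing to row
a when a is not in the word. The diagonal blocks contribute α - β each. -/
theorem contract_rFst_apply (ks : List κ) (g : List (Fin n) → Matrix (Fin n) (Fin n) K)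
    (cs : List (Fin n)) (a b : Fin n) (ha : a ∉ cs) (hl : ks.length = cs.length) :
    contract (ks.map fun k => rFst q (α k) (β k)) g cs a b
      = (ks.map fun k => α k - β k).prod * g cs a b := by
  induction ks generalizing cs g with
  | nil =>
    obtain rfl : cs = [] := by simpa using hl.symm
    simp [contract]
  | cons k ks ih =>
    cases cs with
    | nil => simp at hl
    | cons c cs =>
      rw [List.mem_cons, not_or] at ha
      simp only [List.map_cons, contract, List.prod_cons, Matrix.sum_apply]
      rw [Finset.sum_eq_single c]
      · rw [rFst_self, Matrix.diagonal_mul, if_neg ha.1, ih _ _ ha.2 (by simpa using hl), mul_assoc]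
      · intro i _ hi
        rw [rFst_of_ne _ _ hi, single_mul_apply_ite, if_neg ha.1]
      · simp

/-- Dual to the previous computation, now in column a: the block (i, c) picks out row c of the
remaining product, and by induction column a of that product is supported in row a ≠ c. -/
theorem contract_rSnd_apply (ks : List κ) (γ : List (Fin n) → ℂ)
    (cs : List (Fin n)) (x a : Fin n) (ha : a ∉ cs) (hl : ks.length = cs.length) :
    contract (ks.map fun k => rSnd q (α k) (β k))
      (fun w => algebraMap ℂ (Matrix (Fin n) (Fin n) K) (γ w)) cs x a
      = if x = a then (ks.map fun k => α k - β k).prod * algebraMap ℂ K (γ cs) else 0 := by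
  induction ks generalizing cs γ x with
  | nil =>
    obtain rfl : cs = [] := by simpa using hl.symm
    simp [contract, Matrix.algebraMap_matrix_apply]
  | cons k ks ih =>
    cases cs with
    | nil => simp at hl
    | cons c cs =>
      rw [List.mem_cons, not_or] at ha
      simp only [List.map_cons, contract, List.prod_cons, Matrix.sum_apply]
      rw [Finset.sum_eq_single c]
      · rw [rSnd_self, Matrix.diagonal_mul, ih _ _ _ ha.2 (by simpa using hl)]
        split_ifs with h1 h2
        · exact absurd (h2.symm.trans h1) ha.1
        · simp
        · rw [mul_assoc]
        · simp
      · intro i _ hi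
        rw [rSnd_of_ne _ _ hi, single_mul_apply_ite, ih _ _ _ ha.2 (by simpa using hl),
          if_neg (Ne.symm ha.1)]
        simp
      · simp

theorem exists_complement_word (a : Fin n) :
    ∃ cs : List (Fin n), (a :: cs).Nodup ∧ cs.length + 1 = n ∧ ∀ i, i ≠ a → i ∈ cs := by
  refine ⟨(List.finRange n).erase a, ?_, ?_, ?_⟩
  · rw [List.nodup_cons]
    exact ⟨(List.nodup_finRange n).not_mem_erase, (List.nodup_finRange n).erase a⟩
  · rw [List.length_erase_of_mem (List.mem_finRange a), List.length_finRange]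
    have := a.pos
    omega
  · intro i hi
    exact (List.mem_erase_of_ne hi).2 (List.mem_finRange i)

/-- The determinant is read off in row a from a column word that ends in its only occurrence of a.
All factors but the last contribute α - β, the last contributes qα - q⁻¹β, and other final rows
repeat a letter. The result does not depend on a, so it is scalar. -/
theorem chainDet_rFst (hq : q ≠ 0) {ks : List κ} {k : κ} (hk : ks.length + 1 = n)
    (hc : (ks ++ [k]).IsChain fun k l => β k * α l = q ^ 2 • (α k * β l)) :
    chainDet (-q)⁻¹ ((ks ++ [k]).map fun k => rFst (n := n) q (α k) (β k))
      = Matrix.scalar (Fin n)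
        ((ks.map fun k => α k - β k).prod * (q • α k - q⁻¹ • β k)) := by
  have hp : (-q)⁻¹ ≠ 0 := inv_ne_zero (neg_ne_zero.2 hq)
  have hch : ((ks ++ [k]).map fun k => rFst (n := n) q (α k) (β k)).IsChain
      (IsQPair (-q)⁻¹) := (List.isChain_map _).2 (hc.imp fun _ _ h => rFst_isQPair hq h)
  ext a b
  obtain ⟨cs, hnd, hl, hmem⟩ := exists_complement_word a
  have ha : a ∉ cs := (List.nodup_cons.1 hnd).1
  have hnd' : (cs ++ [a]).Nodup := (List.perm_append_singleton a cs).nodup_iff.2 hnd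
  have h := congrFun (congrFun (contract_algSign hp hch (cs := cs ++ [a]) (by simpa using hl)) a) b
  rw [List.map_append, List.map_singleton, contract_append_singleton _ _ _ _ _ (by simp; omega),
    contract_rFst_apply _ _ _ _ _ _ _ ha (by omega), Matrix.sum_apply,
    Finset.sum_eq_single a _ (by simp), rFst_self, Matrix.diagonal_mul, if_pos rfl, algSign,
    ← Algebra.smul_def, Matrix.smul_apply, Matrix.algebraMap_matrix_apply] at h
  · rw [List.map_append, List.map_singleton]
    -- The sign of a word without repetition is a nonzero complex number, so it cancels even though
    -- K need not be a domain.
    have h0 : IsUnit (algebraMap ℂ K (qSign (-q)⁻¹ (cs ++ [a]))) :=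
      (IsUnit.mk0 _ (qSign_ne_zero hp hnd')).map _
    refine h0.mul_left_cancel ((Algebra.smul_def _ _).symm.trans (h.symm.trans ?_))
    rw [Matrix.scalar_apply, Matrix.diagonal_apply]
    split_ifs <;> ring
  · intro i _ hi
    have : ¬ (cs ++ [i]).Nodup := fun h' =>
      (List.nodup_cons.1 ((List.perm_append_singleton i cs).nodup_iff.1 h')).1 (hmem i hi)
    rw [algSign, qSign_of_not_nodup this, map_zero, mul_zero, Matrix.zero_apply]

/-- As for `chainDet_rFst`, but column a is read off from a word beginning with a, so the
exceptional factor is the first one. -/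
theorem chainDet_rSnd (hq : q ≠ 0) {ks : List κ} {k : κ} (hk : ks.length + 1 = n)
    (hc : (k :: ks).IsChain fun k l => α k * β l = q ^ 2 • (β k * α l)) :
    chainDet (-q)⁻¹ ((k :: ks).map fun k => rSnd (n := n) q (α k) (β k))
      = Matrix.scalar (Fin n)
        ((ks.map fun k => α k - β k).prod * (q • α k - q⁻¹ • β k)) := by
  have hp : (-q)⁻¹ ≠ 0 := inv_ne_zero (neg_ne_zero.2 hq)
  have hch : ((k :: ks).map fun k => rSnd (n := n) q (α k) (β k)).IsChain
      (IsQPair (-q)⁻¹) := (List.isChain_map _).2 (hc.imp fun _ _ h => rSnd_isQPair hq h)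
  ext b a
  obtain ⟨cs, hnd, hl, hmem⟩ := exists_complement_word a
  have ha : a ∉ cs := (List.nodup_cons.1 hnd).1
  have h := congrFun (congrFun (contract_algSign hp hch (cs := a :: cs) (by simpa using hl)) b) a
  have h1 : ∀ i x, contract (ks.map fun k => rSnd (n := n) q (α k) (β k))
      (fun w => algSign _ (-q)⁻¹ (i :: w)) cs x a
      = if x = a then (ks.map fun k => α k - β k).prod
        * algebraMap ℂ K (qSign (-q)⁻¹ (i :: cs)) else 0 := fun i x =>
    contract_rSnd_apply α β ks (fun w => qSign (-q)⁻¹ (i :: w)) cs x a ha (by omega)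
  rw [List.map_cons, contract, Matrix.sum_apply, Finset.sum_eq_single a _ (by simp), rSnd_self,
    Matrix.diagonal_mul, h1, algSign, ← Algebra.smul_def, Matrix.smul_apply] at h
  · have h0 : IsUnit (algebraMap ℂ K (qSign (-q)⁻¹ (a :: cs))) :=
      (IsUnit.mk0 _ (qSign_ne_zero hp hnd)).map _
    refine h0.mul_left_cancel ((Algebra.smul_def _ _).symm.trans (h.symm.trans ?_))
    rw [Matrix.scalar_apply, Matrix.diagonal_apply]
    split_ifs <;> ring
  · intro i _ hi
    have : ¬ (i :: cs).Nodup := fun h' => (List.nodup_cons.1 h').1 (hmem i hi)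
    rw [Matrix.mul_apply]
    exact Finset.sum_eq_zero fun x _ => by
      rw [h1, qSign_of_not_nodup this, map_zero, mul_zero, ite_self, mul_zero]

end RMatrixDeterminant

/-! ### Exchange relations for chain determinants -/

section Exchange

variable {n : ℕ} {A : Type*} [Ring A] [Algebra ℂ A] {q : ℂ}

theorem IsQPair.map {A' : Type*} [Ring A'] [Algebra ℂ A'] (φ : A →ₐ[ℂ] A') {p : ℂ}
    {X Y : Matrix (Fin n) (Fin n) A} (h : IsQPair p X Y) : IsQPair p (X.map φ) (Y.map φ) where
  same i j k hij := by
    simpa only [Matrix.map_apply, map_add, map_mul, map_smul, map_zero] using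
      congrArg φ (h.same i j k hij)
  diff i j k l hij hkl := by
    simpa only [Matrix.map_apply, map_add, map_mul, map_smul] using
      congrArg φ (h.diff i j k l hij hkl)

/-- Scalar matrices, as an algebra homomorphism. -/
def scalarHom (n : ℕ) (A : Type*) [Ring A] [Algebra ℂ A] :
    A →ₐ[ℂ] Matrix (Fin n) (Fin n) A where
  __ := Matrix.scalar (Fin n)
  commutes' _ := rfl

theorem scalarHom_apply (a : A) : scalarHom n A a = Matrix.scalar (Fin n) a := rfl

variable {K : Type*} [CommRing K] [Algebra ℂ K] {κ : Type*} {α β : κ → K}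
  {X : κ → Matrix (Fin n) (Fin n) A} {T : Matrix (Fin n) (Fin n) A} {θ θ' : K →ₐ[ℂ] A}

theorem commute_scalarHom {M : Matrix (Fin n) (Fin n) A} {a : A}
    (h : ∀ i j, Commute (M i j) a) : Commute M (scalarHom n A a) := by
  ext i j
  rw [scalarHom_apply, Matrix.scalar_apply, Matrix.mul_diagonal, Matrix.diagonal_mul]
  exact h i j

theorem map_mapMatrix_chain {p : ℂ} {ks : List κ}
    {r : κ → Matrix (Fin n) (Fin n) (Matrix (Fin n) (Fin n) K)}
    (h : (ks.map r).IsChain (IsQPair p)) (θ : K →ₐ[ℂ] A) :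
    (ks.map fun k => (r k).map (θ.mapMatrix (m := Fin n))).IsChain (IsQPair p) := by
  rw [List.isChain_map] at h ⊢
  exact h.imp fun _ _ h => h.map _

theorem chainDet_map_mapMatrix {p : ℂ} {ks : List κ}
    {r : κ → Matrix (Fin n) (Fin n) (Matrix (Fin n) (Fin n) K)} {φ : K}
    (h : chainDet p (ks.map r) = Matrix.scalar (Fin n) φ) (θ : K →ₐ[ℂ] A) :
    chainDet p (ks.map fun k => (r k).map (θ.mapMatrix (m := Fin n)))
      = scalarHom n A (θ φ) := by
  have h2 := map_chainDet (p := p) (θ.mapMatrix (m := Fin n)) (ks.map r)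
  rw [List.map_map] at h2
  refine h2.symm.trans ?_
  rw [h, scalarHom_apply, Matrix.scalar_apply, Matrix.scalar_apply, AlgHom.mapMatrix_apply,
    Matrix.diagonal_map (map_zero _)]

theorem sum_mul_diagonal_apply (Y : Fin n → A) (Z : A) (b : Fin n) :
    ∑ x, Y x * Matrix.diagonal (fun _ => Z) x b = Y b * Z := by
  rw [Finset.sum_eq_single b (fun x _ hx => by simp [hx]) (by simp), Matrix.diagonal_apply_eq]

theorem sum_diagonal_mul_apply (Y : Fin n → A) (Z : A) (b : Fin n) :
    ∑ x, Matrix.diagonal (fun _ => Z) b x * Y x = Z * Y b := by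
  rw [Finset.sum_eq_single b (fun x _ hx => by simp [hx.symm]) (by simp),
    Matrix.diagonal_apply_eq]

/-- The chain lives in the first tensor factor and everything is viewed over matrices of the second:
entries of X become scalar matrices, blocks of R become matrices, and T itself is the intertwiner.
The two maps θ, θ' allow for the different central elements on the two sides of the mixed relation.
-/
theorem exchange_fst (hq : q ≠ 0) (hθ : ∀ x a, Commute (θ x) a) (hθ' : ∀ x a, Commute (θ' x) a)
    {ks : List κ} {k₀ : κ} (hk : ks.length + 1 = n)
    (hc : (ks ++ [k₀]).IsChain fun k l => β k * α l = q ^ 2 • (α k * β l))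
    (hX : ((ks ++ [k₀]).map X).IsChain (IsQPair (-q)⁻¹))
    (hR : ∀ k I J, ∑ P, θ (rEntry q (α k) (β k) I P) * X k P.1 J.1 * T P.2 J.2
      = ∑ P, T I.2 P.2 * X k I.1 P.1 * θ' (rEntry q (α k) (β k) P J)) (a b : Fin n) :
    θ ((ks.map fun k => α k - β k).prod * (q • α k₀ - q⁻¹ • β k₀))
        * chainDet (-q)⁻¹ ((ks ++ [k₀]).map X) * T a b
      = T a b * (chainDet (-q)⁻¹ ((ks ++ [k₀]).map X)
        * θ' ((ks.map fun k => α k - β k).prod * (q • α k₀ - q⁻¹ • β k₀))) := by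
  have hp : (-q)⁻¹ ≠ 0 := inv_ne_zero (neg_ne_zero.2 hq)
  have hch : ((ks ++ [k₀]).map fun k => rFst (n := n) q (α k) (β k)).IsChain
      (IsQPair (-q)⁻¹) := (List.isChain_map _).2 (hc.imp fun _ _ h => rFst_isQPair hq h)
  have hXs : ((ks ++ [k₀]).map fun k => (X k).map (scalarHom n A)).IsChain (IsQPair (-q)⁻¹) := by
    rw [List.isChain_map] at hX ⊢
    exact hX.imp fun _ _ h => h.map _
  have hD : chainDet (-q)⁻¹ ((ks ++ [k₀]).map fun k => (X k).map (scalarHom n A))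
      = scalarHom n A (chainDet (-q)⁻¹ ((ks ++ [k₀]).map X)) := by
    rw [map_chainDet, List.map_map]; rfl
  have h := (chainDet_exchange hp (by simpa using hk) (T := T)
    (r' := fun k => (rFst (n := n) q (α k) (β k)).map (θ'.mapMatrix (m := Fin n)))
    (map_mapMatrix_chain hch θ) hXs
    (fun k l i j i' j' => commute_scalarHom fun a b => hθ _ _)
    (fun k l i j i' j' => (commute_scalarHom fun a b => hθ' _ _).symm)).1 ?_
  · rw [hD, chainDet_map_mapMatrix (chainDet_rFst α β hq hk hc),
      chainDet_map_mapMatrix (chainDet_rFst α β hq hk hc)] at h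
    have h' := congrFun (congrFun h a) b
    rw [← map_mul, ← map_mul] at h'
    simpa only [scalarHom_apply, Matrix.scalar_apply, Matrix.mul_diagonal, Matrix.diagonal_mul]
      using h'
  · intro k i c
    ext a d
    have h' := hR k (i, a) (c, d)
    simp only [Fintype.sum_prod_type] at h'
    simp only [Matrix.mul_apply, Matrix.sum_apply, Matrix.map_apply, scalarHom_apply,
      Matrix.scalar_apply, AlgHom.mapMatrix_apply, rFst, Matrix.of_apply,
      sum_mul_diagonal_apply, sum_diagonal_mul_apply, Finset.mul_sum, Finset.sum_mul]
    rw [Finset.sum_comm]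
    refine h'.trans ?_
    rw [Finset.sum_comm]
    simp only [mul_assoc]

/-- The chain now lives in the second factor. In the relation R precedes T as an endomorphism, while
T precedes X in the algebra; transposing the first factor reverses the former order and reconciles
the two. -/
theorem exchange_snd (hq : q ≠ 0) (hθ : ∀ x a, Commute (θ x) a) (hθ' : ∀ x a, Commute (θ' x) a)
    {ks : List κ} {k₀ : κ} (hk : ks.length + 1 = n)
    (hc : (k₀ :: ks).IsChain fun k l => α k * β l = q ^ 2 • (β k * α l))
    (hX : ((k₀ :: ks).map X).IsChain (IsQPair (-q)⁻¹))
    (hR : ∀ k I J, ∑ P, θ (rEntry q (α k) (β k) I P) * T P.1 J.1 * X k P.2 J.2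
      = ∑ P, X k I.2 P.2 * T I.1 P.1 * θ' (rEntry q (α k) (β k) P J)) (a b : Fin n) :
    T a b * (θ ((ks.map fun k => α k - β k).prod * (q • α k₀ - q⁻¹ • β k₀))
        * chainDet (-q)⁻¹ ((k₀ :: ks).map X))
      = chainDet (-q)⁻¹ ((k₀ :: ks).map X)
        * θ' ((ks.map fun k => α k - β k).prod * (q • α k₀ - q⁻¹ • β k₀)) * T a b := by
  have hp : (-q)⁻¹ ≠ 0 := inv_ne_zero (neg_ne_zero.2 hq)
  have hch : ((k₀ :: ks).map fun k => rSnd (n := n) q (α k) (β k)).IsChain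
      (IsQPair (-q)⁻¹) := (List.isChain_map _).2 (hc.imp fun _ _ h => rSnd_isQPair hq h)
  have hXs : ((k₀ :: ks).map fun k => (X k).map (scalarHom n A)).IsChain (IsQPair (-q)⁻¹) := by
    rw [List.isChain_map] at hX ⊢
    exact hX.imp fun _ _ h => h.map _
  have hD : chainDet (-q)⁻¹ ((k₀ :: ks).map fun k => (X k).map (scalarHom n A))
      = scalarHom n A (chainDet (-q)⁻¹ ((k₀ :: ks).map X)) := by
    rw [map_chainDet, List.map_map]; rfl
  have h := (chainDet_exchange hp (by simpa using hk) (T := T.transpose)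
    (r' := fun k => (rSnd (n := n) q (α k) (β k)).map (θ'.mapMatrix (m := Fin n)))
    (map_mapMatrix_chain hch θ) hXs
    (fun k l i j i' j' => commute_scalarHom fun a b => hθ _ _)
    (fun k l i j i' j' => (commute_scalarHom fun a b => hθ' _ _).symm)).2 ?_
  · rw [hD, chainDet_map_mapMatrix (chainDet_rSnd α β hq hk hc),
      chainDet_map_mapMatrix (chainDet_rSnd α β hq hk hc)] at h
    have h' := congrFun (congrFun h b) a
    rw [← map_mul, ← map_mul] at h'
    simpa only [scalarHom_apply, Matrix.scalar_apply, Matrix.mul_diagonal, Matrix.diagonal_mul,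
      Matrix.transpose_apply] using h'
  · intro k i c
    ext a d
    have h' := hR k (d, i) (a, c)
    simp only [Fintype.sum_prod_type] at h'
    simp only [Matrix.mul_apply, Matrix.sum_apply, Matrix.map_apply, scalarHom_apply,
      Matrix.scalar_apply, AlgHom.mapMatrix_apply, rSnd, Matrix.of_apply, Matrix.transpose_apply,
      sum_mul_diagonal_apply, sum_diagonal_mul_apply, Finset.mul_sum, Finset.sum_mul]
    refine Eq.trans ?_ (h'.trans ?_)
    · refine Finset.sum_congr rfl fun x _ => Finset.sum_congr rfl fun y _ => ?_
      rw [← mul_assoc, (hθ _ (T x a)).eq]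
    · refine Finset.sum_congr rfl fun x _ => Finset.sum_congr rfl fun y _ => ?_
      rw [mul_assoc, mul_assoc, (hθ' _ (T d x)).eq]

end Exchange

/-! ### The normalized `R`-matrix has quantum determinant one up to a constant -/

section Normalization

variable {q : ℂ} {n : ℕ}

/-- The prefactor `f(x) / (q - q⁻¹ x)` of the normalized `R`-matrix. -/
noncomputable def gSeries (q : ℂ) (n : ℕ) : ℂ⟦X⟧ :=
  fSeries q n * (PowerSeries.C q - PowerSeries.C q⁻¹ * PowerSeries.X)⁻¹

theorem gSeries_mul (hq0 : q ≠ 0) :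
    gSeries q n * (PowerSeries.C q - PowerSeries.C q⁻¹ * PowerSeries.X) = fSeries q n := by
  rw [gSeries, mul_assoc, PowerSeries.inv_mul_cancel, mul_one]
  simpa using hq0

theorem constantCoeff_gSeries : PowerSeries.constantCoeff (gSeries q n) = q⁻¹ := by
  have h := fSeries_coeff_zero q n
  rw [PowerSeries.coeff_zero_eq_constantCoeff_apply] at h
  rw [gSeries, map_mul, h, PowerSeries.constantCoeff_inv]
  simp

/-- The determinant of the normalized `R`-matrix. -/
noncomputable def normSeries (q : ℂ) (n : ℕ) : ℂ⟦X⟧ :=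
  (∏ k ∈ Finset.range n, PowerSeries.rescale (q ^ (2 * k)) (gSeries q n))
    * (PowerSeries.C q - PowerSeries.C q⁻¹ * PowerSeries.X)
    * ∏ k ∈ Finset.range (n - 1), (1 - PowerSeries.C (q ^ (2 * (k + 1))) * PowerSeries.X)

theorem rescale_fSeries (hq : ∀ m : ℕ, 0 < m → q ^ m ≠ 1) (hn : 0 < n) :
    PowerSeries.rescale (q ^ (2 * n)) (fSeries q n)
      * ((1 - PowerSeries.X) * (1 - PowerSeries.C (q ^ (2 * n)) * PowerSeries.X))
    = fSeries q n * ((1 - PowerSeries.C (q ^ 2) * PowerSeries.X)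
      * (1 - PowerSeries.C (q ^ (2 * n - 2)) * PowerSeries.X)) := by
  have h := (fSeries_spec q n hq hn (fSeries q n)).2 rfl
  have h2 : q ^ (2 * (n : ℤ) - 2) = q ^ (2 * n - 2) := by
    rw [← zpow_natCast]; congr 1; omega
  rw [h.2, ratioSeries, h2, mul_assoc, mul_assoc _ (_⁻¹), PowerSeries.inv_mul_cancel, mul_one]
  simp

theorem rescale_linear (c a b : ℂ) :
    PowerSeries.rescale c (PowerSeries.C a - PowerSeries.C b * PowerSeries.X)
      = PowerSeries.C a - PowerSeries.C (b * c) * PowerSeries.X := by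
  have h : ∀ d : ℂ, PowerSeries.rescale c (PowerSeries.C d) = PowerSeries.C d := by
    intro d
    ext k
    rw [PowerSeries.coeff_rescale, PowerSeries.coeff_C]
    split_ifs with hk <;> simp [hk]
  rw [map_sub, map_mul, PowerSeries.rescale_X, h, h, map_mul, mul_assoc]

theorem linear_ne_zero {a b : ℂ} (ha : a ≠ 0) :
    (PowerSeries.C a - PowerSeries.C b * PowerSeries.X : ℂ⟦X⟧) ≠ 0 := fun h => by
  have := congrArg PowerSeries.constantCoeff h
  simp at this
  exact ha this

/-- The products telescope. Under x ↦ q²x the first gains g(q^{2n}x)/g(x), the last gains (1 -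
q^{2n}x)/(1 - q²x), and q - q⁻¹x becomes q(1 - x). The functional equation of f says exactly that
these changes compensate. -/
theorem rescale_normSeries (hq0 : q ≠ 0) (hq : ∀ m : ℕ, 0 < m → q ^ m ≠ 1) (hn : 0 < n) :
    PowerSeries.rescale (q ^ 2) (normSeries q n) = normSeries q n := by
  obtain ⟨m, rfl⟩ : ∃ m, n = m + 1 := ⟨n - 1, by omega⟩
  have hone : ∀ c : ℂ, (1 - PowerSeries.C c * PowerSeries.X : ℂ⟦X⟧)
      = PowerSeries.C 1 - PowerSeries.C c * PowerSeries.X := fun c => by rw [map_one]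
  have h1 : PowerSeries.rescale (q ^ 2)
        (∏ k ∈ Finset.range (m + 1), PowerSeries.rescale (q ^ (2 * k)) (gSeries q (m + 1)))
        * gSeries q (m + 1)
      = (∏ k ∈ Finset.range (m + 1), PowerSeries.rescale (q ^ (2 * k)) (gSeries q (m + 1)))
        * PowerSeries.rescale (q ^ (2 * (m + 1))) (gSeries q (m + 1)) := by
    rw [map_prod, ← Finset.prod_range_succ, Finset.prod_range_succ' _ (m + 1)]
    congr 1
    · refine Finset.prod_congr rfl fun k _ => ?_
      rw [PowerSeries.rescale_rescale]
      congr 2; ring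
    · simp
  have h2 : PowerSeries.rescale (q ^ 2)
        (∏ k ∈ Finset.range m, (1 - PowerSeries.C (q ^ (2 * (k + 1))) * PowerSeries.X))
        * (1 - PowerSeries.C (q ^ 2) * PowerSeries.X)
      = (∏ k ∈ Finset.range m, (1 - PowerSeries.C (q ^ (2 * (k + 1))) * PowerSeries.X))
        * (1 - PowerSeries.C (q ^ (2 * (m + 1))) * PowerSeries.X) := by
    rw [← Finset.prod_range_succ, Finset.prod_range_succ', map_prod]
    congr 1
    refine Finset.prod_congr rfl fun k _ => ?_
    rw [hone, rescale_linear, hone]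
    congr 3; ring
  have h3 := rescale_fSeries (n := m + 1) hq (by omega)
  rw [← gSeries_mul hq0, map_mul, rescale_linear] at h3
  have h4 : PowerSeries.rescale (q ^ 2) (PowerSeries.C q - PowerSeries.C q⁻¹ * PowerSeries.X)
      = PowerSeries.C q * (1 - PowerSeries.X) := by
    rw [rescale_linear, mul_sub, mul_one]
    congr 3
    field_simp
  have h5 : (PowerSeries.C q - PowerSeries.C (q⁻¹ * q ^ (2 * (m + 1))) * PowerSeries.X : ℂ⟦X⟧)
      = PowerSeries.C q * (1 - PowerSeries.C (q ^ (2 * (m + 1) - 2)) * PowerSeries.X) := by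
    rw [mul_sub, mul_one, ← mul_assoc, ← map_mul]
    congr 3
    rw [show 2 * (m + 1) = 2 * m + 2 by ring, Nat.add_sub_cancel]
    field_simp
    ring
  rw [h5] at h3
  have n1 : (1 - PowerSeries.C (q ^ (2 * (m + 1) - 2)) * PowerSeries.X : ℂ⟦X⟧) ≠ 0 := by
    rw [hone]; exact linear_ne_zero one_ne_zero
  have n2 : (1 - PowerSeries.C (q ^ 2) * PowerSeries.X : ℂ⟦X⟧) ≠ 0 := by
    rw [hone]; exact linear_ne_zero one_ne_zero
  have n3 : gSeries q (m + 1) ≠ 0 := fun h => by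
    have := constantCoeff_gSeries (q := q) (n := m + 1)
    rw [h, map_zero] at this
    exact inv_ne_zero hq0 this.symm
  rw [normSeries, map_mul, map_mul, h4, Nat.add_sub_cancel]
  -- Multiplying by g(x)(1 - q²x)(1 - q^{2n-2}x), which is nonzero in the domain ℂ⟦x⟧, turns the
  -- quotients into products.
  refine mul_right_cancel₀ (mul_ne_zero n3 (mul_ne_zero n2 n1)) ?_
  generalize (1 - PowerSeries.C (q ^ (2 * (m + 1) - 2)) * PowerSeries.X : ℂ⟦X⟧) = e1 at *
  generalize (1 - PowerSeries.C (q ^ (2 * (m + 1))) * PowerSeries.X : ℂ⟦X⟧) = e2 at *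
  generalize (1 - PowerSeries.C (q ^ 2) * PowerSeries.X : ℂ⟦X⟧) = e3 at *
  generalize PowerSeries.rescale (q ^ 2) (∏ k ∈ Finset.range m, _) = b' at *
  generalize (∏ k ∈ Finset.range m, _ : ℂ⟦X⟧) = b at *
  generalize PowerSeries.rescale (q ^ 2) (∏ k ∈ Finset.range (m + 1), _) = a' at *
  generalize (∏ k ∈ Finset.range (m + 1), _ : ℂ⟦X⟧) = a at *
  generalize PowerSeries.rescale (q ^ (2 * (m + 1))) (gSeries q (m + 1)) = g' at *
  generalize gSeries q (m + 1) = g at *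
  calc a' * (PowerSeries.C q * (1 - PowerSeries.X)) * b' * (g * (e3 * e1))
      = (a' * g) * (b' * e3) * (PowerSeries.C q * (1 - PowerSeries.X)) * e1 := by ring
    _ = a * b * (g' * (PowerSeries.C q * e1) * ((1 - PowerSeries.X) * e2)) := by
        rw [h1, h2]; ring
    _ = _ := by rw [h3]; ring

/-- Invariance under x ↦ q²x forces q^{2k} = 1 whenever the coefficient of x^k with k > 0 is
nonzero. -/
theorem normSeries_eq (hq0 : q ≠ 0) (hq : ∀ m : ℕ, 0 < m → q ^ m ≠ 1) (hn : 0 < n) :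
    ∃ c : ℂ, c ≠ 0 ∧ normSeries q n = PowerSeries.C c := by
  refine ⟨PowerSeries.constantCoeff (normSeries q n), ?_, ?_⟩
  · have h : ∀ c : ℂ, PowerSeries.constantCoeff (PowerSeries.rescale c (gSeries q n)) = q⁻¹ := by
      intro c
      rw [← PowerSeries.coeff_zero_eq_constantCoeff_apply, PowerSeries.coeff_rescale, pow_zero,
        one_mul, PowerSeries.coeff_zero_eq_constantCoeff_apply, constantCoeff_gSeries]
    simp [normSeries, map_prod, h, hq0]
  · ext k
    cases k with
    | zero => simp
    | succ k =>
      have h := congrArg (PowerSeries.coeff (k + 1)) (rescale_normSeries hq0 hq hn)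
      rw [PowerSeries.coeff_rescale, ← pow_mul] at h
      rw [PowerSeries.coeff_C, if_neg (Nat.succ_ne_zero k)]
      by_contra h0
      exact hq (2 * (k + 1)) (by omega) (mul_right_cancel₀ h0 (h.trans (one_mul _).symm))

end Normalization

/-! ### Series in one and two variables over a noncommutative algebra -/

section Series

variable {U : Type*} [Ring U] [Algebra ℂ U]

theorem commute_of_commute_coeff {p : U⟦X⟧} (h : ∀ i x, Commute (PowerSeries.coeff i p) x)
    (F : U⟦X⟧) : Commute p F := by
  ext k
  rw [PowerSeries.coeff_mul, PowerSeries.coeff_mul, ← Finset.Nat.sum_antidiagonal_swap]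
  exact Finset.sum_congr rfl fun x _ => h _ _

theorem commute_coeff {p : U⟦X⟧} (h : ∀ x, Commute p (PowerSeries.C x)) (i : ℕ) (x : U) :
    Commute (PowerSeries.coeff i p) x := by
  have := congrArg (PowerSeries.coeff i) (h x)
  rwa [PowerSeries.coeff_mul_C, PowerSeries.coeff_C_mul] at this

theorem coeff_complex_smul (i : ℕ) (c : ℂ) (p : U⟦X⟧) :
    PowerSeries.coeff i (c • p) = c • PowerSeries.coeff i p := rfl

theorem smul_C (c : ℂ) (a : U) :
    c • (PowerSeries.C a : U⟦X⟧) = PowerSeries.C (c • a) := by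
  ext r
  rw [coeff_complex_smul, PowerSeries.coeff_C, PowerSeries.coeff_C]
  split_ifs <;> simp

/-- The substitution `u ↦ c u` as an algebra homomorphism. -/
noncomputable def dilHom (c : ℂ) : U⟦X⟧ →ₐ[ℂ] U⟦X⟧ where
  toFun p := PowerSeries.mk fun r => c ^ r • PowerSeries.coeff r p
  map_one' := by
    ext r
    rw [PowerSeries.coeff_mk, PowerSeries.coeff_one]
    split_ifs with h <;> simp [h]
  map_mul' p p' := by
    ext r
    simp only [PowerSeries.coeff_mk, PowerSeries.coeff_mul, Finset.smul_sum]
    refine Finset.sum_congr rfl fun x hx => ?_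
    rw [← Finset.HasAntidiagonal.mem_antidiagonal.1 hx, pow_add, smul_mul_smul_comm]
  map_zero' := by ext r; simp
  map_add' p p' := by ext r; simp [smul_add]
  commutes' a := by
    ext r
    rw [PowerSeries.coeff_mk, PowerSeries.algebraMap_apply, PowerSeries.coeff_C]
    split_ifs with h <;> simp [h]

theorem coeff_dilHom (c : ℂ) (p : U⟦X⟧) (r : ℕ) :
    PowerSeries.coeff r (dilHom c p) = c ^ r • PowerSeries.coeff r p :=
  PowerSeries.coeff_mk r fun r => c ^ r • PowerSeries.coeff r p

theorem dilHom_C (c : ℂ) (a : U) : dilHom c (PowerSeries.C a) = PowerSeries.C a := by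
  ext r
  rw [coeff_dilHom, PowerSeries.coeff_C]
  split_ifs with h <;> simp [h]

theorem dilHom_X (c : ℂ) : dilHom c (PowerSeries.X : U⟦X⟧) = c • PowerSeries.X := by
  ext r
  rw [coeff_dilHom, coeff_complex_smul, PowerSeries.coeff_X]
  split_ifs with h <;> simp [h]

theorem dilHom_dilHom (c d : ℂ) (p : U⟦X⟧) : dilHom c (dilHom d p) = dilHom (c * d) p := by
  ext r
  simp only [coeff_dilHom, smul_smul, mul_pow]

theorem dilHom_one (p : U⟦X⟧) : dilHom 1 p = p := by
  ext r
  simp [coeff_dilHom]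

/-- The scaling factor of the power series variable under the substitution `u ↦ c u`. -/
noncomputable def PM.scale : PM → ℂ → ℂ
  | .plus, c => c
  | .minus, c => c⁻¹

theorem dilate_eq (s : PM) (c : ℂ) (p : U⟦X⟧) : dilate s c p = dilHom (s.scale c) p := by
  cases s <;> rfl

/-! ### Series in two independent central variables -/

/-- A series in the first (inner) variable as a series in two variables. -/
noncomputable abbrev inner₁ : U⟦X⟧ →+* U⟦X⟧⟦X⟧ := PowerSeries.C

/-- A series in the second (outer) variable as a series in two variables. -/
noncomputable abbrev outer₂ : U⟦X⟧ →+* U⟦X⟧⟦X⟧ := PowerSeries.map PowerSeries.C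

theorem inner₁_algebraMap (c : ℂ) :
    inner₁ (algebraMap ℂ U⟦X⟧ c) = algebraMap ℂ U⟦X⟧⟦X⟧ c := by
  rw [PowerSeries.algebraMap_apply (A := U⟦X⟧)]

theorem outer₂_algebraMap (c : ℂ) :
    outer₂ (algebraMap ℂ U⟦X⟧ c) = algebraMap ℂ U⟦X⟧⟦X⟧ c := by
  rw [PowerSeries.algebraMap_apply, PowerSeries.algebraMap_apply (A := U⟦X⟧), PowerSeries.map_C,
    PowerSeries.algebraMap_apply]

/-- The coefficient of a series in two variables. -/
noncomputable def coeff₂ (a b : ℕ) (F : U⟦X⟧⟦X⟧) : U :=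
  PowerSeries.coeff a (PowerSeries.coeff b F)

theorem ext_coeff₂ {F G : U⟦X⟧⟦X⟧} (h : ∀ a b, coeff₂ a b F = coeff₂ a b G) : F = G := by
  ext b a
  exact h a b

theorem coeff₂_sum {ι : Type*} (s : Finset ι) (F : ι → U⟦X⟧⟦X⟧) (a b : ℕ) :
    coeff₂ a b (∑ i ∈ s, F i) = ∑ i ∈ s, coeff₂ a b (F i) := by
  simp only [coeff₂, map_sum]

theorem coeff₂_add (F G : U⟦X⟧⟦X⟧) (a b : ℕ) :
    coeff₂ a b (F + G) = coeff₂ a b F + coeff₂ a b G := by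
  simp only [coeff₂, map_add]

theorem coeff₂_smul (c : ℂ) (F : U⟦X⟧⟦X⟧) (a b : ℕ) :
    coeff₂ a b (c • F) = c • coeff₂ a b F := rfl

theorem coeff₂_inner₁_mul_outer₂ (p k : U⟦X⟧) (a b : ℕ) :
    coeff₂ a b (inner₁ p * outer₂ k) = PowerSeries.coeff a p * PowerSeries.coeff b k := by
  rw [coeff₂, PowerSeries.coeff_C_mul, PowerSeries.coeff_map, PowerSeries.coeff_mul_C]

theorem coeff₂_outer₂_mul_inner₁ (p k : U⟦X⟧) (a b : ℕ) :
    coeff₂ a b (outer₂ k * inner₁ p) = PowerSeries.coeff b k * PowerSeries.coeff a p := by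
  rw [coeff₂, PowerSeries.coeff_mul_C, PowerSeries.coeff_map, PowerSeries.coeff_C_mul]

theorem coeff₂_zero_inner_X_mul (F : U⟦X⟧⟦X⟧) (b : ℕ) :
    coeff₂ 0 b (inner₁ PowerSeries.X * F) = 0 := by
  rw [coeff₂, PowerSeries.coeff_C_mul, PowerSeries.coeff_zero_X_mul]

theorem coeff₂_succ_inner_X_mul (F : U⟦X⟧⟦X⟧) (a b : ℕ) :
    coeff₂ (a + 1) b (inner₁ PowerSeries.X * F) = coeff₂ a b F := by
  rw [coeff₂, PowerSeries.coeff_C_mul, PowerSeries.coeff_succ_X_mul, coeff₂]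

theorem coeff₂_zero_outer_X_mul (F : U⟦X⟧⟦X⟧) (a : ℕ) :
    coeff₂ a 0 (PowerSeries.X * F) = 0 := by
  rw [coeff₂, PowerSeries.coeff_zero_X_mul, map_zero]

theorem coeff₂_succ_outer_X_mul (F : U⟦X⟧⟦X⟧) (a b : ℕ) :
    coeff₂ a (b + 1) (PowerSeries.X * F) = coeff₂ a b F := by
  rw [coeff₂, PowerSeries.coeff_succ_X_mul, coeff₂]

/-- The specialization `u = c t`, `v = t`. -/
noncomputable def specialize (c : ℂ) : U⟦X⟧⟦X⟧ →ₗ[ℂ] U⟦X⟧ where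
  toFun F := PowerSeries.mk fun N => ∑ x ∈ Finset.HasAntidiagonal.antidiagonal N, c ^ x.1 • coeff₂ x.1 x.2 F
  map_add' F G := by
    ext N
    simp only [coeff₂, map_add, smul_add, Finset.sum_add_distrib, PowerSeries.coeff_mk]
  map_smul' a F := by
    ext N
    simp only [coeff₂_smul, PowerSeries.coeff_mk, RingHom.id_apply, coeff_complex_smul,
      Finset.smul_sum]
    exact Finset.sum_congr rfl fun x _ => smul_comm _ _ _

theorem coeff_specialize (c : ℂ) (F : U⟦X⟧⟦X⟧) (N : ℕ) :
    PowerSeries.coeff N (specialize c F)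
      = ∑ x ∈ Finset.HasAntidiagonal.antidiagonal N, c ^ x.1 • coeff₂ x.1 x.2 F :=
  PowerSeries.coeff_mk N fun N =>
    ∑ x ∈ Finset.HasAntidiagonal.antidiagonal N, c ^ x.1 • coeff₂ x.1 x.2 F

/-- The variables are central, so specialization keeps the order of the coefficients; this and the
opposite order are all that fusion needs. -/
theorem specialize_inner₁_mul_outer₂ (c : ℂ) (p k : U⟦X⟧) :
    specialize c (inner₁ p * outer₂ k) = dilHom c p * k := by
  ext N
  rw [coeff_specialize, PowerSeries.coeff_mul]
  exact Finset.sum_congr rfl fun x _ => by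
    rw [coeff₂_inner₁_mul_outer₂, coeff_dilHom, smul_mul_assoc]

theorem specialize_outer₂_mul_inner₁ (c : ℂ) (p k : U⟦X⟧) :
    specialize c (outer₂ k * inner₁ p) = k * dilHom c p := by
  ext N
  rw [coeff_specialize, PowerSeries.coeff_mul, ← Finset.Nat.sum_antidiagonal_swap]
  exact Finset.sum_congr rfl fun x _ => by
    rw [coeff₂_outer₂_mul_inner₁, coeff_dilHom, mul_smul_comm]
    rfl

theorem specialize_inner_X_mul (c : ℂ) (F : U⟦X⟧⟦X⟧) :
    specialize c (inner₁ PowerSeries.X * F) = PowerSeries.X * (c • specialize c F) := by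
  ext N
  rw [coeff_specialize]
  cases N with
  | zero => simp [coeff₂_zero_inner_X_mul]
  | succ N =>
    rw [Finset.Nat.antidiagonal_succ, Finset.sum_cons, Finset.sum_map, PowerSeries.coeff_succ_X_mul,
      coeff_complex_smul, coeff_specialize, Finset.smul_sum, coeff₂_zero_inner_X_mul, smul_zero,
      zero_add]
    refine Finset.sum_congr rfl fun x _ => ?_
    simp [coeff₂_succ_inner_X_mul, pow_succ', mul_smul]

theorem specialize_outer_X_mul (c : ℂ) (F : U⟦X⟧⟦X⟧) :
    specialize c (PowerSeries.X * F) = PowerSeries.X * specialize c F := by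
  ext N
  rw [coeff_specialize]
  cases N with
  | zero => simp [coeff₂_zero_outer_X_mul]
  | succ N =>
    rw [Finset.Nat.antidiagonal_succ', Finset.sum_cons, Finset.sum_map,
      PowerSeries.coeff_succ_X_mul, coeff_specialize, coeff₂_zero_outer_X_mul, smul_zero, zero_add]
    refine Finset.sum_congr rfl fun x _ => ?_
    simp [coeff₂_succ_outer_X_mul]

/-- The linear form `a v + b u` is a nonzero divisor when `a ≠ 0`. -/
theorem isLeftRegular_linear {a : ℂ} (ha : a ≠ 0) (b : ℂ) :
    IsLeftRegular (a • PowerSeries.X + b • inner₁ PowerSeries.X : U⟦X⟧⟦X⟧) := by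
  rw [isLeftRegular_iff_right_eq_zero_of_mul]
  intro F hF
  -- Induction on the degree in u: once lower degrees vanish, the coefficient of uⁱvʲ⁺¹ in the
  -- product is a times that of uⁱvʲ in F.
  have h : ∀ i j, coeff₂ i j F = 0 := by
    intro i
    induction i with
    | zero =>
      intro j
      have := congrArg (coeff₂ 0 (j + 1)) hF
      simp only [add_mul, smul_mul_assoc] at this
      rwa [show coeff₂ _ _ (0 : U⟦X⟧⟦X⟧) = 0 by simp [coeff₂], coeff₂_add, coeff₂_smul, coeff₂_smul, coeff₂_succ_outer_X_mul, coeff₂_zero_inner_X_mul, smul_zero,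
        add_zero, smul_eq_zero_iff_right ha] at this
    | succ i ih =>
      intro j
      have := congrArg (coeff₂ (i + 1) (j + 1)) hF
      simp only [add_mul, smul_mul_assoc] at this
      rwa [show coeff₂ _ _ (0 : U⟦X⟧⟦X⟧) = 0 by simp [coeff₂], coeff₂_add, coeff₂_smul, coeff₂_smul, coeff₂_succ_outer_X_mul, coeff₂_succ_inner_X_mul, ih,
        smul_zero, add_zero, smul_eq_zero_iff_right ha] at this
  exact ext_coeff₂ fun i j => h i j

/-- The substitution `x ↦ y u w` into a complex power series, for a central element `y`. -/
noncomputable def diagHom (y : U) (hy : ∀ x, Commute y x) : ℂ⟦X⟧ →ₐ[ℂ] U⟦X⟧⟦X⟧ where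
  toFun f := PowerSeries.mk fun b =>
    PowerSeries.C (PowerSeries.coeff b f • y ^ b) * PowerSeries.X ^ b
  map_one' := by
    ext1 b
    rw [PowerSeries.coeff_mk, PowerSeries.coeff_one, PowerSeries.coeff_one]
    split_ifs with h <;> simp [h]
  map_mul' f g := by
    ext1 b
    simp only [PowerSeries.coeff_mk, PowerSeries.coeff_mul, Finset.sum_smul, map_sum,
      Finset.sum_mul]
    refine Finset.sum_congr rfl fun x hx => ?_
    rw [← Finset.HasAntidiagonal.mem_antidiagonal.1 hx, pow_add, pow_add, ← smul_mul_smul_comm,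
      map_mul]
    exact (PowerSeries.commute_X_pow _ _).mul_mul_mul_comm _ _
  map_zero' := by ext1 b; simp
  map_add' f g := by ext1 b; simp [add_smul, add_mul]
  commutes' a := by
    ext1 b
    rw [PowerSeries.coeff_mk, PowerSeries.algebraMap_apply, PowerSeries.algebraMap_apply,
      PowerSeries.coeff_C, PowerSeries.coeff_C]
    split_ifs with h
    · simp [h, Algebra.algebraMap_eq_smul_one, PowerSeries.algebraMap_apply (A := U)]
    · simp

theorem coeff_diagHom (y : U) (hy : ∀ x, Commute y x) (f : ℂ⟦X⟧) (b : ℕ) :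
    PowerSeries.coeff b (diagHom y hy f)
      = PowerSeries.C (PowerSeries.coeff b f • y ^ b) * PowerSeries.X ^ b :=
  PowerSeries.coeff_mk b fun b =>
    PowerSeries.C (PowerSeries.coeff b f • y ^ b) * PowerSeries.X ^ b

theorem diagHom_commute (y : U) (hy : ∀ x, Commute y x) (f : ℂ⟦X⟧) (F : U⟦X⟧⟦X⟧) :
    Commute (diagHom y hy f) F := by
  refine commute_of_commute_coeff (fun i x => ?_) F
  rw [coeff_diagHom]
  refine Commute.mul_left ?_ (PowerSeries.commute_X_pow x i).symm
  refine commute_of_commute_coeff (fun j x => ?_) x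
  rw [PowerSeries.coeff_C]
  split_ifs
  · exact ((hy x).pow_left i).smul_left _
  · exact Commute.zero_left x

theorem coeff₂_diagHom_mul (y : U) (hy : ∀ x, Commute y x) (f : ℂ⟦X⟧) (F : U⟦X⟧⟦X⟧) (a b : ℕ) :
    coeff₂ a b (diagHom y hy f * F) = ∑ m ∈ Finset.range (b + 1), if m ≤ a then
      (PowerSeries.coeff m f • y ^ m) * coeff₂ (a - m) (b - m) F else 0 := by
  rw [coeff₂, PowerSeries.coeff_mul, Finset.Nat.sum_antidiagonal_eq_sum_range_succ_mk, map_sum]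
  refine Finset.sum_congr rfl fun m _ => ?_
  rw [coeff_diagHom, mul_assoc, PowerSeries.coeff_C_mul, PowerSeries.coeff_X_pow_mul']
  split_ifs
  · rfl
  · rw [mul_zero]

/-- The dilation of the first variable. -/
noncomputable def dilInner (c : ℂ) : U⟦X⟧⟦X⟧ →+* U⟦X⟧⟦X⟧ :=
  PowerSeries.map (dilHom c : U⟦X⟧ →ₐ[ℂ] U⟦X⟧).toRingHom

theorem dilInner_inner₁ (c : ℂ) (p : U⟦X⟧) : dilInner c (inner₁ p) = inner₁ (dilHom c p) :=
  PowerSeries.map_C _ _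

theorem dilInner_outer₂ (c : ℂ) (k : U⟦X⟧) : dilInner c (outer₂ k) = outer₂ k := by
  ext1 b
  rw [dilInner, PowerSeries.coeff_map, PowerSeries.coeff_map]
  exact dilHom_C _ _

/-- The substituted variable is x = y·u·w, so dilating u rescales x; `dilOuter_diagHom` does the
same for w. -/
theorem dilInner_diagHom (c : ℂ) (y : U) (hy : ∀ x, Commute y x) (f : ℂ⟦X⟧) :
    dilInner c (diagHom y hy f) = diagHom y hy (PowerSeries.rescale c f) := by
  ext1 b
  rw [dilInner, PowerSeries.coeff_map, coeff_diagHom, coeff_diagHom]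
  change dilHom c _ = _
  rw [map_mul, map_pow, dilHom_C, dilHom_X, PowerSeries.coeff_rescale, smul_pow, mul_smul_comm,
    ← smul_mul_assoc, mul_smul, smul_C]

theorem dilOuter_inner₁ (c : ℂ) (p : U⟦X⟧) : dilHom c (inner₁ p) = inner₁ p :=
  dilHom_C _ _

theorem dilOuter_outer₂ (c : ℂ) (k : U⟦X⟧) : dilHom c (outer₂ k) = outer₂ (dilHom c k) := by
  refine ext_coeff₂ fun a b => ?_
  rw [coeff₂, coeff₂, coeff_dilHom, PowerSeries.coeff_map, PowerSeries.coeff_map, coeff_dilHom,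
    coeff_complex_smul, PowerSeries.coeff_C, PowerSeries.coeff_C]
  split_ifs <;> simp

theorem dilOuter_diagHom (c : ℂ) (y : U) (hy : ∀ x, Commute y x) (f : ℂ⟦X⟧) :
    dilHom c (diagHom y hy f) = diagHom y hy (PowerSeries.rescale c f) := by
  ext1 b
  rw [coeff_dilHom, coeff_diagHom, coeff_diagHom, PowerSeries.coeff_rescale, mul_smul,
    ← smul_mul_assoc, smul_C]

end Series

/-! ### The defining relations in terms of generating series -/

section Relations

variable {q : ℂ} {n : ℕ}

theorem commute_of_commute_gen {x : Uq q n}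
    (h : ∀ g, Commute x (RingQuot.mkAlgHom ℂ (Rel q n) (gen g))) (y : Uq q n) : Commute x y := by
  obtain ⟨z, rfl⟩ := RingQuot.mkAlgHom_surjective ℂ (Rel q n) y
  induction z using FreeAlgebra.induction with
  | grade0 r => rw [AlgHom.commutes]; exact Algebra.commute_algebraMap_right _ _
  | grade1 g => exact h g
  | mul a b ha hb => rw [map_mul]; exact ha.mul_right hb
  | add a b ha hb => rw [map_add]; exact ha.add_right hb

/-- The central element `q^c`. -/
noncomputable def qcU (q : ℂ) (n : ℕ) : Uq q n := RingQuot.mkAlgHom ℂ (Rel q n) (gen .qc)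

/-- The central element `q^{-c}`. -/
noncomputable def qcInvU (q : ℂ) (n : ℕ) : Uq q n := RingQuot.mkAlgHom ℂ (Rel q n) (gen .qcInv)

theorem qcU_commute (x : Uq q n) : Commute (qcU q n) x :=
  commute_of_commute_gen (fun g => by
    have h := RingQuot.mkAlgHom_rel ℂ (Rel.qc_comm (q := q) g)
    rwa [map_mul, map_mul] at h) x

theorem qcInvU_commute (x : Uq q n) : Commute (qcInvU q n) x := by
  have h1 : qcU q n * qcInvU q n = 1 := by
    have h := RingQuot.mkAlgHom_rel ℂ (Rel.qc_qcInv (q := q) (n := n))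
    rwa [map_mul, map_one] at h
  have h2 : qcInvU q n * qcU q n = 1 := by
    have h := RingQuot.mkAlgHom_rel ℂ (Rel.qcInv_qc (q := q) (n := n))
    rwa [map_mul, map_one] at h
  exact Commute.units_inv_left (u := ⟨qcU q n, qcInvU q n, h1, h2⟩) (qcU_commute x)

/-- The coefficient of `u ^ r` in `L^±(u)`, for an integer `r`. -/
noncomputable def mode (q : ℂ) (n : ℕ) (s : PM) (r : ℤ) : Matrix (Fin n) (Fin n) (Uq q n) :=
  (freeMode s r).map (RingQuot.mkAlgHom ℂ (Rel q n))

theorem mode_plus (k : ℕ) (i j : Fin n) :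
    mode q n .plus k i j = PowerSeries.coeff k (LMat q n .plus i j) := by
  simp [mode, freeMode, LMat, l]

theorem mode_minus (k : ℕ) (i j : Fin n) :
    mode q n .minus (-k) i j = PowerSeries.coeff k (LMat q n .minus i j) := by
  simp [mode, freeMode, LMat, l]

theorem freeMode_plus_of_neg {r : ℤ} (hr : r < 0) : freeMode (n := n) .plus r = 0 := by
  simp [freeMode, hr]

theorem freeMode_minus_of_pos {r : ℤ} (hr : 0 < r) : freeMode (n := n) .minus r = 0 := by
  simp [freeMode, hr]

theorem mode_plus_of_neg {r : ℤ} (hr : r < 0) : mode q n .plus r = 0 := by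
  rw [mode, freeMode_plus_of_neg hr, Matrix.map_zero _ (map_zero _)]

theorem mode_minus_of_pos {r : ℤ} (hr : 0 < r) : mode q n .minus r = 0 := by
  rw [mode, freeMode_minus_of_pos hr, Matrix.map_zero _ (map_zero _)]

theorem kronecker_one_mul_one_kronecker {A : Type*} [Ring A] (M M' : Matrix (Fin n) (Fin n) A)
    (P J : Fin n × Fin n) :
    ((M ⊗ₖ (1 : Matrix (Fin n) (Fin n) A)) * ((1 : Matrix (Fin n) (Fin n) A) ⊗ₖ M')) P J
      = M P.1 J.1 * M' P.2 J.2 := by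
  rw [Matrix.mul_apply, Finset.sum_eq_single (J.1, P.2)]
  · simp
  · rintro ⟨a, b⟩ _ h
    simp only [Matrix.kroneckerMap_apply, Matrix.one_apply]
    by_cases h1 : P.2 = b
    · have : a ≠ J.1 := fun h2 => h (by rw [h1, h2])
      simp [this]
    · simp [h1]
  · simp

theorem one_kronecker_mul_kronecker_one {A : Type*} [Ring A] (M M' : Matrix (Fin n) (Fin n) A)
    (I P : Fin n × Fin n) :
    (((1 : Matrix (Fin n) (Fin n) A) ⊗ₖ M') * (M ⊗ₖ (1 : Matrix (Fin n) (Fin n) A))) I P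
      = M' I.2 P.2 * M I.1 P.1 := by
  rw [Matrix.mul_apply, Finset.sum_eq_single (I.1, P.2)]
  · simp
  · rintro ⟨a, b⟩ _ h
    simp only [Matrix.kroneckerMap_apply, Matrix.one_apply]
    by_cases h1 : I.1 = a
    · have : b ≠ P.2 := fun h2 => h (by rw [h1, h2])
      simp [this]
    · simp [h1]
  · simp

/-- Beyond N one of the two modes vanishes, so the formally infinite sum is finite and may be mapped
to the quotient term by term. -/
theorem mk_rllLeft (y : Free n) (s t : PM) (a b : ℤ) (N : ℕ)
    (hN : ∀ m : ℕ, N < m → freeMode (n := n) s (a - m) = 0 ∨ freeMode (n := n) t (b + m) = 0)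
    (I J : Fin n × Fin n) :
    RingQuot.mkAlgHom ℂ (Rel q n) (rllLeft q n y s t a b I J)
      = ∑ m ∈ Finset.range (N + 1), RingQuot.mkAlgHom ℂ (Rel q n) y ^ m *
        ∑ P, algebraMap ℂ (Uq q n) (PowerSeries.coeff m (RMatrix q n I P))
          * (mode q n s (a - m) P.1 J.1 * mode q n t (b + m) P.2 J.2) := by
  rw [rllLeft, finsum_eq_sum_of_support_subset (s := Finset.range (N + 1))]
  · rw [Matrix.sum_apply, map_sum]
    refine Finset.sum_congr rfl fun m _ => ?_
    rw [Matrix.smul_apply, smul_eq_mul, map_mul, map_pow, mul_assoc, Matrix.mul_apply, map_sum]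
    congr 1
    refine Finset.sum_congr rfl fun P _ => ?_
    rw [kronecker_one_mul_one_kronecker, map_mul, map_mul, RCoeff, Matrix.map_apply,
      AlgHom.commutes]
    rfl
  · intro m hm
    by_contra h
    have h' : N < m := by simpa using h
    refine hm ?_
    rcases hN m h' with h0 | h0 <;> simp [h0]

theorem mk_rllRight (y : Free n) (s t : PM) (a b : ℤ) (N : ℕ)
    (hN : ∀ m : ℕ, N < m → freeMode (n := n) s (a - m) = 0 ∨ freeMode (n := n) t (b + m) = 0)
    (I J : Fin n × Fin n) :
    RingQuot.mkAlgHom ℂ (Rel q n) (rllRight q n y s t a b I J)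
      = ∑ m ∈ Finset.range (N + 1), RingQuot.mkAlgHom ℂ (Rel q n) y ^ m *
        ∑ P, algebraMap ℂ (Uq q n) (PowerSeries.coeff m (RMatrix q n P J))
          * (mode q n t (b + m) I.2 P.2 * mode q n s (a - m) I.1 P.1) := by
  rw [rllRight, finsum_eq_sum_of_support_subset (s := Finset.range (N + 1))]
  · rw [Matrix.sum_apply, map_sum]
    refine Finset.sum_congr rfl fun m _ => ?_
    rw [Matrix.smul_apply, smul_eq_mul, map_mul, map_pow, Matrix.mul_apply, map_sum]
    congr 1
    refine Finset.sum_congr rfl fun P _ => ?_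
    rw [one_kronecker_mul_kronecker_one, map_mul, map_mul, RCoeff, Matrix.map_apply,
      AlgHom.commutes, Algebra.commutes]
    rfl
  · intro m hm
    by_contra h
    have h' : N < m := by simpa using h
    refine hm ?_
    rcases hN m h' with h0 | h0 <;> simp [h0]

theorem RMatrix_apply (I J : Fin n × Fin n) : RMatrix q n I J
    = rEntry q (gSeries q n) (gSeries q n * PowerSeries.X) I J := by
  rw [RMatrix, Matrix.smul_apply, Matrix.sub_apply, Matrix.smul_apply, Matrix.map_apply,
    Matrix.map_apply, rEntry, smul_eq_mul, smul_eq_mul, PowerSeries.smul_eq_C_mul,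
    PowerSeries.smul_eq_C_mul, gSeries]
  ring

/-! #### Relations between series with different signs -/

/-- With w = v⁻¹ all series are power series in u and w, and R(q^{∓c}uw) makes sense without
clearing denominators. Comparing coefficients of uᵃwᵇ, the modes of L⁻ cut the sum at m ≤ b and
those of L⁺ at m ≤ a. -/
theorem mixed_relation (I J : Fin n × Fin n) :
    ∑ P, diagHom (qcInvU q n) qcInvU_commute
        (rEntry q (gSeries q n) (gSeries q n * PowerSeries.X) I P)
        * inner₁ (LMat q n .plus P.1 J.1) * outer₂ (LMat q n .minus P.2 J.2)
      = ∑ P, outer₂ (LMat q n .minus I.2 P.2) * inner₁ (LMat q n .plus I.1 P.1)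
        * diagHom (qcU q n) qcU_commute
          (rEntry q (gSeries q n) (gSeries q n * PowerSeries.X) P J) := by
  refine ext_coeff₂ fun a b => ?_
  have hN : ∀ m : ℕ, b < m → freeMode (n := n) .plus ((a : ℤ) - m) = 0 ∨
      freeMode (n := n) .minus (-(b : ℤ) + m) = 0 := fun m hm =>
    Or.inr (freeMode_minus_of_pos (by omega))
  have h := RingQuot.mkAlgHom_rel ℂ (Rel.rllMixed (q := q) (n := n) a (-b) I J)
  rw [mk_rllLeft _ _ _ _ _ b hN, mk_rllRight _ _ _ _ _ b hN] at h
  rw [coeff₂_sum, coeff₂_sum]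
  have h1 : ∀ P : Fin n × Fin n, ∀ m ∈ Finset.range (b + 1),
      (if m ≤ a then (PowerSeries.coeff m (RMatrix q n I P) • qcInvU q n ^ m) *
        coeff₂ (a - m) (b - m) (inner₁ (LMat q n .plus P.1 J.1) * outer₂ (LMat q n .minus P.2 J.2))
        else 0)
      = qcInvU q n ^ m * (algebraMap ℂ (Uq q n) (PowerSeries.coeff m (RMatrix q n I P))
          * (mode q n .plus (a - m) P.1 J.1 * mode q n .minus (-b + m) P.2 J.2)) := by
    intro P m hm
    have hm' : m ≤ b := by simpa [Nat.lt_succ_iff] using hm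
    split_ifs with h0
    · rw [coeff₂_inner₁_mul_outer₂, ← mode_plus, ← mode_minus, Nat.cast_sub h0, Nat.cast_sub hm',
        neg_sub, Algebra.smul_def, Algebra.commutes, mul_assoc, sub_eq_neg_add (m : ℤ)]
    · rw [mode_plus_of_neg (by omega)]
      simp
  have h2 : ∀ P : Fin n × Fin n, ∀ m ∈ Finset.range (b + 1),
      (if m ≤ a then (PowerSeries.coeff m (RMatrix q n P J) • qcU q n ^ m) *
        coeff₂ (a - m) (b - m) (outer₂ (LMat q n .minus I.2 P.2) * inner₁ (LMat q n .plus I.1 P.1))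
        else 0)
      = qcU q n ^ m * (algebraMap ℂ (Uq q n) (PowerSeries.coeff m (RMatrix q n P J))
          * (mode q n .minus (-b + m) I.2 P.2 * mode q n .plus (a - m) I.1 P.1)) := by
    intro P m hm
    have hm' : m ≤ b := by simpa [Nat.lt_succ_iff] using hm
    split_ifs with h0
    · rw [coeff₂_outer₂_mul_inner₁, ← mode_plus, ← mode_minus, Nat.cast_sub h0, Nat.cast_sub hm',
        neg_sub, Algebra.smul_def, Algebra.commutes, mul_assoc, sub_eq_neg_add (m : ℤ)]
    · rw [mode_plus_of_neg (by omega)]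
      simp
  calc _ = ∑ P, ∑ m ∈ Finset.range (b + 1), qcInvU q n ^ m *
          (algebraMap ℂ (Uq q n) (PowerSeries.coeff m (RMatrix q n I P))
          * (mode q n .plus (a - m) P.1 J.1 * mode q n .minus (-b + m) P.2 J.2)) := by
        refine Finset.sum_congr rfl fun P _ => ?_
        rw [mul_assoc, coeff₂_diagHom_mul, ← RMatrix_apply]
        exact Finset.sum_congr rfl (h1 P)
    _ = ∑ P, ∑ m ∈ Finset.range (b + 1), qcU q n ^ m *
          (algebraMap ℂ (Uq q n) (PowerSeries.coeff m (RMatrix q n P J))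
          * (mode q n .minus (-b + m) I.2 P.2 * mode q n .plus (a - m) I.1 P.1)) := by
        rw [Finset.sum_comm, Finset.sum_comm (f := fun P m => qcU q n ^ m * _)]
        simp only [Finset.mul_sum] at h
        exact h
    _ = _ := by
        refine Finset.sum_congr rfl fun P _ => ?_
        rw [← (diagHom_commute _ _ _ _).eq, coeff₂_diagHom_mul, ← RMatrix_apply]
        exact (Finset.sum_congr rfl (h2 P)).symm

/-! #### Relations between series with the same sign -/

theorem isUnit_gSeries (hq0 : q ≠ 0) : IsUnit (gSeries q n) := by
  rw [PowerSeries.isUnit_iff_constantCoeff, constantCoeff_gSeries]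
  exact (inv_ne_zero hq0).isUnit

theorem coeff_map_linear_mul {U : Type*} [Ring U] [Algebra ℂ U] (c d : ℂ) (Q Q' : ℕ → U)
    (h0 : Q' 0 = 0) (hQ : ∀ j, Q' (j + 1) = Q j) (j : ℕ) :
    PowerSeries.coeff j (PowerSeries.map (algebraMap ℂ U)
      (PowerSeries.C c - PowerSeries.X * PowerSeries.C d) * PowerSeries.mk Q)
      = c • Q j - d • Q' j := by
  rw [map_sub, map_mul (PowerSeries.map _), PowerSeries.map_C, PowerSeries.map_C, PowerSeries.map_X,
    sub_mul, map_sub,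
    PowerSeries.coeff_C_mul, PowerSeries.coeff_mk, mul_assoc, Algebra.smul_def, Algebra.smul_def]
  congr 1
  cases j with
  | zero => rw [PowerSeries.coeff_zero_X_mul, h0, mul_zero]
  | succ j => rw [PowerSeries.coeff_succ_X_mul, PowerSeries.coeff_C_mul, PowerSeries.coeff_mk, hQ]

theorem RMatrix_apply_eq_mul (I J : Fin n × Fin n) : RMatrix q n I J
    = gSeries q n * (PowerSeries.C (R0 q n I J) - PowerSeries.X * PowerSeries.C (R1 q n I J)) := by
  rw [RMatrix, Matrix.smul_apply, Matrix.sub_apply, Matrix.smul_apply, Matrix.map_apply,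
    Matrix.map_apply, smul_eq_mul, smul_eq_mul, gSeries]

/-- The coefficients of the relation `(R - x R̃) L₁ L₂ = L₂ L₁ (R - x R̃)` along a diagonal
sequence of modes. -/
theorem same_sign_modes (hq0 : q ≠ 0) (s : PM) (A B : ℕ → ℤ)
    (hA : ∀ j m : ℕ, m ≤ j → A (j - m) = A j - m) (hB : ∀ j m : ℕ, m ≤ j → B (j - m) = B j + m)
    (hN : ∀ j m : ℕ, j < m → freeMode (n := n) s (A j - m) = 0 ∨
      freeMode (n := n) s (B j + m) = 0)
    (I J : Fin n × Fin n) (j : ℕ) :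
    ∑ P, (R0 q n I P • (mode q n s (A j) P.1 J.1 * mode q n s (B j) P.2 J.2)
        - R1 q n I P • (mode q n s (A j - 1) P.1 J.1 * mode q n s (B j + 1) P.2 J.2))
      = ∑ P, (R0 q n P J • (mode q n s (B j) I.2 P.2 * mode q n s (A j) I.1 P.1)
        - R1 q n P J • (mode q n s (B j + 1) I.2 P.2 * mode q n s (A j - 1) I.1 P.1)) := by
  -- The term just before the start of the diagonal vanishes, so the shifted sequence below begins
  -- with zero.
  have hz : mode q n s (A 0 - 1) = 0 ∨ mode q n s (B 0 + 1) = 0 := by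
    rcases hN 0 1 one_pos with h | h
    · left
      rw [mode, ← Nat.cast_one, h, Matrix.map_zero _ (map_zero _)]
    · right
      rw [mode, ← Nat.cast_one, h, Matrix.map_zero _ (map_zero _)]
  have hA1 : ∀ j : ℕ, A (j + 1) - 1 = A j := fun j => by
    have := hA (j + 1) 1 (by omega)
    rw [Nat.add_sub_cancel] at this
    simpa using this.symm
  have hB1 : ∀ j : ℕ, B (j + 1) + 1 = B j := fun j => by
    have := hB (j + 1) 1 (by omega)
    rw [Nat.add_sub_cancel] at this
    simpa using this.symm
  -- Along a diagonal the sum of the two exponents is constant, and the relation becomes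
  -- multiplication by R(x) of the generating series in the position j.
  have key : ∑ P, PowerSeries.map (algebraMap ℂ (Uq q n)) (RMatrix q n I P)
        * PowerSeries.mk (fun j => mode q n s (A j) P.1 J.1 * mode q n s (B j) P.2 J.2)
      = ∑ P, PowerSeries.map (algebraMap ℂ (Uq q n)) (RMatrix q n P J)
        * PowerSeries.mk (fun j => mode q n s (B j) I.2 P.2 * mode q n s (A j) I.1 P.1) := by
    ext k
    have h := RingQuot.mkAlgHom_rel ℂ (Rel.rll (q := q) (n := n) s (A k) (B k) I J)
    rw [mk_rllLeft _ _ _ _ _ k (hN k), mk_rllRight _ _ _ _ _ k (hN k)] at h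
    simp only [map_one, one_pow, one_mul] at h
    simp only [map_sum, PowerSeries.coeff_mul, Finset.Nat.sum_antidiagonal_eq_sum_range_succ_mk,
      PowerSeries.coeff_map, PowerSeries.coeff_mk]
    rw [Finset.sum_comm, Finset.sum_comm (s := Finset.univ (α := Fin n × Fin n))]
    refine Eq.trans ?_ (h.trans ?_)
    · refine Finset.sum_congr rfl fun m hm => ?_
      rw [hA k m (by simpa [Nat.lt_succ_iff] using hm), hB k m (by simpa [Nat.lt_succ_iff] using hm)]
    · refine Finset.sum_congr rfl fun m hm => ?_
      rw [hA k m (by simpa [Nat.lt_succ_iff] using hm), hB k m (by simpa [Nat.lt_succ_iff] using hm)]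
  -- The scalar prefactor f(x)/(q - q⁻¹x) is an invertible power series and cancels.
  simp only [RMatrix_apply_eq_mul, map_mul _ (gSeries q n), mul_assoc, ← Finset.mul_sum] at key
  have key2 := congrArg (PowerSeries.coeff j)
    (((isUnit_gSeries hq0).map (PowerSeries.map (algebraMap ℂ (Uq q n)))).mul_left_cancel key)
  rw [map_sum, map_sum] at key2
  refine Eq.trans ?_ (key2.trans ?_)
  · refine Finset.sum_congr rfl fun P _ => ?_
    rw [coeff_map_linear_mul _ _ _
      (fun j => mode q n s (A j - 1) P.1 J.1 * mode q n s (B j + 1) P.2 J.2)]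
    · rcases hz with h | h <;> simp [h]
    · intro j
      simp only [hA1, hB1]
  · refine Finset.sum_congr rfl fun P _ => ?_
    rw [coeff_map_linear_mul _ _ _
      (fun j => mode q n s (B j + 1) I.2 P.2 * mode q n s (A j - 1) I.1 P.1)]
    · rcases hz with h | h <;> simp [h]
    · intro j
      simp only [hA1, hB1]

theorem coeff_X_mul_LMat_plus (k : ℕ) (i j : Fin n) :
    PowerSeries.coeff k (PowerSeries.X * LMat q n .plus i j)
      = mode q n .plus ((k : ℤ) - 1) i j := by
  cases k with
  | zero => rw [PowerSeries.coeff_zero_X_mul, mode_plus_of_neg (by simp), Matrix.zero_apply]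
  | succ k =>
    rw [PowerSeries.coeff_succ_X_mul, Nat.cast_succ, add_sub_cancel_right, mode_plus]

theorem coeff_X_mul_LMat_minus (k : ℕ) (i j : Fin n) :
    PowerSeries.coeff k (PowerSeries.X * LMat q n .minus i j)
      = mode q n .minus (1 - (k : ℤ)) i j := by
  cases k with
  | zero => rw [PowerSeries.coeff_zero_X_mul, mode_minus_of_pos (by simp), Matrix.zero_apply]
  | succ k =>
    rw [PowerSeries.coeff_succ_X_mul, Nat.cast_succ, sub_add_cancel_right, mode_minus]

section

variable {U : Type*} [Ring U]

theorem outer_X_mul_inner₁_mul_outer₂ (p k : U⟦X⟧) :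
    PowerSeries.X * (inner₁ p * outer₂ k) = inner₁ p * outer₂ (PowerSeries.X * k) := by
  rw [map_mul outer₂, PowerSeries.map_X, ← mul_assoc, ← mul_assoc, PowerSeries.X_mul]

theorem outer_X_mul_outer₂_mul_inner₁ (p k : U⟦X⟧) :
    PowerSeries.X * (outer₂ k * inner₁ p) = outer₂ (PowerSeries.X * k) * inner₁ p := by
  rw [map_mul outer₂, PowerSeries.map_X, ← mul_assoc]

theorem inner_X_mul_inner₁_mul_outer₂ (p k : U⟦X⟧) :
    inner₁ PowerSeries.X * (inner₁ p * outer₂ k) = inner₁ (PowerSeries.X * p) * outer₂ k := by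
  rw [map_mul inner₁, ← mul_assoc]

theorem inner_X_mul_outer₂_mul_inner₁ [Algebra ℂ U] (p k : U⟦X⟧) :
    inner₁ PowerSeries.X * (outer₂ k * inner₁ p) = outer₂ k * inner₁ (PowerSeries.X * p) := by
  have h : Commute (inner₁ (PowerSeries.X : U⟦X⟧)) (outer₂ k) :=
    commute_of_commute_coeff (fun i x => by
      rw [PowerSeries.coeff_C]
      split_ifs
      · exact (PowerSeries.commute_X x).symm
      · exact Commute.zero_left x) _
  rw [map_mul inner₁, ← mul_assoc, h.eq, mul_assoc]

end

/-- Complex power series in two variables as series with coefficients in an algebra. -/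
noncomputable def scalarSeries (U : Type*) [Ring U] [Algebra ℂ U] : ℂ⟦X⟧⟦X⟧ →ₐ[ℂ] U⟦X⟧⟦X⟧ :=
  PowerSeries.mapAlgHom (PowerSeries.mapAlgHom (Algebra.ofId ℂ U))

theorem scalarSeries_X (U : Type*) [Ring U] [Algebra ℂ U] :
    scalarSeries U PowerSeries.X = PowerSeries.X :=
  PowerSeries.map_X _

theorem scalarSeries_inner_X (U : Type*) [Ring U] [Algebra ℂ U] :
    scalarSeries U (PowerSeries.C PowerSeries.X) = inner₁ PowerSeries.X :=
  (PowerSeries.map_C _ _).trans (congrArg PowerSeries.C (PowerSeries.map_X _))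

theorem scalarSeries_commute {U : Type*} [Ring U] [Algebra ℂ U] (f : ℂ⟦X⟧⟦X⟧) (F : U⟦X⟧⟦X⟧) :
    Commute (scalarSeries U f) F := by
  refine commute_of_commute_coeff (fun i x => commute_of_commute_coeff (fun j y => ?_) x) F
  exact Algebra.commutes _ _

/-- The coefficients `(α, β)` of the relation `(α R - β R̃) L₁ L₂ = L₂ L₁ (α R - β R̃)`, where
the first variable is scaled by `c`. -/
noncomputable def PM.forms : PM → ℂ → ℂ⟦X⟧⟦X⟧ × ℂ⟦X⟧⟦X⟧
  | .plus, c => (PowerSeries.X, c • PowerSeries.C PowerSeries.X)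
  | .minus, c => (c⁻¹ • PowerSeries.C PowerSeries.X, PowerSeries.X)

theorem scalarSeries_rEntry_mul {U : Type*} [Ring U] [Algebra ℂ U] (α β : ℂ⟦X⟧⟦X⟧)
    (I J : Fin n × Fin n) (F : U⟦X⟧⟦X⟧) :
    scalarSeries U (rEntry q α β I J) * F
      = R0 q n I J • (scalarSeries U α * F) - R1 q n I J • (scalarSeries U β * F) := by
  rw [rEntry, map_sub, map_smul, map_smul, sub_mul, smul_mul_assoc, smul_mul_assoc]

theorem coeff₂_sub {U : Type*} [Ring U] (F G : U⟦X⟧⟦X⟧) (a b : ℕ) :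
    coeff₂ a b (F - G) = coeff₂ a b F - coeff₂ a b G := by
  simp only [coeff₂, map_sub]

/-- For equal signs u/v is not a power series in the available variables. Multiplying by v (sign
plus) or u⁻¹ (sign minus) gives vR - uR̃ or u⁻¹R - v⁻¹R̃, which is polynomial in them. -/
theorem same_sign_relation_aux (hq0 : q ≠ 0) (s : PM) (I J : Fin n × Fin n) :
    ∑ P, scalarSeries (Uq q n) (rEntry q (s.forms 1).1 (s.forms 1).2 I P)
        * (inner₁ (LMat q n s P.1 J.1) * outer₂ (LMat q n s P.2 J.2))
      = ∑ P, scalarSeries (Uq q n) (rEntry q (s.forms 1).1 (s.forms 1).2 P J)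
        * (outer₂ (LMat q n s I.2 P.2) * inner₁ (LMat q n s I.1 P.1)) := by
  refine ext_coeff₂ fun a b => ?_
  simp only [coeff₂_sum, scalarSeries_rEntry_mul, coeff₂_sub, coeff₂_smul]
  cases s with
  | plus =>
    -- The factor v lowers the second exponent by one, so the diagonal has sum a + b - 1 and is
    -- evaluated at position a.
    have h := same_sign_modes (n := n) hq0 .plus (fun j => j) (fun j => (a : ℤ) + b - 1 - j)
      (fun j m h => Nat.cast_sub h) (fun j m h => by rw [Nat.cast_sub h]; ring)
      (fun j m h => Or.inl (freeMode_plus_of_neg (by omega))) I J a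
    simp only [show (a : ℤ) + b - 1 - a = b - 1 by ring, sub_add_cancel] at h
    simpa only [PM.forms, one_smul, scalarSeries_X, scalarSeries_inner_X,
      outer_X_mul_inner₁_mul_outer₂, outer_X_mul_outer₂_mul_inner₁, inner_X_mul_inner₁_mul_outer₂,
      inner_X_mul_outer₂_mul_inner₁, coeff₂_inner₁_mul_outer₂, coeff₂_outer₂_mul_inner₁,
      coeff_X_mul_LMat_plus, ← mode_plus] using h
  | minus =>
    -- Here u⁻¹ shifts the first exponent: at position b the modes are 1 - a and -b.
    have h := same_sign_modes (n := n) hq0 .minus (fun j => 1 - (a : ℤ) - b + j) (fun j => -(j : ℤ))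
      (fun j m h => by rw [Nat.cast_sub h]; ring) (fun j m h => by rw [Nat.cast_sub h]; ring)
      (fun j m h => Or.inr (freeMode_minus_of_pos (by omega))) I J b
    simp only [sub_add_cancel, neg_add_eq_sub, show 1 - (a : ℤ) - 1 = -a by ring] at h
    simpa only [PM.forms, inv_one, one_smul, scalarSeries_X, scalarSeries_inner_X,
      outer_X_mul_inner₁_mul_outer₂, outer_X_mul_outer₂_mul_inner₁, inner_X_mul_inner₁_mul_outer₂,
      inner_X_mul_outer₂_mul_inner₁, coeff₂_inner₁_mul_outer₂, coeff₂_outer₂_mul_inner₁,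
      coeff_X_mul_LMat_minus, ← mode_minus] using h

theorem scale_one (s : PM) : s.scale 1 = 1 := by
  cases s <;> simp [PM.scale]

theorem dilInner_scalarSeries_forms {U : Type*} [Ring U] [Algebra ℂ U] (s : PM) (c : ℂ)
    (I J : Fin n × Fin n) :
    dilInner (s.scale c) (scalarSeries U (rEntry q (s.forms 1).1 (s.forms 1).2 I J))
      = scalarSeries U (rEntry q (s.forms c).1 (s.forms c).2 I J) := by
  have hsmul : ∀ (d e : ℂ) (F : U⟦X⟧⟦X⟧), dilInner d (e • F) = e • dilInner d F := by
    intro d e F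
    rw [Algebra.smul_def, map_mul, Algebra.smul_def, ← inner₁_algebraMap, dilInner_inner₁,
      AlgHom.commutes]
  have hX : ∀ d : ℂ, dilInner d (PowerSeries.X : U⟦X⟧⟦X⟧) = PowerSeries.X :=
    fun d => PowerSeries.map_X _
  have hY : ∀ d : ℂ, dilInner d (inner₁ (PowerSeries.X : U⟦X⟧)) = d • inner₁ PowerSeries.X := by
    intro d
    rw [dilInner_inner₁, dilHom_X, Algebra.smul_def, map_mul, inner₁_algebraMap, ← Algebra.smul_def]
  simp only [rEntry, map_sub, map_smul, hsmul]
  cases s <;> simp only [PM.forms, PM.scale, map_smul, scalarSeries_X, scalarSeries_inner_X, hX, hY,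
    inv_one, one_smul]

theorem same_sign_relation (hq0 : q ≠ 0) (s : PM) (c : ℂ) (I J : Fin n × Fin n) :
    ∑ P, scalarSeries (Uq q n) (rEntry q (s.forms c).1 (s.forms c).2 I P)
        * inner₁ (dilate s c (LMat q n s P.1 J.1)) * outer₂ (LMat q n s P.2 J.2)
      = ∑ P, outer₂ (LMat q n s I.2 P.2) * inner₁ (dilate s c (LMat q n s I.1 P.1))
        * scalarSeries (Uq q n) (rEntry q (s.forms c).1 (s.forms c).2 P J) := by
  have h := congrArg (dilInner (s.scale c)) (same_sign_relation_aux hq0 s I J)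
  simp only [map_sum, map_mul, dilInner_scalarSeries_forms, dilInner_inner₁, dilInner_outer₂] at h
  simp only [dilate_eq, mul_assoc]
  refine h.trans (Finset.sum_congr rfl fun P _ => ?_)
  rw [(scalarSeries_commute _ _).eq, mul_assoc]

end Relations

/-! ### Fusion -/

section Fusion

variable {q : ℂ} {n : ℕ}

theorem sum_rEntry_row_smul {A : Type*} [AddCommGroup A] [Module ℂ A] (α β : ℂ) {i a : Fin n}
    (h : i ≠ a) (F : Fin n × Fin n → A) :
    ∑ P, rEntry q α β (i, a) P • F P
      = (α - β) • F (i, a) + ((q - q⁻¹) * (if i < a then α else β)) • F (a, i) := by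
  rw [Fintype.sum_eq_add (i, a) (a, i) (by simp [h])]
  · simp [rEntry_apply, h]
  · rintro ⟨j, b⟩ ⟨h1, h2⟩
    rw [rEntry_apply, if_neg (by grind), if_neg (by grind), zero_smul]

theorem sum_rEntry_col_smul {A : Type*} [AddCommGroup A] [Module ℂ A] (α β : ℂ) {i a : Fin n}
    (h : i ≠ a) (F : Fin n × Fin n → A) :
    ∑ P, rEntry q α β P (i, a) • F P
      = (α - β) • F (i, a) + ((q - q⁻¹) * (if a < i then α else β)) • F (a, i) := by
  rw [Fintype.sum_eq_add (i, a) (a, i) (by simp [h])]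
  · simp [rEntry_apply, h, h.symm]
  · rintro ⟨j, b⟩ ⟨h1, h2⟩
    rw [rEntry_apply, if_neg (by grind), if_neg (by grind), zero_smul]

theorem sum_rEntry_col_self_smul {A : Type*} [AddCommGroup A] [Module ℂ A] (α β : ℂ) (i : Fin n)
    (F : Fin n × Fin n → A) :
    ∑ P, rEntry q α β P (i, i) • F P = (q * α - q⁻¹ * β) • F (i, i) := by
  rw [Fintype.sum_eq_single (i, i)]
  · simp [rEntry_apply]
  · rintro ⟨j, b⟩ h1
    rw [rEntry_apply, if_neg (by grind), if_neg (by grind), zero_smul]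

/-- At x = q² one has q - q⁻¹ = (1 - q²)p, so a row (i, a) with i < a of R - q²R̃ q-antisymmetrizes.
Its columns (k, k) vanish and its columns (k, l), (l, k) are proportional, which yields `same` and
`diff`; 1 - q² ≠ 0 is needed to divide. -/
theorem isQPair_of_relation {A : Type*} [Ring A] [Algebra ℂ A] (hq0 : q ≠ 0) (hq : q ^ 2 ≠ 1)
    {X Y : Matrix (Fin n) (Fin n) A}
    (h : ∀ I J, ∑ P, rEntry q 1 (q ^ 2) I P • (X P.1 J.1 * Y P.2 J.2)
      = ∑ P, rEntry q 1 (q ^ 2) P J • (Y I.2 P.2 * X I.1 P.1)) : IsQPair (-q)⁻¹ X Y := by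
  have h1 : (1 - q ^ 2 : ℂ) ≠ 0 := sub_ne_zero.2 hq.symm
  have hp : q - q⁻¹ = (1 - q ^ 2) * (-q)⁻¹ := by field_simp; ring
  have key : ∀ i a c d : Fin n, i < a →
      (1 - q ^ 2) • (X i c * Y a d + (-q)⁻¹ • (X a c * Y i d))
        = ∑ P, rEntry q 1 (q ^ 2) P (c, d) • (Y a P.2 * X i P.1) := by
    intro i a c d hia
    rw [← h (i, a) (c, d), sum_rEntry_row_smul _ _ hia.ne, if_pos hia, mul_one, hp, smul_add,
      mul_smul]
  constructor
  · intro i j k hij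
    refine (smul_eq_zero_iff_right h1).1 ?_
    rw [key i j k k hij, sum_rEntry_col_self_smul, mul_one,
      show q - q⁻¹ * q ^ 2 = 0 by field_simp; ring, zero_smul]
  · intro i j k l hij hkl
    refine smul_right_injective A h1 ?_
    simp only []
    rw [smul_comm _ (-q)⁻¹, key i j k l hij, key i j l k hij, sum_rEntry_col_smul _ _ hkl.ne,
      sum_rEntry_col_smul _ _ hkl.ne', if_pos hkl, if_neg hkl.not_gt, smul_add, smul_smul,
      smul_smul, add_comm]
    congr 2 <;> field_simp <;> ring

theorem scale_mul (s : PM) (c d : ℂ) : s.scale (c * d) = s.scale c * s.scale d := by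
  cases s <;> simp [PM.scale, mul_comm]

/-- Specializing u = q²v leaves a common factor of the variable, which cancels, and what remains is
the relation with R - q²R̃. -/
theorem LMat_isQPair_aux (hq0 : q ≠ 0) (hq : q ^ 2 ≠ 1) (s : PM) :
    IsQPair (-q)⁻¹ ((LMat q n s).map (dilHom (s.scale (q ^ 2)))) (LMat q n s) := by
  refine isQPair_of_relation hq0 hq fun I J => ?_
  have h := congrArg (specialize (s.scale (q ^ 2))) (same_sign_relation_aux hq0 s I J)
  have hX : ∀ F G : (Uq q n)⟦X⟧, PowerSeries.X * F = PowerSeries.X * G → F = G :=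
    fun F G h => PowerSeries.X_mul_cancel h
  simp only [map_sum, scalarSeries_rEntry_mul, map_sub, map_smul] at h
  cases s with
  | plus =>
    simp only [PM.forms, one_smul, scalarSeries_X, scalarSeries_inner_X, specialize_inner_X_mul,
      specialize_outer_X_mul, specialize_inner₁_mul_outer₂, specialize_outer₂_mul_inner₁,
      ← mul_smul_comm, ← mul_sub, ← Finset.mul_sum] at h
    have h' := hX _ _ h
    simpa only [rEntry, smul_eq_mul, sub_smul, mul_smul, one_smul, PM.scale, Matrix.map_apply,
      mul_sub, mul_smul_comm] using h'
  | minus =>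
    simp only [PM.forms, inv_one, one_smul, scalarSeries_X, scalarSeries_inner_X, specialize_inner_X_mul,
      specialize_outer_X_mul, specialize_inner₁_mul_outer₂, specialize_outer₂_mul_inner₁,
      ← mul_smul_comm, ← mul_sub, ← Finset.mul_sum] at h
    -- In the inverse variables the specialized pair (α, β) is (q⁻², 1); scaling by q² gives (1,
    -- q²).
    have h' := congrArg (fun F => q ^ 2 • F) (hX _ _ h)
    have hs : ∀ (a : ℂ) (F : (Uq q n)⟦X⟧), q ^ 2 • a • (q ^ 2)⁻¹ • F = a • F := fun a F => by
      rw [smul_comm, smul_inv_smul₀ (pow_ne_zero 2 hq0)]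
    simp only [mul_sub, mul_smul_comm, Finset.smul_sum, smul_sub, PM.scale, hs] at h'
    simpa only [rEntry, smul_eq_mul, sub_smul, mul_smul, one_smul, PM.scale, Matrix.map_apply,
      mul_sub, mul_smul_comm, smul_comm (q ^ 2) (_ : ℂ)] using h'

theorem LMat_isQPair (hq0 : q ≠ 0) (hq : q ^ 2 ≠ 1) (s : PM) {c d : ℂ} (h : c = q ^ 2 * d) :
    IsQPair (-q)⁻¹ ((LMat q n s).map (dilHom (s.scale c)))
      ((LMat q n s).map (dilHom (s.scale d))) := by
  have h1 := (LMat_isQPair_aux (n := n) hq0 hq s).map (dilHom (s.scale d))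
  rw [Matrix.map_map] at h1
  convert h1 using 2
  ext1 p
  rw [Function.comp_apply, dilHom_dilHom, ← scale_mul, h, mul_comm]

end Fusion

/-! ### The quantum determinant as the determinant of a chain -/

section QuantumDeterminant

variable {q : ℂ} {n : ℕ}

/-- The list `q^{2m-2}, …, q², 1` of dilation parameters. -/
noncomputable def qChain (q : ℂ) : ℕ → List ℂ
  | 0 => []
  | m + 1 => q ^ (2 * m) :: qChain q m

theorem length_qChain (q : ℂ) (m : ℕ) : (qChain q m).length = m := by
  induction m with
  | zero => rfl
  | succ m ih => rw [qChain, List.length_cons, ih]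

theorem isChain_qChain (q : ℂ) (m : ℕ) : (qChain q m).IsChain fun c d => c = q ^ 2 * d := by
  induction m with
  | zero => exact List.isChain_nil
  | succ m ih =>
    cases m with
    | zero => exact List.isChain_singleton _
    | succ m => exact List.isChain_cons_cons.2 ⟨by ring, ih⟩

/-- Peeling off the last parameter instead of the first exposes the common part q^{2m}, …, q² of the
two chains of minors. -/
theorem qChain_succ_eq_append (q : ℂ) (m : ℕ) :
    qChain q (m + 1) = (qChain q m).map (q ^ 2 * ·) ++ [1] := by
  induction m with
  | zero => simp [qChain]
  | succ m ih =>
    have h : q ^ (2 * (m + 1)) = q ^ 2 * q ^ (2 * m) := by ring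
    change _ :: qChain q (m + 1) = (q ^ 2 * q ^ (2 * m)) :: ((qChain q m).map (q ^ 2 * ·) ++ [1])
    rw [ih, h]

theorem qChain_eq_ofFn (q : ℂ) (m : ℕ) :
    qChain q m = List.ofFn fun k : Fin m => q ^ (2 * (m - 1 - (k : ℕ))) := by
  induction m with
  | zero => rfl
  | succ m ih =>
    rw [qChain, ih, List.ofFn_succ]
    congr 1
    congr 1
    funext k
    rw [Fin.val_succ, show m + 1 - 1 - (k + 1 : ℕ) = m - 1 - k by omega]

theorem prod_map_qChain {K : Type*} [CommMonoid K] (f : ℂ → K) (m : ℕ) :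
    ((qChain q m).map f).prod = ∏ k ∈ Finset.range m, f (q ^ (2 * k)) := by
  induction m with
  | zero => rfl
  | succ m ih => rw [qChain, List.map_cons, List.prod_cons, ih, Finset.prod_range_succ, mul_comm]

/-- The matrix `L^±(c u)`. -/
noncomputable def dilL (q : ℂ) (n : ℕ) (s : PM) (c : ℂ) : Matrix (Fin n) (Fin n) (Uq q n)⟦X⟧ :=
  (LMat q n s).map (dilHom (s.scale c))

theorem isChain_dilL (hq0 : q ≠ 0) (hq : q ^ 2 ≠ 1) (s : PM) {cs : List ℂ}
    (h : cs.IsChain fun c d => c = q ^ 2 * d) :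
    (cs.map (dilL q n s)).IsChain (IsQPair (-q)⁻¹) :=
  (List.isChain_map _).2 (h.imp fun _ _ h => LMat_isQPair hq0 hq s h)

theorem qdet_eq_chainDet (s : PM) :
    qdet q n s = chainDet (-q)⁻¹ ((qChain q n).map (dilL q n s)) := by
  rw [qChain_eq_ofFn, List.map_ofFn, chainDet_ofFn, qdet]
  refine Finset.sum_congr rfl fun σ _ => ?_
  rw [qSign_ofFn _ σ.injective, zpow_neg, inv_pow, zpow_natCast]
  congr 3
  funext k
  rw [dilate_eq, Function.comp_apply, dilL, Matrix.map_apply]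
  congr 3
  rw [← zpow_natCast]
  congr 1
  omega

/-- The embedding of series in the first variable, as an algebra homomorphism. -/
noncomputable def innerHom (U : Type*) [Ring U] [Algebra ℂ U] : U⟦X⟧ →ₐ[ℂ] U⟦X⟧⟦X⟧ where
  __ := (inner₁ : U⟦X⟧ →+* U⟦X⟧⟦X⟧)
  commutes' := inner₁_algebraMap

/-- The embedding of series in the second variable, as an algebra homomorphism. -/
noncomputable def outerHom (U : Type*) [Ring U] [Algebra ℂ U] : U⟦X⟧ →ₐ[ℂ] U⟦X⟧⟦X⟧ where
  __ := (outer₂ : U⟦X⟧ →+* U⟦X⟧⟦X⟧)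
  commutes' := outer₂_algebraMap

theorem map_qdet {A : Type*} [Ring A] [Algebra ℂ A] (φ : (Uq q n)⟦X⟧ →ₐ[ℂ] A) (s : PM) :
    φ (qdet q n s) = chainDet (-q)⁻¹ ((qChain q n).map fun c => (dilL q n s c).map φ) := by
  rw [qdet_eq_chainDet, map_chainDet, List.map_map]
  rfl

theorem isChain_map_dilL {A : Type*} [Ring A] [Algebra ℂ A] (φ : (Uq q n)⟦X⟧ →ₐ[ℂ] A)
    (hq0 : q ≠ 0) (hq : q ^ 2 ≠ 1) (s : PM) (m : ℕ) :
    ((qChain q m).map fun c => (dilL q n s c).map φ).IsChain (IsQPair (-q)⁻¹) :=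
  (List.isChain_map _).2 ((isChain_qChain q m).imp fun _ _ h => (LMat_isQPair hq0 hq s h).map φ)

/-! ### Centrality of the quantum determinant -/

theorem commute_of_regular {A : Type*} [Ring A] {x y z : A} (hz : IsLeftRegular z)
    (hzc : ∀ a, Commute z a) (h : z * x * y = y * (x * z)) : Commute x y := by
  refine hz ?_
  simp only []
  rw [← mul_assoc, h, ← mul_assoc, ← (hzc _).eq]

/-- The two variables are independent, so commutation of the series separates into commutation of
all pairs of coefficients. -/
theorem commute_coeff_of_commute {U : Type*} [Ring U] [Algebra ℂ U] {f g : U⟦X⟧}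
    (h : Commute (inner₁ f) (outer₂ g)) (a b : ℕ) :
    Commute (PowerSeries.coeff a f) (PowerSeries.coeff b g) := by
  have := congrArg (coeff₂ a b) h.eq
  rwa [coeff₂_inner₁_mul_outer₂, coeff₂_outer₂_mul_inner₁] at this

theorem isLeftRegular_list_prod {A : Type*} [Ring A] {xs : List A}
    (h : ∀ x ∈ xs, IsLeftRegular x) : IsLeftRegular xs.prod := by
  induction xs with
  | nil => exact isRegular_one.left
  | cons x xs ih =>
    rw [List.prod_cons]
    exact (h x List.mem_cons_self).mul (ih fun y hy => h y (List.mem_cons_of_mem _ hy))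

theorem forms_chain (hq0 : q ≠ 0) (s : PM) {c d : ℂ} (h : c = q ^ 2 * d) :
    (s.forms c).2 * (s.forms d).1 = q ^ 2 • ((s.forms c).1 * (s.forms d).2) := by
  subst h
  cases s with
  | plus =>
    simp only [PM.forms, smul_mul_assoc, mul_smul_comm, smul_smul]
    rw [mul_comm (PowerSeries.C _)]
  | minus =>
    simp only [PM.forms, smul_mul_assoc, mul_smul_comm, smul_smul]
    rw [mul_comm, mul_inv, mul_inv_cancel_left₀ (pow_ne_zero 2 hq0)]

theorem isLeftRegular_forms {U : Type*} [Ring U] [Algebra ℂ U] (s : PM) (c : ℂ) {a b : ℂ}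
    (ha : a ≠ 0) (hb : b ≠ 0) :
    IsLeftRegular (scalarSeries U (a • (s.forms c).1 - b • (s.forms c).2)) := by
  cases s with
  | plus =>
    simp only [PM.forms, map_sub, map_smul, scalarSeries_X, scalarSeries_inner_X]
    rw [smul_smul, sub_eq_add_neg, ← neg_smul]
    exact isLeftRegular_linear ha _
  | minus =>
    simp only [PM.forms, map_sub, map_smul, scalarSeries_X, scalarSeries_inner_X]
    rw [smul_smul, sub_eq_neg_add, ← neg_smul]
    exact isLeftRegular_linear (neg_ne_zero.2 hb) _

/-- The determinant of the R-chain is the same product of linear forms on both sides of the exchange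
relation. It is not invertible but it is regular and central, so it cancels. -/
theorem commute_qdet_same_sign (hq0 : q ≠ 0) (hq : q ^ 2 ≠ 1) (hn : 0 < n) (s : PM)
    (i j : Fin n) : Commute (inner₁ (qdet q n s)) (outer₂ (LMat q n s i j)) := by
  obtain ⟨m, rfl⟩ : ∃ m, n = m + 1 := ⟨n - 1, by omega⟩
  have h := exchange_fst (n := m + 1) (ks := (qChain q m).map (q ^ 2 * ·)) (k₀ := 1)
    (α := fun c => (s.forms c).1) (β := fun c => (s.forms c).2) (T := (LMat q (m + 1) s).map outer₂)
    (X := fun c => (dilL q (m + 1) s c).map (innerHom _)) (θ := scalarSeries _) (θ' := scalarSeries _) hq0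
    scalarSeries_commute scalarSeries_commute (by rw [List.length_map, length_qChain])
    (by
      rw [← qChain_succ_eq_append]
      exact (isChain_qChain q (m + 1)).imp fun _ _ h => forms_chain hq0 s h)
    (by
      rw [← qChain_succ_eq_append]
      exact isChain_map_dilL _ hq0 hq s _)
    (fun c I J => by
      have := same_sign_relation (n := m + 1) hq0 s c I J
      simp only [dilate_eq] at this
      exact this) i j
  rw [← qChain_succ_eq_append, ← map_qdet] at h
  refine commute_of_regular ?_ (scalarSeries_commute _) h
  rw [map_mul, map_list_prod]
  refine IsLeftRegular.mul (isLeftRegular_list_prod ?_) (isLeftRegular_forms s 1 hq0 (inv_ne_zero hq0))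
  intro x hx
  obtain ⟨y, hy, rfl⟩ := List.mem_map.1 hx
  obtain ⟨c, hc, rfl⟩ := List.mem_map.1 hy
  have := isLeftRegular_forms (U := Uq q (m + 1)) s c one_ne_zero one_ne_zero
  rwa [one_smul, one_smul] at this

theorem rescale_smul (c a : ℂ) (f : ℂ⟦X⟧) :
    PowerSeries.rescale c (a • f) = a • PowerSeries.rescale c f := by
  ext k
  simp only [PowerSeries.coeff_rescale, map_smul, smul_eq_mul]
  ring

theorem rescale_rEntry (c : ℂ) (α β : ℂ⟦X⟧) (I J : Fin n × Fin n) :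
    PowerSeries.rescale c (rEntry q α β I J)
      = rEntry q (PowerSeries.rescale c α) (PowerSeries.rescale c β) I J := by
  rw [rEntry, rEntry, map_sub, rescale_smul, rescale_smul]

theorem rescale_mul_X (c : ℂ) (f : ℂ⟦X⟧) : PowerSeries.rescale c (f * PowerSeries.X)
    = c • (PowerSeries.rescale c f * PowerSeries.X) := by
  rw [map_mul, PowerSeries.rescale_X, PowerSeries.smul_eq_C_mul]
  ring

theorem mixed_relation_dilInner (c : ℂ) (I J : Fin n × Fin n) :
    ∑ P, diagHom (qcInvU q n) qcInvU_commute
        (rEntry q (PowerSeries.rescale c (gSeries q n))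
          (PowerSeries.rescale c (gSeries q n * PowerSeries.X)) I P)
        * inner₁ (dilL q n .plus c P.1 J.1) * outer₂ (LMat q n .minus P.2 J.2)
      = ∑ P, outer₂ (LMat q n .minus I.2 P.2) * inner₁ (dilL q n .plus c I.1 P.1)
        * diagHom (qcU q n) qcU_commute
          (rEntry q (PowerSeries.rescale c (gSeries q n))
            (PowerSeries.rescale c (gSeries q n * PowerSeries.X)) P J) := by
  have h := congrArg (dilInner c) (mixed_relation (q := q) I J)
  simp only [map_sum, map_mul (dilInner c), dilInner_diagHom, dilInner_inner₁, dilInner_outer₂,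
    rescale_rEntry] at h
  exact h

/-- The inverse appears because the series L⁻ is written in v⁻¹: dilating v by c rescales x by c⁻¹.
-/
theorem mixed_relation_dilOuter (c : ℂ) (I J : Fin n × Fin n) :
    ∑ P, diagHom (qcInvU q n) qcInvU_commute
        (rEntry q (PowerSeries.rescale c⁻¹ (gSeries q n))
          (PowerSeries.rescale c⁻¹ (gSeries q n * PowerSeries.X)) I P)
        * inner₁ (LMat q n .plus P.1 J.1) * outer₂ (dilL q n .minus c P.2 J.2)
      = ∑ P, outer₂ (dilL q n .minus c I.2 P.2) * inner₁ (LMat q n .plus I.1 P.1)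
        * diagHom (qcU q n) qcU_commute
          (rEntry q (PowerSeries.rescale c⁻¹ (gSeries q n))
            (PowerSeries.rescale c⁻¹ (gSeries q n * PowerSeries.X)) P J) := by
  have h := congrArg (dilHom c⁻¹) (mixed_relation (q := q) I J)
  simp only [map_sum, map_mul (dilHom c⁻¹), dilOuter_diagHom, dilOuter_inner₁, dilOuter_outer₂,
    rescale_rEntry] at h
  exact h

theorem diagHom_complex_C {U : Type*} [Ring U] [Algebra ℂ U] (y : U) (hy : ∀ x, Commute y x)
    (c : ℂ) : diagHom y hy (PowerSeries.C c) = algebraMap ℂ U⟦X⟧⟦X⟧ c :=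
  (diagHom y hy).commutes c

theorem one_sub_linear (f : ℂ⟦X⟧) (c : ℂ) :
    PowerSeries.rescale c f - PowerSeries.rescale c (f * PowerSeries.X)
      = PowerSeries.rescale c f * (1 - PowerSeries.C c * PowerSeries.X) := by
  rw [map_mul, PowerSeries.rescale_X, mul_sub, mul_one]

theorem linear_factor (f : ℂ⟦X⟧) (c : ℂ) :
    q • PowerSeries.rescale c f - q⁻¹ • PowerSeries.rescale c (f * PowerSeries.X)
      = PowerSeries.rescale c (f * (PowerSeries.C q - PowerSeries.C q⁻¹ * PowerSeries.X)) := by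
  rw [← rescale_smul, ← rescale_smul, ← map_sub, PowerSeries.smul_eq_C_mul,
    PowerSeries.smul_eq_C_mul]
  congr 1
  ring

/-- Identifies the invariant series of the normalization step with the scalar in `exchange_fst`. -/
theorem normSeries_eq_prod (m : ℕ) : normSeries q (m + 1)
    = (((qChain q m).map (q ^ 2 * ·)).map fun c => PowerSeries.rescale c (gSeries q (m + 1))
        - PowerSeries.rescale c (gSeries q (m + 1) * PowerSeries.X)).prod
      * (q • PowerSeries.rescale 1 (gSeries q (m + 1))
        - q⁻¹ • PowerSeries.rescale 1 (gSeries q (m + 1) * PowerSeries.X)) := by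
  rw [List.map_map, prod_map_qChain]
  simp only [Function.comp_apply, one_sub_linear, linear_factor]
  rw [Finset.prod_mul_distrib, normSeries, Finset.prod_range_succ', Nat.add_sub_cancel, mul_zero,
    pow_zero]
  simp only [PowerSeries.rescale_one, RingHom.id_apply, ← pow_add, mul_add_one, add_comm]
  ring

/-- For the second tensor factor the parameters are inverted; up to the rescaling by q^{-2m} the
same factors occur in reversed order. -/
theorem rescale_normSeries_eq_prod (hq0 : q ≠ 0) (m : ℕ) :
    PowerSeries.rescale (q ^ (2 * m))⁻¹ (normSeries q (m + 1))
    = ((qChain q m).map fun c => PowerSeries.rescale c⁻¹ (gSeries q (m + 1))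
        - PowerSeries.rescale c⁻¹ (gSeries q (m + 1) * PowerSeries.X)).prod
      * (q • PowerSeries.rescale (q ^ (2 * m))⁻¹ (gSeries q (m + 1))
        - q⁻¹ • PowerSeries.rescale (q ^ (2 * m))⁻¹ (gSeries q (m + 1) * PowerSeries.X)) := by
  rw [normSeries_eq_prod, map_mul, List.map_map, prod_map_qChain, prod_map_qChain, map_prod,
    PowerSeries.rescale_one, RingHom.id_apply, RingHom.id_apply, ← Finset.prod_range_reflect,
    map_sub, rescale_smul, rescale_smul]
  congr 1
  refine Finset.prod_congr rfl fun k hk => ?_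
  have hk' : k < m := Finset.mem_range.1 hk
  have e : q ^ 2 * q ^ (2 * (m - 1 - k)) * (q ^ (2 * m))⁻¹ = (q ^ (2 * k))⁻¹ := by
    rw [mul_inv_eq_iff_eq_mul₀ (pow_ne_zero _ hq0), eq_inv_mul_iff_mul_eq₀ (pow_ne_zero _ hq0),
      ← pow_add, ← pow_add]
    congr 1
    omega
  simp only [Function.comp_apply, map_sub, PowerSeries.rescale_rescale, e]

theorem isLeftRegular_algebraMap {U : Type*} [Ring U] [Algebra ℂ U] {c : ℂ} (hc : c ≠ 0) :
    IsLeftRegular (algebraMap ℂ U⟦X⟧⟦X⟧ c) :=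
  ((hc.isUnit).map (algebraMap ℂ U⟦X⟧⟦X⟧)).isRegular.left

/-- The normalized R-chain has the constant determinant c₀, so its values at q^{-c} and q^c agree
and cancel. This is where the normalization by f is indispensable. -/
theorem commute_qdet_plus_minus (hq0 : q ≠ 0) (hq : ∀ m : ℕ, 0 < m → q ^ m ≠ 1) (hn : 0 < n)
    (i j : Fin n) : Commute (inner₁ (qdet q n .plus)) (outer₂ (LMat q n .minus i j)) := by
  obtain ⟨c₀, hc₀, hnorm⟩ := normSeries_eq hq0 hq hn
  obtain ⟨m, rfl⟩ : ∃ m, n = m + 1 := ⟨n - 1, by omega⟩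
  have h := exchange_fst (n := m + 1) (ks := (qChain q m).map (q ^ 2 * ·)) (k₀ := 1)
    (α := fun c => PowerSeries.rescale c (gSeries q (m + 1)))
    (β := fun c => PowerSeries.rescale c (gSeries q (m + 1) * PowerSeries.X))
    (T := (LMat q (m + 1) .minus).map outer₂)
    (X := fun c => (dilL q (m + 1) .plus c).map (innerHom _))
    (θ := diagHom (qcInvU q (m + 1)) qcInvU_commute) (θ' := diagHom (qcU q (m + 1)) qcU_commute)
    hq0 (diagHom_commute _ _) (diagHom_commute _ _) (by rw [List.length_map, length_qChain])
    (by
      rw [← qChain_succ_eq_append]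
      refine (isChain_qChain q (m + 1)).imp fun c d h => ?_
      rw [rescale_mul_X, rescale_mul_X, h, smul_mul_assoc, mul_smul_comm, smul_smul]
      congr 1
      ring)
    (by
      rw [← qChain_succ_eq_append]
      exact isChain_map_dilL _ hq0 (hq 2 two_pos) .plus _)
    (fun c I J => mixed_relation_dilInner c I J) i j
  rw [← qChain_succ_eq_append, ← map_qdet, ← normSeries_eq_prod, hnorm, diagHom_complex_C,
    diagHom_complex_C] at h
  exact commute_of_regular (isLeftRegular_algebraMap hc₀) (Algebra.commutes _) h

theorem commute_qdet_minus_plus (hq0 : q ≠ 0) (hq : ∀ m : ℕ, 0 < m → q ^ m ≠ 1) (hn : 0 < n)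
    (i j : Fin n) : Commute (inner₁ (LMat q n .plus i j)) (outer₂ (qdet q n .minus)) := by
  obtain ⟨c₀, hc₀, hnorm⟩ := normSeries_eq hq0 hq hn
  obtain ⟨m, rfl⟩ : ∃ m, n = m + 1 := ⟨n - 1, by omega⟩
  have h := exchange_snd (n := m + 1) (ks := qChain q m) (k₀ := q ^ (2 * m))
    (α := fun c => PowerSeries.rescale c⁻¹ (gSeries q (m + 1)))
    (β := fun c => PowerSeries.rescale c⁻¹ (gSeries q (m + 1) * PowerSeries.X))
    (T := (LMat q (m + 1) .plus).map inner₁)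
    (X := fun c => (dilL q (m + 1) .minus c).map (outerHom _))
    (θ := diagHom (qcInvU q (m + 1)) qcInvU_commute) (θ' := diagHom (qcU q (m + 1)) qcU_commute)
    hq0 (diagHom_commute _ _) (diagHom_commute _ _) (by rw [length_qChain])
    (by
      refine (isChain_qChain q (m + 1)).imp fun c d h => ?_
      rw [rescale_mul_X, rescale_mul_X, h, smul_mul_assoc, mul_smul_comm, smul_smul, mul_inv,
        mul_inv_cancel_left₀ (pow_ne_zero 2 hq0)]
      congr 1
      ring)
    (isChain_map_dilL _ hq0 (hq 2 two_pos) .minus (m + 1))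
    (fun c I J => mixed_relation_dilOuter c I J) i j
  have hC : PowerSeries.rescale (q ^ (2 * m))⁻¹ (PowerSeries.C c₀ : ℂ⟦X⟧) = PowerSeries.C c₀ := by
    simpa using rescale_linear (q ^ (2 * m))⁻¹ c₀ 0
  have e := rescale_normSeries_eq_prod hq0 m
  rw [hnorm, hC] at e
  rw [← qChain, ← map_qdet, ← e, diagHom_complex_C, diagHom_complex_C] at h
  refine (commute_of_regular (isLeftRegular_algebraMap hc₀) (Algebra.commutes _) ?_).symm
  rw [Algebra.commutes]
  refine h.symm.trans ?_
  rw [Algebra.commutes]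
  rfl

theorem commute_coeff_qdet (hq0 : q ≠ 0) (hq : ∀ m : ℕ, 0 < m → q ^ m ≠ 1) (hn : 0 < n) (s : PM)
    (r : ℕ) (x : Uq q n) : Commute (PowerSeries.coeff r (qdet q n s)) x := by
  have hl : ∀ (t : PM) (i j : Fin n) (k : ℕ),
      Commute (PowerSeries.coeff r (qdet q n s)) (l q n t i j k) := by
    intro t i j k
    have hk : l q n t i j k = PowerSeries.coeff k (LMat q n t i j) :=
      (PowerSeries.coeff_mk _ _).symm
    rw [hk]
    cases s <;> cases t
    · exact commute_coeff_of_commute (commute_qdet_same_sign hq0 (hq 2 two_pos) hn _ i j) r k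
    · exact commute_coeff_of_commute (commute_qdet_plus_minus hq0 hq hn i j) r k
    · exact (commute_coeff_of_commute (commute_qdet_minus_plus hq0 hq hn i j) k r).symm
    · exact commute_coeff_of_commute (commute_qdet_same_sign hq0 (hq 2 two_pos) hn _ i j) r k
  refine commute_of_commute_gen (fun g => ?_) x
  cases g with
  | lp i j k => exact hl .plus i j k
  | lm i j k => exact hl .minus i j k
  | qc => exact (qcU_commute _).symm
  | qcInv => exact (qcInvU_commute _).symm

theorem qdet_commute (hq0 : q ≠ 0) (hq : ∀ m : ℕ, 0 < m → q ^ m ≠ 1) (hn : 0 < n) (s : PM)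
    (F : (Uq q n)⟦X⟧) : Commute (qdet q n s) F :=
  commute_of_commute_coeff (fun r x => commute_coeff_qdet hq0 hq hn s r x) F

end QuantumDeterminant

/-! ### Invertibility -/

section Invertibility

variable {q : ℂ} {n : ℕ}

/-- A matrix of series whose constant term is triangular with invertible diagonal entries, with
respect to some well-founded order of the indices. -/
structure IsTriangularAtZero {U : Type*} [Ring U] (M : Matrix (Fin n) (Fin n) U⟦X⟧)
    (r : Fin n → Fin n → Prop) : Prop where
  wf : WellFounded r
  off_diag : ∀ i j, i ≠ j → ¬ r i j → PowerSeries.constantCoeff (M i j) = 0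
  diag : ∀ i, IsUnit (PowerSeries.constantCoeff (M i i))

theorem constantCoeff_LMat (s : PM) (i j : Fin n) :
    PowerSeries.constantCoeff (LMat q n s i j) = l q n s i j 0 := by
  rw [← PowerSeries.coeff_zero_eq_constantCoeff_apply, LMat, Matrix.of_apply,
    PowerSeries.coeff_mk]

theorem exists_isTriangularAtZero_LMat (q : ℂ) (n : ℕ) (s : PM) :
    ∃ r, IsTriangularAtZero (LMat q n s) r := by
  have h1 : ∀ i, l q n .plus i i 0 * l q n .minus i i 0 = 1 := fun i => by
    have h := RingQuot.mkAlgHom_rel ℂ (Rel.lp_lm (q := q) i)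
    rwa [map_mul, map_one] at h
  have h2 : ∀ i, l q n .minus i i 0 * l q n .plus i i 0 = 1 := fun i => by
    have h := RingQuot.mkAlgHom_rel ℂ (Rel.lm_lp (q := q) i)
    rwa [map_mul, map_one] at h
  cases s with
  | plus =>
    refine ⟨(· < ·), wellFounded_lt, fun i j hij hr => ?_, fun i => ?_⟩
    · rw [constantCoeff_LMat]
      have h := RingQuot.mkAlgHom_rel ℂ (Rel.lp_zero (q := q) j i (by grind))
      rwa [map_zero] at h
    · rw [constantCoeff_LMat]
      exact ⟨⟨_, _, h1 i, h2 i⟩, rfl⟩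
  | minus =>
    refine ⟨(· > ·), wellFounded_gt, fun i j hij hr => ?_, fun i => ?_⟩
    · rw [constantCoeff_LMat]
      have h := RingQuot.mkAlgHom_rel ℂ (Rel.lm_zero (q := q) i j (by grind))
      rwa [map_zero] at h
    · rw [constantCoeff_LMat]
      exact ⟨⟨_, _, h2 i, h1 i⟩, rfl⟩

/-- Double induction, on the degree and then on the column along r: all terms but the diagonal one
drop out, and the diagonal constant term is a unit. It is used to make a left inverse two-sided. -/
theorem IsTriangularAtZero.eq_zero_of_mul_eq_zero {U : Type*} [Ring U]
    {M Z : Matrix (Fin n) (Fin n) U⟦X⟧} {r : Fin n → Fin n → Prop}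
    (hM : IsTriangularAtZero M r) (h : Z * M = 0) : Z = 0 := by
  ext k i N
  rw [Matrix.zero_apply, map_zero]
  induction N using Nat.strong_induction_on generalizing i with
  | _ N ihN =>
    induction i using hM.wf.induction with
    | _ j ihj =>
      have h0 := congrArg (PowerSeries.coeff N) (congrFun (congrFun h k) j)
      rw [Matrix.mul_apply, map_sum, Matrix.zero_apply, map_zero] at h0
      have h1 : ∀ i, PowerSeries.coeff N (Z k i * M i j)
          = PowerSeries.coeff N (Z k i) * PowerSeries.constantCoeff (M i j) := by
        intro i
        rw [PowerSeries.coeff_mul, Finset.sum_eq_single (N, 0)]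
        · rw [PowerSeries.coeff_zero_eq_constantCoeff_apply]
        · rintro ⟨a, b⟩ hab hne
          have hab' : a + b = N := Finset.HasAntidiagonal.mem_antidiagonal.1 hab
          have ha : a < N := by
            rcases Nat.eq_zero_or_pos b with rfl | hb
            · exact absurd (by rw [← hab', add_zero]) hne
            · omega
          rw [ihN a ha i, zero_mul]
        · simp
      simp only [h1] at h0
      rw [Finset.sum_eq_single j] at h0
      · exact (hM.diag j).mul_left_eq_zero.1 h0
      · intro i _ hij
        by_cases hr : r i j
        · rw [ihj i hr, zero_mul]
        · rw [hM.off_diag i j hij hr, mul_zero]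
      · simp

/-- If r (σ k) k, then σ fixes σ k by induction, and injectivity gives σ k = k. -/
theorem perm_eq_one_of_wellFounded {r : Fin n → Fin n → Prop} (hr : WellFounded r)
    (σ : Equiv.Perm (Fin n)) (h : ∀ k, σ k = k ∨ r (σ k) k) : σ = 1 := by
  ext1 k
  rw [Equiv.Perm.one_apply]
  induction k using hr.induction with
  | _ k ih =>
    rcases h k with h | h
    · exact h
    · exact σ.injective (ih _ h)

theorem constantCoeff_smul_complex {U : Type*} [Ring U] [Algebra ℂ U] (c : ℂ) (F : U⟦X⟧) :
    PowerSeries.constantCoeff (c • F) = c • PowerSeries.constantCoeff F := rfl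

theorem constantCoeff_dilate {U : Type*} [Ring U] [Algebra ℂ U] (s : PM) (c : ℂ) (F : U⟦X⟧) :
    PowerSeries.constantCoeff (dilate s c F) = PowerSeries.constantCoeff F := by
  rw [dilate_eq, ← PowerSeries.coeff_zero_eq_constantCoeff_apply, coeff_dilHom, pow_zero,
    one_smul, PowerSeries.coeff_zero_eq_constantCoeff_apply]

/-- In the constant term only the identity permutation survives triangularity, leaving a power of -q
times a product of invertible diagonal generators. -/
theorem isUnit_qdet (hq0 : q ≠ 0) (s : PM) : IsUnit (qdet q n s) := by
  obtain ⟨r, hr⟩ := exists_isTriangularAtZero_LMat q n s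
  have hL : ∀ σ : Equiv.Perm (Fin n), PowerSeries.constantCoeff
      (List.ofFn fun k : Fin n => dilate s (q ^ (2 * (n : ℤ) - 2 - 2 * ((k : ℕ) : ℤ)))
        (LMat q n s (σ k) k)).prod
      = (List.ofFn fun k : Fin n => PowerSeries.constantCoeff (LMat q n s (σ k) k)).prod := by
    intro σ
    rw [map_list_prod, List.map_ofFn]
    simp only [Function.comp_def, constantCoeff_dilate]
  rw [PowerSeries.isUnit_iff_constantCoeff, qdet, map_sum, Finset.sum_eq_single 1]
  · rw [constantCoeff_smul_complex, hL, Algebra.smul_def]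
    refine (((zpow_ne_zero _ (neg_ne_zero.2 hq0)).isUnit).map _).mul (List.prod_isUnit ?_)
    intro x hx
    obtain ⟨k, rfl⟩ := List.mem_ofFn.1 hx
    exact hr.diag k
  · intro σ _ hσ
    rw [constantCoeff_smul_complex, hL]
    obtain ⟨k, hk⟩ : ∃ k, ¬ (σ k = k ∨ r (σ k) k) := by
      by_contra! h
      exact hσ (perm_eq_one_of_wellFounded hr.wf σ fun k => by grind)
    rw [not_or] at hk
    rw [List.prod_eq_zero, smul_zero]
    exact List.mem_ofFn.2 ⟨k, hr.off_diag _ _ hk.1 hk.2⟩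
  · simp

end Invertibility

/-! ### The series `z^±(u)` -/

section CentralSeries

variable {q : ℂ}

/-- The ratio between complementary minors and entries of the inverse. -/
noncomputable def minorWeight (q : ℂ) (m i : ℕ) : ℂ := (-q)⁻¹ ^ (m - i) / (-q)⁻¹ ^ i

theorem minorWeight_ne_zero (hq0 : q ≠ 0) (m i : ℕ) : minorWeight q m i ≠ 0 :=
  have h : (-q)⁻¹ ≠ 0 := inv_ne_zero (neg_ne_zero.2 hq0)
  div_ne_zero (pow_ne_zero _ h) (pow_ne_zero _ h)

/-- This is where D comes from: its entries are the inverse weights of the expansion along the last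
matrix, up to a common sign. -/
theorem minorWeight_eq (hq0 : q ≠ 0) {m i : ℕ} (h : i ≤ m) :
    minorWeight q m i * q ^ ((m : ℤ) - 2 * i) = (-1) ^ m := by
  obtain ⟨k, rfl⟩ := Nat.exists_eq_add_of_le h
  have e : ((i + k : ℕ) : ℤ) - 2 * i = (k : ℤ) - (i : ℤ) := by push_cast; ring
  have h1 : ∀ j : ℕ, (-q)⁻¹ ^ j * q ^ j = (-1) ^ j := fun j => by
    rw [← mul_pow, inv_neg, neg_mul, inv_mul_cancel₀ hq0]
  have h2 : ((-1 : ℂ) ^ i) ^ 2 = 1 := by rw [← pow_mul, mul_comm, pow_mul]; simp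
  rw [e, minorWeight, Nat.add_sub_cancel_left, zpow_sub₀ hq0, zpow_natCast, zpow_natCast,
    div_mul_div_comm, h1, h1, div_eq_iff (pow_ne_zero i (by norm_num)), pow_add]
  linear_combination -(-1) ^ k * h2

/-- The chain `L^±(u q^{2m}), …, L^±(u q²)`. -/
noncomputable def minorChain (q : ℂ) (m : ℕ) (s : PM) :
    List (Matrix (Fin (m + 1)) (Fin (m + 1)) (Uq q (m + 1))⟦X⟧) :=
  ((qChain q m).map (q ^ 2 * ·)).map (dilL q (m + 1) s)

theorem dilL_one (n : ℕ) (s : PM) : dilL q n s 1 = LMat q n s := by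
  ext1 i j
  rw [dilL, Matrix.map_apply, scale_one, dilHom_one]

theorem minorChain_append (m : ℕ) (s : PM) : minorChain q m s ++ [LMat q (m + 1) s]
    = (qChain q (m + 1)).map (dilL q (m + 1) s) := by
  rw [qChain_succ_eq_append, List.map_append, List.map_singleton, dilL_one]
  rfl

theorem cons_minorChain (m : ℕ) (s : PM) :
    dilL q (m + 1) s (q ^ (2 * (m + 1))) :: minorChain q m s
      = ((qChain q (m + 1)).map (q ^ 2 * ·)).map (dilL q (m + 1) s) := by
  rw [qChain, List.map_cons, List.map_cons, minorChain,
    show q ^ (2 * (m + 1)) = q ^ 2 * q ^ (2 * m) by ring]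

theorem isChain_map_mul_qChain (q : ℂ) (m : ℕ) :
    ((qChain q m).map (q ^ 2 * ·)).IsChain fun c d => c = q ^ 2 * d :=
  (List.isChain_map _).2 ((isChain_qChain q m).imp fun _ _ h => by rw [h])

theorem chainDet_cons_minorChain (m : ℕ) (s : PM) :
    chainDet (-q)⁻¹ (dilL q (m + 1) s (q ^ (2 * (m + 1))) :: minorChain q m s)
      = dilate s (q ^ 2) (qdet q (m + 1) s) := by
  rw [dilate_eq, map_qdet, cons_minorChain, List.map_map]
  congr 1
  refine List.map_congr_left fun c _ => ?_
  ext1 i j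
  rw [Function.comp_apply, dilL, dilL, Matrix.map_apply, Matrix.map_apply, Matrix.map_apply,
    dilHom_dilHom, scale_mul]

theorem algSign_cons {n : ℕ} {A : Type*} [Ring A] [Algebra ℂ A] (p : ℂ) {ρ : Fin n → List (Fin n)}
    (hρ : ∀ k i, i ≠ k → i ∈ ρ k) (c k : Fin n) :
    algSign A p (c :: ρ k) = if c = k then algebraMap ℂ A (qSign p (k :: ρ k)) else 0 := by
  split_ifs with h
  · rw [h, algSign]
  · rw [algSign, qSign_of_not_nodup fun h' => (List.nodup_cons.1 h').1 (hρ k c h), map_zero]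

/-- The inverse of `L^±(u)` and the matrix `L^±(u q^{2n})^t D (L^±(u)⁻¹)^t`. -/
theorem exists_inverse_LMat (hq0 : q ≠ 0) (hq : q ^ 2 ≠ 1) (m : ℕ) (s : PM)
    (hcomm : ∀ F, Commute (qdet q (m + 1) s) F) :
    ∃ V, V * LMat q (m + 1) s = 1 ∧
      ((LMat q (m + 1) s).map (dilate s (q ^ (2 * (m + 1))))).transpose * DMat q (m + 1)
        * V.transpose
      = (dilate s (q ^ 2) (qdet q (m + 1) s) * Ring.inverse (qdet q (m + 1) s))
        • DMat q (m + 1) := by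
  have hp : (-q)⁻¹ ≠ 0 := inv_ne_zero (neg_ne_zero.2 hq0)
  choose ρ hnd hlen hmem using exists_complement_word (n := m + 1)
  obtain ⟨Q, hQ⟩ := isUnit_qdet (n := m + 1) hq0 s
  have hQi : ∀ F, Commute (↑Q⁻¹ : (Uq q (m + 1))⟦X⟧) F := fun F =>
    Commute.units_inv_left (by rw [hQ]; exact hcomm F)
  rw [← hQ, Ring.inverse_unit]
  set e : Fin (m + 1) → ℂ := fun k => qSign (-q)⁻¹ (k :: ρ k) with he
  have he0 : ∀ k, e k ≠ 0 := fun k => qSign_ne_zero hp (hnd k)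
  set S : Fin (m + 1) → Fin (m + 1) → (Uq q (m + 1))⟦X⟧ := fun i k =>
    chainMinor (-q)⁻¹ (minorChain q m s) i (ρ k) with hS
  -- The word ρ k misses only k, so an expansion along any other column c repeats a letter and
  -- vanishes.
  have hleft : ∀ c k, ∑ i, dilL q (m + 1) s (q ^ (2 * (m + 1))) i c * S i k
      = if c = k then e k • dilate s (q ^ 2) (qdet q (m + 1) s) else 0 := by
    intro c k
    have h := sum_mul_chainMinor hp (by
      rw [cons_minorChain]
      exact isChain_dilL (n := m + 1) hq0 hq s (isChain_map_mul_qChain q (m + 1))) (hlen k) c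
    rw [chainDet_cons_minorChain, algSign_cons _ hmem] at h
    rw [h, ite_mul, zero_mul, ← Algebra.smul_def]
  have hright : ∀ c k, ∑ i : Fin (m + 1), minorWeight q m i • (S i k * LMat q (m + 1) s i c)
      = if c = k then (minorWeight q m k * e k) • (Q : (Uq q (m + 1))⟦X⟧) else 0 := by
    intro c k
    have h := sum_chainMinor_mul hp (by
      rw [minorChain_append]
      exact isChain_dilL (n := m + 1) hq0 hq s (isChain_qChain q (m + 1)))
      (by simp [minorChain, length_qChain]) (hlen k) c
    rw [minorChain_append, ← qdet_eq_chainDet, algSign_cons _ hmem, ← hQ] at h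
    refine h.trans ?_
    split_ifs with hck
    · rw [← Algebra.smul_def, smul_smul, hck]
      rfl
    · rw [zero_mul, smul_zero]
  -- The adjugate: minors divided by qdet L(u), normalized by the weights and by the sign e k of the
  -- chosen word.
  refine ⟨Matrix.of fun k i => ((minorWeight q m k * e k)⁻¹ * minorWeight q m i) • (↑Q⁻¹ * S i k),
    ?_, ?_⟩
  · ext1 k c
    have h0 : minorWeight q m k * e k ≠ 0 := mul_ne_zero (minorWeight_ne_zero hq0 _ _) (he0 k)
    have h1 : ∀ i : Fin (m + 1), ((minorWeight q m k * e k)⁻¹ * minorWeight q m i) •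
        ((↑Q⁻¹ : (Uq q (m + 1))⟦X⟧) * S i k) * LMat q (m + 1) s i c
        = (minorWeight q m k * e k)⁻¹ • ((↑Q⁻¹ : (Uq q (m + 1))⟦X⟧) *
          minorWeight q m i • (S i k * LMat q (m + 1) s i c)) := fun i => by
      rw [smul_mul_assoc, mul_smul, mul_smul_comm, mul_assoc]
    simp only [Matrix.mul_apply, Matrix.of_apply, h1]
    rw [← Finset.smul_sum, ← Finset.mul_sum, hright, Matrix.one_apply]
    by_cases hck : c = k
    · rw [if_pos hck, if_pos hck.symm, mul_smul_comm, Units.inv_mul, inv_smul_smul₀ h0]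
    · rw [if_neg hck, if_neg (Ne.symm hck), mul_zero, smul_zero]
  · ext1 c k
    -- The entry of D cancels the i-dependent weight in the inverse, so the sum over i becomes the
    -- expansion along L(uq^{2n}).
    have hd : ∀ i : Fin (m + 1), q ^ (((m + 1 : ℕ) : ℤ) - 1 - 2 * ((i : ℕ) : ℤ))
        = (-1) ^ m * (minorWeight q m i)⁻¹ := fun i => by
      rw [eq_mul_inv_iff_mul_eq₀ (minorWeight_ne_zero hq0 _ _), mul_comm,
        ← minorWeight_eq hq0 (Nat.lt_succ_iff.1 i.2)]
      push_cast
      rw [add_sub_cancel_right]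
    have h1 : ∀ i : Fin (m + 1), dilate s (q ^ (2 * (m + 1))) (LMat q (m + 1) s i c) *
        algebraMap ℂ (Uq q (m + 1))⟦X⟧ (q ^ (((m + 1 : ℕ) : ℤ) - 1 - 2 * ((i : ℕ) : ℤ))) *
          ((minorWeight q m k * e k)⁻¹ * minorWeight q m i) •
            ((↑Q⁻¹ : (Uq q (m + 1))⟦X⟧) * S i k)
        = ((-1) ^ m * (minorWeight q m k * e k)⁻¹) • ((↑Q⁻¹ : (Uq q (m + 1))⟦X⟧) *
          (dilL q (m + 1) s (q ^ (2 * (m + 1))) i c * S i k)) := fun i => by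
      rw [← Algebra.commutes, ← Algebra.smul_def, smul_mul_smul_comm, hd, dilate_eq,
        (hQi _).left_comm]
      congr 1
      have := minorWeight_ne_zero hq0 m i
      field_simp
    have h2 : (Matrix.transpose ((LMat q (m + 1) s).map (dilate s (q ^ (2 * (m + 1)))))
        * DMat q (m + 1) * (Matrix.transpose (Matrix.of fun k i : Fin (m + 1) => ((minorWeight q m k * e k)⁻¹
          * minorWeight q m i) • ((↑Q⁻¹ : (Uq q (m + 1))⟦X⟧) * S i k)))) c k
        = ((-1) ^ m * (minorWeight q m k * e k)⁻¹) • ((↑Q⁻¹ : (Uq q (m + 1))⟦X⟧) *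
          ∑ i, dilL q (m + 1) s (q ^ (2 * (m + 1))) i c * S i k) := by
      rw [Matrix.mul_apply, Finset.mul_sum, Finset.smul_sum]
      refine Finset.sum_congr rfl fun i _ => ?_
      rw [DMat, Matrix.mul_diagonal]
      exact h1 i
    refine h2.trans ?_
    rw [hleft, Matrix.smul_apply, DMat, Matrix.diagonal_apply, smul_eq_mul]
    split_ifs with hck
    · subst hck
      rw [mul_smul_comm, smul_smul, hd, ← Algebra.commutes, ← Algebra.smul_def, (hQi _).eq, hQ]
      congr 1
      rw [mul_inv, mul_assoc, mul_assoc, inv_mul_cancel₀ (he0 c), mul_one]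
    · rw [mul_zero, mul_zero, smul_zero]

end CentralSeries

end QuantumAffine

/-! ### Conclusion: invertibility, uniqueness and centrality -/

theorem theorem2p4 (q : ℂ) (hq0 : q ≠ 0) (hq : ∀ m : ℕ, 0 < m → q ^ m ≠ 1)
    (n : ℕ) (hn : 0 < n) (s : QuantumAffine.PM) :
    IsUnit (QuantumAffine.LMat q n s) ∧
    IsUnit (QuantumAffine.qdet q n s) ∧
    (∃! z : PowerSeries (QuantumAffine.Uq q n), QuantumAffine.IsZSeries q n s z) ∧
    ∀ z : PowerSeries (QuantumAffine.Uq q n), QuantumAffine.IsZSeries q n s z →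
      (∀ r : ℕ, PowerSeries.coeff r z ∈ Subalgebra.center ℂ (QuantumAffine.Uq q n)) ∧
      z = QuantumAffine.dilate s (q ^ 2) (QuantumAffine.qdet q n s)
        * Ring.inverse (QuantumAffine.qdet q n s) := by
  open QuantumAffine in
  have hcomm := qdet_commute hq0 hq hn s
  have hunit := isUnit_qdet (n := n) hq0 s
  obtain ⟨m, rfl⟩ : ∃ m, n = m + 1 := ⟨n - 1, by omega⟩
  obtain ⟨V, hV, hz⟩ := exists_inverse_LMat hq0 (hq 2 two_pos) m s hcomm
  obtain ⟨r, hr⟩ := exists_isTriangularAtZero_LMat q (m + 1) s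
  -- (LV - 1)L = L(VL) - L = 0, and L has no nonzero left annihilator.
  have hV' : LMat q (m + 1) s * V = 1 := by
    refine sub_eq_zero.1 (hr.eq_zero_of_mul_eq_zero ?_)
    rw [sub_mul, mul_assoc, hV, mul_one, one_mul, sub_self]
  have hinv : Ring.inverse (LMat q (m + 1) s) = V :=
    Ring.inverse_unit (⟨LMat q (m + 1) s, V, hV', hV⟩ : (Matrix _ _ _)ˣ)
  have hex : IsZSeries q (m + 1) s (dilate s (q ^ 2) (qdet q (m + 1) s)
      * Ring.inverse (qdet q (m + 1) s)) := by
    rw [IsZSeries, hinv]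
    exact hz
  have huniq : ∀ z z', IsZSeries q (m + 1) s z → IsZSeries q (m + 1) s z' → z = z' := by
    intro z z' h h'
    -- One diagonal entry suffices, since the entries of D are invertible scalars.
    have h0 := congrFun (congrFun (h.symm.trans h') 0) 0
    rw [Matrix.smul_apply, Matrix.smul_apply, DMat, Matrix.diagonal_apply_eq, smul_eq_mul,
      smul_eq_mul] at h0
    exact (((zpow_ne_zero _ hq0).isUnit).map (algebraMap ℂ _)).mul_right_cancel h0
  refine ⟨⟨⟨_, V, hV', hV⟩, rfl⟩, hunit, ⟨_, hex, fun z h => huniq _ _ h hex⟩, fun z h => ?_⟩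
  obtain rfl := huniq _ _ h hex
  refine ⟨fun k => ?_, rfl⟩
  rw [Subalgebra.mem_center_iff]
  intro x
  refine (commute_coeff (fun y => ?_) k x).symm.eq
  refine Commute.mul_left ?_ ?_
  · refine commute_of_commute_coeff (fun i y => ?_) _
    rw [dilate_eq, coeff_dilHom]
    exact (commute_coeff_qdet hq0 hq hn s i y).smul_left _
  · obtain ⟨Q, hQ⟩ := hunit
    rw [← hQ, Ring.inverse_unit]
    exact Commute.units_inv_left (by rw [hQ]; exact hcomm _)
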